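/- Let $n\ge 1$ and $1\le k<d$ be integers and let $P=(p_1,\dots,p_n)$ be points of $\mathbb{R}^d$. Let $$\mathcal D=\{(X,y)\in\mathbb{R}^{d\times d}\times\mathbb{R}^n : X^T=X,\ \operatorname{tr}X=d-k,\ 0\prec X\prec I_d,\ \|Xp_i\|_2<y_i\ (1\le i\le n)\},$$ and for $t>0$ let $G_t:\mathcal D\to\mathbb{R}$, $$G_t(X,y)=t\sum_{i=1}^n y_i-\sum_{i=1}^n\ln\bigl(y_i^2-\|Xp_i\|_2^2\bigr)-\ln\det X-\ln\det(I_d-X).$$ For $z\in\mathcal D$ the Newton decrement is $\lambda(G_t,z)=\sqrt{\nabla G_t(z)^T(\nabla^2G_t(z))^{-1}\nabla G_t(z)}$, where the gradient and the Hessian are those of $G_t$ as a function on the affine subspace $\{X^T=X,\ \operatorname{tr}X=d-k\}$. Put $$X_0=\tfrac{d-k}{d}I_d,\qquad (y_0)_i=\sqrt{\|X_0p_i\|_2^2+e},\qquad t_0=\frac{2n}{\sum_{i=1}^n (y_0)_i}.$$ (a) $(X_0,y_0)\in\mathcal D$, the function $G_{t_0}$ is bounded below on $\mathcal D$, and if $t_0>1$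 then $$G_{t_0}(X_0,y_0)-\inf_{\mathcal D}G_{t_0}\le 2n+4d\ln d .$$ (b) Consider the real RAM: a random access machine with memory cells for natural numbers and for real numbers, which performs the operations $+,-,\cdot$ on natural numbers, the operations $+,-,\cdot,/,\sqrt{\ }$ on reals, comparisons, indirect reads and writes, the conversion of a natural number to a real, and the use of the constant $e$, exactly and at unit cost. Let $\omega$ be a real number such that invertible real $m\times m$ matrices can be inverted on this machine in $O(m^\omega)$ time (by one program for all $m\ge1$, whatever the initial contents of its working memory). Then there is one program that, given any $n\ge1$, any $1\le k<d$ and any $P\in(\mathbb{R}^d)^n$ (whatever the initial contents of the other cells), computes a pair $(X_{t_0},y_{t_0})\in\mathcal D$ with $$\lambda\bigl(G_{t_0},(X_{t_0},y_{t_0})\bigr)\le 0.01$$ in time $O\bigl((n+d^2)^\omega\,(n+d\log d)\bigr)$; the constant in the $O$ does not depend on $n$, $d$, $k$ or $P$. -/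

import Mathlib

open scoped Gradient

noncomputable section

namespace KSM

/-! ### The barrier problem -/

/-- The Euclidean space `ℝ^{d×d} × ℝ^n` of pairs `(X, y)`, with `X` stored entrywise. -/
abbrev Point (n d : ℕ) : Type := EuclideanSpace ℝ ((Fin d × Fin d) ⊕ Fin n)

/-- The matrix component `X` of `z = (X, y)`. -/
def Point.X {n d : ℕ} (z : Point n d) : Matrix (Fin d) (Fin d) ℝ :=
  Matrix.of fun i j => z (Sum.inl (i, j))

/-- The vector component `y` of `z = (X, y)`. -/
def Point.y {n d : ℕ} (z : Point n d) (i : Fin n) : ℝ := z (Sum.inr i)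

/-- The pair `(X, y)` as a point of the Euclidean space. -/
def mkPoint {n d : ℕ} (X : Matrix (Fin d) (Fin d) ℝ) (y : Fin n → ℝ) : Point n d :=
  WithLp.toLp 2 (Sum.elim (fun ij => X ij.1 ij.2) y)

/-- The vector `X p`, in Euclidean `ℝ^d`. -/
def applyTo {d : ℕ} (X : Matrix (Fin d) (Fin d) ℝ) (p : EuclideanSpace ℝ (Fin d)) :
    EuclideanSpace ℝ (Fin d) :=
  Matrix.toEuclideanLin X p

/-- The domain `𝒟(G)`: `X` symmetric, `tr X = d - k`, `0 ≺ X ≺ I`, `‖X p_i‖ < y_i` for all `i`.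
(`Matrix.PosDef` includes symmetry.) -/
def domain {n d : ℕ} (k : ℕ) (P : Fin n → EuclideanSpace ℝ (Fin d)) : Set (Point n d) :=
  {z | z.X.PosDef ∧ (1 - z.X).PosDef ∧ z.X.trace = (d : ℝ) - (k : ℝ) ∧
    ∀ i, ‖applyTo z.X (P i)‖ < z.y i}

/-- The directions of the affine hull of the domain: `Xᵀ = X` and `tr X = 0`. -/
def tangent (n d : ℕ) : Submodule ℝ (Point n d) where
  carrier := {z | (∀ i j, z.X i j = z.X j i) ∧ z.X.trace = 0}
  zero_mem' := by
    simp [Point.X, Matrix.trace]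
  add_mem' := by
    rintro a b ⟨ha, ha'⟩ ⟨hb, hb'⟩
    refine ⟨fun i j => ?_, ?_⟩
    · have h1 := ha i j
      have h2 := hb i j
      simp only [Point.X, Matrix.of_apply] at h1 h2
      simp [Point.X, h1, h2]
    · simp only [Point.X, Matrix.trace, Matrix.diag_apply, Matrix.of_apply] at ha' hb'
      simp [Point.X, Matrix.trace, Finset.sum_add_distrib, ha', hb']
  smul_mem' := by
    rintro c a ⟨ha, ha'⟩
    refine ⟨fun i j => ?_, ?_⟩
    · have h1 := ha i j
      simp only [Point.X, Matrix.of_apply] at h1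
      simp [Point.X, h1]
    · simp only [Point.X, Matrix.trace, Matrix.diag_apply, Matrix.of_apply] at ha'
      simp [Point.X, Matrix.trace, ← Finset.mul_sum, ha']

/-- The `t`-relaxation
`G_t(X,y) = t 1ᵀy - ∑ ln(y_i² - ‖X p_i‖²) - ln det X - ln det (I - X)`. -/
def relaxation {n d : ℕ} (P : Fin n → EuclideanSpace ℝ (Fin d)) (t : ℝ) (z : Point n d) : ℝ :=
  t * ∑ i, z.y i - ∑ i, Real.log (z.y i ^ 2 - ‖applyTo z.X (P i)‖ ^ 2)
    - Real.log z.X.det - Real.log (1 - z.X).det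

/-- The Newton decrement `√(∇φᵀ (∇²φ)⁻¹ ∇φ)` at `x` of a function `φ` on the affine subspace
`x + V`; the gradient and the Hessian are those of `φ` along `V`. -/
def newtonDecrement {E : Type*} [NormedAddCommGroup E] [InnerProductSpace ℝ E]
    [FiniteDimensional ℝ E] (V : Submodule ℝ E) (φ : E → ℝ) (x : E) : ℝ :=
  haveI : CompleteSpace V := FiniteDimensional.complete ℝ V
  let ψ : V → ℝ := fun v => φ (x + v)
  let hessian : V →L[ℝ] V := fderiv ℝ (fun v => ∇ ψ v) 0
  Real.sqrt (inner ℝ (∇ ψ 0) (hessian.inverse (∇ ψ 0)))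

/-- `λ(G_t, z)`. -/
def decrement {n d : ℕ} (P : Fin n → EuclideanSpace ℝ (Fin d)) (t : ℝ) (z : Point n d) : ℝ :=
  newtonDecrement (tangent n d) (relaxation P t) z

/-- `X₀ = ((d-k)/d) I`. -/
def X0 (d k : ℕ) : Matrix (Fin d) (Fin d) ℝ :=
  (((d : ℝ) - (k : ℝ)) / (d : ℝ)) • (1 : Matrix (Fin d) (Fin d) ℝ)

/-- `(y₀)_i = √(‖X₀ p_i‖² + e)`. -/
def y0 {n d : ℕ} (k : ℕ) (P : Fin n → EuclideanSpace ℝ (Fin d)) (i : Fin n) : ℝ :=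
  Real.sqrt (‖applyTo (X0 d k) (P i)‖ ^ 2 + Real.exp 1)

/-- `(X₀, y₀)`. -/
def initialPoint {n d : ℕ} (k : ℕ) (P : Fin n → EuclideanSpace ℝ (Fin d)) : Point n d :=
  mkPoint (X0 d k) (y0 k P)

/-- `t₀ = 2n / ∑ (y₀)_i`. -/
def t0 {n d : ℕ} (k : ℕ) (P : Fin n → EuclideanSpace ℝ (Fin d)) : ℝ :=
  2 * (n : ℝ) / ∑ i, y0 k P i

/-! ### The real RAM

Unit-cost random access machine with exact real arithmetic, programmed in a structured language.
Memory consists of arrays of natural numbers and arrays of reals; the name of an array is a fixed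
number in the program text, the index into it is computed at run time. A scalar variable is a cell
with a constant index. -/

/-- A memory: `nat b i` and `real b i` are the cells with index `i` of the arrays named `b`. -/
structure Memory where
  /-- the arrays of natural numbers -/
  nat : ℕ → ℕ → ℕ
  /-- the arrays of real numbers -/
  real : ℕ → ℕ → ℝ

/-- Expressions for natural numbers. -/
inductive NExp where
  | lit (c : ℕ)
  | get (b : ℕ) (i : NExp)
  | add (u v : NExp)
  | sub (u v : NExp)
  | mul (u v : NExp)

/-- Expressions for real numbers; the constants are the natural numbers and Euler's number. -/
inductive RExp where
  | ofNat (u : NExp)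
  | euler
  | get (b : ℕ) (i : NExp)
  | add (u v : RExp)
  | sub (u v : RExp)
  | mul (u v : RExp)
  | div (u v : RExp)
  | sqrt (u : RExp)

/-- Tests. -/
inductive Test where
  | natLt (u v : NExp)
  | realLt (u v : RExp)

/-- Programs. -/
inductive Prog where
  | skip
  | setNat (b : ℕ) (i u : NExp)
  | setReal (b : ℕ) (i : NExp) (u : RExp)
  | seq (p q : Prog)
  | ite (c : Test) (p q : Prog)
  | while (c : Test) (p : Prog)

/-- Value of an expression; subtraction of natural numbers is truncated at `0`. -/
def NExp.eval (s : Memory) : NExp → ℕ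
  | .lit c => c
  | .get b i => s.nat b (i.eval s)
  | .add u v => u.eval s + v.eval s
  | .sub u v => u.eval s - v.eval s
  | .mul u v => u.eval s * v.eval s

/-- Number of operations in an expression. -/
def NExp.cost : NExp → ℕ
  | .lit _ => 1
  | .get _ i => i.cost + 1
  | .add u v => u.cost + v.cost + 1
  | .sub u v => u.cost + v.cost + 1
  | .mul u v => u.cost + v.cost + 1

/-- Value of an expression; division by zero and the root of a negative number give `0`. -/
def RExp.eval (s : Memory) : RExp → ℝ
  | .ofNat u => (u.eval s : ℝ)
  | .euler => Real.exp 1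
  | .get b i => s.real b (i.eval s)
  | .add u v => u.eval s + v.eval s
  | .sub u v => u.eval s - v.eval s
  | .mul u v => u.eval s * v.eval s
  | .div u v => u.eval s / v.eval s
  | .sqrt u => Real.sqrt (u.eval s)

/-- Number of operations in an expression. -/
def RExp.cost : RExp → ℕ
  | .ofNat u => u.cost + 1
  | .euler => 1
  | .get _ i => i.cost + 1
  | .add u v => u.cost + v.cost + 1
  | .sub u v => u.cost + v.cost + 1
  | .mul u v => u.cost + v.cost + 1
  | .div u v => u.cost + v.cost + 1
  | .sqrt u => u.cost + 1

/-- The test succeeds. -/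
def Test.Holds (s : Memory) : Test → Prop
  | .natLt u v => u.eval s < v.eval s
  | .realLt u v => u.eval s < v.eval s

/-- Number of operations in a test. -/
def Test.cost : Test → ℕ
  | .natLt u v => u.cost + v.cost + 1
  | .realLt u v => u.cost + v.cost + 1

/-- Write `x` into the cell with index `i` of the array `b` of natural numbers. -/
def Memory.writeNat (s : Memory) (b i x : ℕ) : Memory :=
  { s with nat := Function.update s.nat b (Function.update (s.nat b) i x) }

/-- Write `x` into the cell with index `i` of the array `b` of real numbers. -/
def Memory.writeReal (s : Memory) (b i : ℕ) (x : ℝ) : Memory :=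
  { s with real := Function.update s.real b (Function.update (s.real b) i x) }

/-- `Exec p s s' τ`: the program `p`, started in the memory `s`, halts in the memory `s'` after
`τ` elementary operations. -/
inductive Exec : Prog → Memory → Memory → ℕ → Prop where
  | skip (s : Memory) : Exec .skip s s 1
  | setNat (s : Memory) (b : ℕ) (i u : NExp) :
      Exec (.setNat b i u) s (s.writeNat b (i.eval s) (u.eval s)) (i.cost + u.cost + 1)
  | setReal (s : Memory) (b : ℕ) (i : NExp) (u : RExp) :
      Exec (.setReal b i u) s (s.writeReal b (i.eval s) (u.eval s)) (i.cost + u.cost + 1)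
  | seq {p q : Prog} {s s' s'' : Memory} {τ τ' : ℕ} :
      Exec p s s' τ → Exec q s' s'' τ' → Exec (.seq p q) s s'' (τ + τ')
  | iteTrue {c : Test} {p q : Prog} {s s' : Memory} {τ : ℕ} :
      c.Holds s → Exec p s s' τ → Exec (.ite c p q) s s' (c.cost + τ)
  | iteFalse {c : Test} {p q : Prog} {s s' : Memory} {τ : ℕ} :
      ¬ c.Holds s → Exec q s s' τ → Exec (.ite c p q) s s' (c.cost + τ)
  | whileTrue {c : Test} {p : Prog} {s s' s'' : Memory} {τ τ' : ℕ} :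
      c.Holds s → Exec p s s' τ → Exec (.while c p) s' s'' τ' →
      Exec (.while c p) s s'' (c.cost + τ + τ')
  | whileFalse {c : Test} {p : Prog} {s : Memory} :
      ¬ c.Holds s → Exec (.while c p) s s c.cost

/-- Real `m × m` matrices can be inverted in `O(m^ω)` time: one program, given `m` and an
invertible matrix `A` (row by row in the real array `0`), writes `A⁻¹` (row by row) into the real
array `1`. As for every subroutine, the contents of all other cells at the start are arbitrary. -/
def InversionTime (ω : ℝ) : Prop :=
  ∃ (inv : Prog) (C : ℝ), ∀ (m : ℕ), 1 ≤ m → ∀ A : Matrix (Fin m) (Fin m) ℝ, IsUnit A.det →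
    ∀ s : Memory, s.nat 0 0 = m → (∀ i j : Fin m, s.real 0 (i * m + j) = A i j) →
      ∃ (s' : Memory) (τ : ℕ), Exec inv s s' τ ∧ (τ : ℝ) ≤ C * (m : ℝ) ^ ω ∧
        ∀ i j : Fin m, s'.real 1 (i * m + j) = A⁻¹ i j

/-- The memory holds the input: `n, d, k` in the array `0` of natural numbers, and the coordinates
of `p_1, …, p_n`, point by point, in the real array `0`. All other cells are arbitrary. -/
def HoldsInput {n d : ℕ} (s : Memory) (k : ℕ) (P : Fin n → EuclideanSpace ℝ (Fin d)) : Prop :=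
  s.nat 0 0 = n ∧ s.nat 0 1 = d ∧ s.nat 0 2 = k ∧
    ∀ (i : Fin n) (j : Fin d), s.real 0 (i * d + j) = P i j

/-- The memory holds the output `(X, y)`: `X` row by row in the real array `1`, and `y` in the real
array `2`. -/
def HoldsOutput {n d : ℕ} (s : Memory) (z : Point n d) : Prop :=
  (∀ i j : Fin d, s.real 1 (i * d + j) = z.X i j) ∧ ∀ i : Fin n, s.real 2 i = z.y i

end KSM

end

open scoped Gradient

noncomputable section

namespace KSM

/-! Along a line in the domain every barrier term splits into real linear factors: det(X + sU)
because one congruence diagonalizes both X and U (`exists_line_eigenvalues`), and y_i² - ‖X p_i‖²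
because the reversed Cauchy–Schwarz inequality makes its discriminant nonnegative
(`exists_lorentz_roots`). Hence G_t on the line is affine minus ∑ log(1 + s μ_j), and ∑ μ_j² is its
second derivative at s = 0 (`exists_line_factors`). Since -log(1 + x) ≤ -x + x² for |x| ≤ 1/2, a
step of squared Hessian norm at most 1/4 stays in the domain and changes G_t by at most the gradient
term plus that squared norm (`relaxation_step`).

Let N solve Hessian · N = gradient, let λ be the decrement and κ = 1/(1 + λ²). The damped step -κN
has squared Hessian norm κ(1 - κ) ≤ 1/4 and lowers G_t by at least (1 - κ)² (`newton_step`). As long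
as λ > 1/100 this exceeds a fixed constant, so the number of steps is governed by the distance from
the starting value to a lower bound of G_t. Such a bound is 2n + 2n ln(t/2) (`relaxation_ge`): both
determinants are at most 1, and ty - 2 ln y is minimal at y = 2/t. If t₀ > 1 it is nonnegative,
which gives (a). In (b) t₀ is arbitrary, so the iteration starts not at the point of (a) but at y_i
= ‖X₀p_i‖ + 2/t₀, where the distance is at most 2n + 2d ln d for every t₀
(`relaxation_startPoint_le`).

A step costs one inversion of order d² + 2n + 2 and two of order d. The large matrix is a bordered
Newton system: one auxiliary unknown per cone replaces the rank-one terms of the Hessian, so each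
entry takes constant time from precomputed tables, and a scale unknown is chosen so that the last
column of the inverse contains the damped step and the corner is -κ (`kkt_weak`, `kkt_isUnit_det`).
The matrix unknown ranges over all d × d matrices; the Hessian form is extended to them so as to
stay definite and invariant under transposition, which forces the solution to be symmetric. All
other work is quadratic in n + d² and is absorbed because ω ≥ 2 (`InversionTime.two_le`). The
inversion program is a black box, but it writes only to arrays whose names lie below a bound
(`Exec.frame`); the working data is kept above it. -/

/-- Simultaneous diagonalization by congruence. -/
theorem exists_congruence {ι : Type*} [Fintype ι] [DecidableEq ι] {X U : Matrix ι ι ℝ}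
    (hX : X.PosDef) (hU : U.IsSymm) :
    ∃ (R : Matrix ι ι ℝ) (μ : ι → ℝ), IsUnit R.det ∧ X = R * R.transpose ∧
      U = R * Matrix.diagonal μ * R.transpose := by
  have hXs := hX.1
  let Q : Matrix ι ι ℝ := hXs.eigenvectorUnitary
  let D : Matrix ι ι ℝ := Matrix.diagonal fun i => Real.sqrt (hXs.eigenvalues i)
  let A : Matrix ι ι ℝ := Q * D
  have hXA : X = A * A.transpose := by
    have h := hXs.spectral_theorem
    rw [Unitary.conjStarAlgAut_apply] at h
    conv_lhs => rw [h]
    have hDD : D * D = Matrix.diagonal (RCLike.ofReal ∘ hXs.eigenvalues) := by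
      simp only [D, Matrix.diagonal_mul_diagonal]
      congr 1
      funext i
      simpa using Real.mul_self_sqrt (hX.eigenvalues_pos i).le
    simp only [A, Matrix.transpose_mul]
    rw [show Q * D * (D.transpose * Q.transpose) = Q * (D * D) * Q.transpose by
      simp only [D, Matrix.diagonal_transpose, Matrix.mul_assoc], hDD]
    simp [Q, Matrix.star_eq_conjTranspose]
  have hAu : IsUnit A.det := by
    have : A.det * A.det = X.det := by
      conv_rhs => rw [hXA]
      simp
    have h2 := hX.det_pos
    rw [isUnit_iff_ne_zero]
    intro h0
    rw [h0] at this
    linarith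
  -- With X = A Aᵀ, the pulled-back U is still symmetric; an orthogonal diagonalization `Z` of it
  -- leaves A Aᵀ unchanged, so R = A Z serves both matrices.
  let W := A⁻¹ * U * (A⁻¹).transpose
  have hW : W.IsHermitian := by
    unfold Matrix.IsHermitian
    simp only [W, Matrix.conjTranspose_eq_transpose_of_trivial, Matrix.transpose_mul,
      Matrix.transpose_transpose, hU.eq, Matrix.mul_assoc]
  let Z : Matrix ι ι ℝ := hW.eigenvectorUnitary
  have hZ1 : Z * Z.transpose = 1 := by
    have := Unitary.mul_star_self_of_mem hW.eigenvectorUnitary.2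
    simpa [Matrix.star_eq_conjTranspose] using this
  refine ⟨A * Z, hW.eigenvalues, ?_, ?_, ?_⟩
  · rw [Matrix.det_mul]
    refine hAu.mul ?_
    have := congrArg Matrix.det hZ1
    rw [Matrix.det_mul, Matrix.det_one] at this
    exact IsUnit.of_mul_eq_one _ this
  · rw [Matrix.transpose_mul, Matrix.mul_assoc, ← Matrix.mul_assoc Z, hZ1, Matrix.one_mul]
    exact hXA
  · have h := hW.spectral_theorem
    rw [Unitary.conjStarAlgAut_apply] at h
    have h' : Z * Matrix.diagonal hW.eigenvalues * Z.transpose = W := by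
      conv_rhs => rw [h]
      simp [Z, Matrix.star_eq_conjTranspose]
    have hAA : A * A⁻¹ = 1 := Matrix.mul_nonsing_inv _ hAu
    have hAAt : (A⁻¹).transpose * A.transpose = 1 := by
      rw [← Matrix.transpose_mul, hAA, Matrix.transpose_one]
    calc U = (A * A⁻¹) * U * ((A⁻¹).transpose * A.transpose) := by rw [hAA, hAAt]; simp
      _ = A * W * A.transpose := by simp only [W, Matrix.mul_assoc]
      _ = A * (Z * Matrix.diagonal hW.eigenvalues * Z.transpose) * A.transpose :=
          congrArg (fun B => A * B * A.transpose) h'.symm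
      _ = _ := by simp only [Matrix.transpose_mul, Matrix.mul_assoc]

/-! ### Determinants and trace forms along lines of symmetric matrices. -/

section Congruence

variable {ι : Type*} [Fintype ι] [DecidableEq ι]

theorem congruence_line (R : Matrix ι ι ℝ) (μ : ι → ℝ) (s : ℝ) :
    R * R.transpose + s • (R * Matrix.diagonal μ * R.transpose) =
      R * Matrix.diagonal (fun j => 1 + s * μ j) * R.transpose := by
  have : Matrix.diagonal (fun j => 1 + s * μ j) = 1 + s • Matrix.diagonal μ := by
    rw [← Matrix.diagonal_one, ← Matrix.diagonal_smul, Matrix.diagonal_add]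
    rfl
  rw [this, Matrix.mul_add, Matrix.add_mul, Matrix.mul_one, Matrix.mul_smul, Matrix.smul_mul]

/-- The determinant and the trace forms along a line of symmetric matrices. -/
theorem exists_line_eigenvalues {X U : Matrix ι ι ℝ} (hX : X.PosDef) (hU : U.IsSymm) :
    ∃ μ : ι → ℝ, (∀ s : ℝ, (X + s • U).det = X.det * ∏ j, (1 + s * μ j)) ∧
      (∀ s : ℝ, (∀ j, 0 < 1 + s * μ j) → (X + s • U).PosDef) ∧
      ∑ j, μ j = (X⁻¹ * U).trace ∧
      ∑ j, μ j ^ 2 = (U.transpose * X⁻¹ * U * X⁻¹).trace := by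
  obtain ⟨R, μ, hR, rfl, rfl⟩ := exists_congruence hX hU
  have hRt : IsUnit R.transpose.det := by rwa [Matrix.det_transpose]
  have h1 : R⁻¹ * R = 1 := Matrix.nonsing_inv_mul _ hR
  have h2 : R.transpose * R.transpose⁻¹ = 1 := Matrix.mul_nonsing_inv _ hRt
  refine ⟨μ, fun s => ?_, fun s hs => ?_, ?_, ?_⟩
  · rw [congruence_line]
    simp only [Matrix.det_mul, Matrix.det_diagonal]
    ring
  · rw [congruence_line]
    have := (Matrix.PosDef.diagonal hs).mul_mul_conjTranspose_same (B := R) (by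
      exact Matrix.vecMul_injective_of_isUnit ((Matrix.isUnit_iff_isUnit_det _).2 hR))
    simpa using this
  · rw [Matrix.mul_inv_rev]
    have : R.transpose⁻¹ * R⁻¹ * (R * Matrix.diagonal μ * R.transpose) =
        R.transpose⁻¹ * (Matrix.diagonal μ * R.transpose) := by
      calc _ = R.transpose⁻¹ * (R⁻¹ * R) * (Matrix.diagonal μ * R.transpose) := by
            simp only [Matrix.mul_assoc]
        _ = _ := by rw [h1, Matrix.mul_one]
    rw [this, Matrix.trace_mul_comm, Matrix.mul_assoc, h2, Matrix.mul_one, Matrix.trace_diagonal]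
  · rw [Matrix.mul_inv_rev]
    have : (R * Matrix.diagonal μ * R.transpose).transpose * (R.transpose⁻¹ * R⁻¹) *
        (R * Matrix.diagonal μ * R.transpose) * (R.transpose⁻¹ * R⁻¹) =
        R * (Matrix.diagonal μ * Matrix.diagonal μ * R⁻¹) := by
      calc _ = R * Matrix.diagonal μ * (R.transpose * R.transpose⁻¹) * (R⁻¹ * R) *
          Matrix.diagonal μ * (R.transpose * R.transpose⁻¹) * R⁻¹ := by
            simp only [Matrix.mul_assoc, Matrix.transpose_mul, Matrix.transpose_transpose,
              Matrix.diagonal_transpose]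
        _ = _ := by rw [h1, h2]; simp only [Matrix.mul_one, Matrix.mul_assoc]
    rw [this, Matrix.trace_mul_comm, Matrix.mul_assoc, h1, Matrix.mul_one,
      Matrix.diagonal_mul_diagonal, Matrix.trace_diagonal]
    simp [sq]

/-- The form `tr (Uᵀ S U S)` is positive definite if `S⁻¹` is. -/
theorem trace_form_nonneg {X : Matrix ι ι ℝ} (hX : X.PosDef) (U : Matrix ι ι ℝ) :
    0 ≤ (U.transpose * X⁻¹ * U * X⁻¹).trace ∧
      ((U.transpose * X⁻¹ * U * X⁻¹).trace = 0 → U = 0) := by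
  obtain ⟨R, μ, hR, hXR, -⟩ := exists_congruence hX.inv (U := 0) (by simp [Matrix.IsSymm])
  rw [hXR]
  have hRt : IsUnit R.transpose.det := by rwa [Matrix.det_transpose]
  -- With X⁻¹ = R Rᵀ the form is the squared Frobenius norm of Rᵀ U R.
  have key : (U.transpose * (R * R.transpose) * U * (R * R.transpose)).trace =
      ((R.transpose * U * R).transpose * (R.transpose * U * R)).trace := by
    rw [← Matrix.mul_assoc, Matrix.trace_mul_comm]
    simp only [Matrix.mul_assoc, Matrix.transpose_mul, Matrix.transpose_transpose]
  rw [key]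
  constructor
  · simp only [Matrix.trace, Matrix.diag_apply, Matrix.mul_apply, Matrix.transpose_apply]
    exact Finset.sum_nonneg fun i _ => Finset.sum_nonneg fun j _ => mul_self_nonneg _
  · intro h
    have h0 := (Matrix.trace_conjTranspose_mul_self_eq_zero_iff
      (A := R.transpose * U * R)).1 (by simpa using h)
    have h1 : R * R⁻¹ = 1 := Matrix.mul_nonsing_inv _ hR
    have h2 : R.transpose⁻¹ * R.transpose = 1 := Matrix.nonsing_inv_mul _ hRt
    calc U = (R.transpose⁻¹ * R.transpose) * U * (R * R⁻¹) := by rw [h1, h2]; simp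
      _ = R.transpose⁻¹ * (R.transpose * U * R) * R⁻¹ := by simp only [Matrix.mul_assoc]
      _ = 0 := by rw [h0]; simp

end Congruence

/-! ### The Lorentz cone. -/

/-- The reversed Cauchy–Schwarz inequality of the Lorentz cone. -/
theorem lorentz_discriminant {E : Type*} [NormedAddCommGroup E] [InnerProductSpace ℝ E]
    {y η : ℝ} {w u : E} (h : ‖w‖ < y) :
    (y ^ 2 - ‖w‖ ^ 2) * (η ^ 2 - ‖u‖ ^ 2) ≤ (y * η - inner ℝ w u) ^ 2 := by
  have hy : 0 < y := (norm_nonneg w).trans_lt h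
  have hwy : ‖w‖ ^ 2 ≤ y ^ 2 := by gcongr
  have hcs := real_inner_mul_inner_self_le (y • u - η • w) w
  have hn : ‖y • u - η • w‖ ^ 2 = y ^ 2 * ‖u‖ ^ 2 - 2 * (y * η * inner ℝ w u) + η ^ 2 * ‖w‖ ^ 2 := by
    rw [norm_sub_sq_real, norm_smul, norm_smul, real_inner_smul_left, real_inner_smul_right,
      real_inner_comm u w, mul_pow, mul_pow, Real.norm_eq_abs, Real.norm_eq_abs, sq_abs, sq_abs]
    ring
  have hi : inner ℝ (y • u - η • w) w = y * inner ℝ w u - η * ‖w‖ ^ 2 := by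
    rw [inner_sub_left, real_inner_smul_left, real_inner_smul_left, real_inner_comm,
      real_inner_self_eq_norm_sq]
  rw [real_inner_self_eq_norm_sq, real_inner_self_eq_norm_sq, hi] at hcs
  set a := ‖y • u - η • w‖ ^ 2 with ha
  have ha0 : 0 ≤ a := by positivity
  set b := inner ℝ w u
  -- The claim says that the Gram determinant of w and u is at most ‖yu - ηw‖². Multiplied by y² it
  -- becomes the Gram determinant of yu - ηw and w, which is at most ‖yu - ηw‖² ‖w‖².
  have h1 : y ^ 2 * (‖w‖ ^ 2 * ‖u‖ ^ 2 - b ^ 2) ≤ y ^ 2 * a := by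
    have : a * ‖w‖ ^ 2 ≤ a * y ^ 2 := by gcongr
    have e : y ^ 2 * (‖w‖ ^ 2 * ‖u‖ ^ 2 - b ^ 2) =
        a * ‖w‖ ^ 2 - (y * b - η * ‖w‖ ^ 2) * (y * b - η * ‖w‖ ^ 2) := by rw [hn]; ring
    linarith [mul_self_nonneg (y * b - η * ‖w‖ ^ 2)]
  have h2 := le_of_mul_le_mul_left h1 (by positivity)
  rw [hn] at h2
  nlinarith

/-- Factorization of the Lorentz form along a line. -/
theorem exists_lorentz_roots {E : Type*} [NormedAddCommGroup E] [InnerProductSpace ℝ E]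
    {y : ℝ} {w : E} (h : ‖w‖ < y) (η : ℝ) (u : E) :
    ∃ α β : ℝ, (∀ s : ℝ, (y + s * η) ^ 2 - ‖w + s • u‖ ^ 2 =
        (y ^ 2 - ‖w‖ ^ 2) * ((1 + s * α) * (1 + s * β))) ∧
      (∀ s : ℝ, 0 < 1 + s * α → 0 < 1 + s * β → ‖w + s • u‖ < y + s * η) ∧
      α + β = 2 / (y ^ 2 - ‖w‖ ^ 2) * (y * η - inner ℝ w u) ∧
      α ^ 2 + β ^ 2 = 4 / (y ^ 2 - ‖w‖ ^ 2) ^ 2 * (y * η - inner ℝ w u) ^ 2 -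
        2 / (y ^ 2 - ‖w‖ ^ 2) * (η ^ 2 - ‖u‖ ^ 2) := by
  have hy : 0 < y := (norm_nonneg w).trans_lt h
  have hq : 0 < y ^ 2 - ‖w‖ ^ 2 := by nlinarith [norm_nonneg w]
  have hd := lorentz_discriminant (η := η) (u := u) h
  set q := y ^ 2 - ‖w‖ ^ 2 with hqdef
  set σ := y * η - inner ℝ w u with hσ
  set r := Real.sqrt (σ ^ 2 - q * (η ^ 2 - ‖u‖ ^ 2)) with hr
  have hr2 : r ^ 2 = σ ^ 2 - q * (η ^ 2 - ‖u‖ ^ 2) := Real.sq_sqrt (by linarith)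
  have hline : ∀ s : ℝ, (y + s * η) ^ 2 - ‖w + s • u‖ ^ 2 =
      q * ((1 + s * ((σ + r) / q)) * (1 + s * ((σ - r) / q))) := by
    intro s
    rw [norm_add_sq_real, norm_smul, real_inner_smul_right, mul_pow, Real.norm_eq_abs, sq_abs]
    have e : q * ((1 + s * ((σ + r) / q)) * (1 + s * ((σ - r) / q))) =
        q + 2 * s * σ + s ^ 2 * ((σ ^ 2 - r ^ 2) / q) := by field_simp; ring
    rw [e, hr2]
    have e2 : (σ ^ 2 - (σ ^ 2 - q * (η ^ 2 - ‖u‖ ^ 2))) / q = η ^ 2 - ‖u‖ ^ 2 := by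
      field_simp; ring
    rw [e2, hσ, hqdef]
    ring
  refine ⟨(σ + r) / q, (σ - r) / q, hline, fun s ha hb => ?_, by field_simp; ring, ?_⟩
  · have hpos : 0 < (y + s * η) ^ 2 - ‖w + s • u‖ ^ 2 := by rw [hline]; positivity
    -- Positivity of the product of the factors places the point in the cone or in its negative.
    -- Positivity of their sum, which is this polar form with the interior point (w, y) up to a
    -- positive factor, rules out the negative.
    have hmid : 0 < y * (y + s * η) - inner ℝ w (w + s • u) := by
      have : y * (y + s * η) - inner ℝ w (w + s • u) =
          q * ((1 + s * ((σ + r) / q)) + (1 + s * ((σ - r) / q))) / 2 := by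
        rw [inner_add_right, real_inner_smul_right, real_inner_self_eq_norm_sq]
        have : q * ((1 + s * ((σ + r) / q)) + (1 + s * ((σ - r) / q))) / 2 = q + s * σ := by
          field_simp; ring
        rw [this, hσ, hqdef]; ring
      rw [this]; positivity
    by_contra hcon
    push Not at hcon
    have hneg : y + s * η < -‖w + s • u‖ := by
      by_contra h'
      push Not at h'
      have := sq_le_sq' h' hcon
      linarith
    have hcs := abs_real_inner_le_norm w (w + s • u)
    have h3 := neg_le_of_abs_le hcs
    have : ‖w‖ * ‖w + s • u‖ ≤ y * ‖w + s • u‖ := by gcongr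
    nlinarith
  · have : ((σ + r) / q) ^ 2 + ((σ - r) / q) ^ 2 = (2 * σ ^ 2 + 2 * r ^ 2) / q ^ 2 := by
      field_simp; ring
    rw [this, hr2]
    field_simp
    ring

/-! ### Coordinates of pairs (X, y). -/

section Coordinates

variable {n d : ℕ}

@[simp] theorem Point.X_add (z v : Point n d) : (z + v).X = z.X + v.X := rfl
@[simp] theorem Point.X_smul (s : ℝ) (v : Point n d) : (s • v).X = s • v.X := rfl
@[simp] theorem Point.X_sub (z v : Point n d) : (z - v).X = z.X - v.X := rfl
@[simp] theorem Point.y_add (z v : Point n d) (i : Fin n) : (z + v).y i = z.y i + v.y i := rfl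
@[simp] theorem Point.y_smul (s : ℝ) (v : Point n d) (i : Fin n) : (s • v).y i = s * v.y i := rfl
@[simp] theorem Point.y_sub (z v : Point n d) (i : Fin n) : (z - v).y i = z.y i - v.y i := rfl
@[simp] theorem mkPoint_X (X : Matrix (Fin d) (Fin d) ℝ) (y : Fin n → ℝ) :
    (mkPoint X y).X = X := rfl
@[simp] theorem mkPoint_y (X : Matrix (Fin d) (Fin d) ℝ) (y : Fin n → ℝ) (i : Fin n) :
    (mkPoint X y).y i = y i := rfl

theorem Point.ext_iff' {z v : Point n d} : z = v ↔ z.X = v.X ∧ ∀ i, z.y i = v.y i := by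
  constructor
  · rintro rfl; exact ⟨rfl, fun _ => rfl⟩
  · rintro ⟨h1, h2⟩
    ext i
    rcases i with ⟨a, b⟩ | i
    · exact congrFun (congrFun h1 a) b
    · exact h2 i

@[simp] theorem applyTo_add (X U : Matrix (Fin d) (Fin d) ℝ) (p : EuclideanSpace ℝ (Fin d)) :
    applyTo (X + U) p = applyTo X p + applyTo U p := by
  simp [applyTo]
@[simp] theorem applyTo_smul (s : ℝ) (X : Matrix (Fin d) (Fin d) ℝ)
    (p : EuclideanSpace ℝ (Fin d)) : applyTo (s • X) p = s • applyTo X p := by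
  simp [applyTo]
@[simp] theorem applyTo_zero (p : EuclideanSpace ℝ (Fin d)) : applyTo 0 p = 0 := by
  simp [applyTo]

theorem applyTo_apply (X : Matrix (Fin d) (Fin d) ℝ) (p : EuclideanSpace ℝ (Fin d)) (a : Fin d) :
    applyTo X p a = ∑ b, X a b * p b := by
  simp [applyTo, Matrix.toLpLin_apply, Matrix.mulVec, dotProduct]

theorem mem_tangent {v : Point n d} : v ∈ tangent n d ↔ v.X.IsSymm ∧ v.X.trace = 0 := by
  constructor
  · rintro ⟨h1, h2⟩
    exact ⟨Matrix.IsSymm.ext fun i j => h1 j i, h2⟩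
  · rintro ⟨h1, h2⟩
    exact ⟨fun i j => h1.apply j i, h2⟩

end Coordinates

/-! ### First and second differential of the relaxation, and its behaviour along lines. -/

section Forms

variable {n d : ℕ} (P : Fin n → EuclideanSpace ℝ (Fin d)) (t : ℝ) (z : Point n d)

/-- `y_i² - ‖X p_i‖²`. -/
def residual (i : Fin n) : ℝ := z.y i ^ 2 - ‖applyTo z.X (P i)‖ ^ 2

/-- The symmetric part of a matrix. -/
def symPart (U : Matrix (Fin d) (Fin d) ℝ) : Matrix (Fin d) (Fin d) ℝ :=
  (1 / 2 : ℝ) • (U + U.transpose)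

/-- Half the derivative of `y_i² - ‖X p_i‖²` in the direction `v`. -/
def slope (v : Point n d) (i : Fin n) : ℝ :=
  z.y i * v.y i - inner ℝ (applyTo z.X (P i)) (applyTo (symPart v.X) (P i))

/-- The differential of the relaxation. -/
def gradForm (v : Point n d) : ℝ :=
  t * ∑ i, v.y i - ∑ i, 2 / residual P z i * slope P z v i
    - (z.X⁻¹ * v.X).trace + ((1 - z.X)⁻¹ * v.X).trace

/-- The second differential of the relaxation on symmetric directions, extended to all
directions. -/
def hessForm (u v : Point n d) : ℝ :=
  (u.X.transpose * z.X⁻¹ * v.X * z.X⁻¹).trace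
    + (u.X.transpose * (1 - z.X)⁻¹ * v.X * (1 - z.X)⁻¹).trace
    + ∑ i, (1 / residual P z i * (inner ℝ (applyTo u.X (P i)) (applyTo v.X (P i))
          + inner ℝ (applyTo u.X.transpose (P i)) (applyTo v.X.transpose (P i)))
        - 2 / residual P z i * (u.y i * v.y i)
        + 4 / residual P z i ^ 2 * (slope P z u i * slope P z v i))

variable {P t z}

theorem symPart_of_isSymm {U : Matrix (Fin d) (Fin d) ℝ} (h : U.IsSymm) : symPart U = U := by
  rw [symPart, h.eq, ← two_smul ℝ, smul_smul]
  norm_num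

theorem residual_pos {k : ℕ} (hz : z ∈ domain k P) (i : Fin n) : 0 < residual P z i := by
  have := hz.2.2.2 i
  unfold residual
  nlinarith [norm_nonneg (applyTo z.X (P i))]

theorem slope_add (u v : Point n d) (i : Fin n) :
    slope P z (u + v) i = slope P z u i + slope P z v i := by
  simp only [slope, symPart, Point.X_add, Point.y_add, Matrix.transpose_add, applyTo_add,
    applyTo_smul, inner_add_right, real_inner_smul_right]
  ring

theorem slope_smul (s : ℝ) (v : Point n d) (i : Fin n) :
    slope P z (s • v) i = s * slope P z v i := by
  simp only [slope, symPart, Point.X_smul, Point.y_smul, Matrix.transpose_smul, applyTo_add,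
    applyTo_smul, inner_add_right, real_inner_smul_right]
  ring

theorem gradForm_smul (s : ℝ) (v : Point n d) :
    gradForm P t z (s • v) = s * gradForm P t z v := by
  simp only [gradForm, slope_smul, Point.X_smul, Point.y_smul, Matrix.mul_smul, Matrix.trace_smul,
    smul_eq_mul, ← Finset.mul_sum, mul_left_comm _ s]
  ring

theorem hessForm_add_left (u u' v : Point n d) :
    hessForm P z (u + u') v = hessForm P z u v + hessForm P z u' v := by
  simp only [hessForm, slope_add, Point.X_add, Point.y_add, Matrix.transpose_add, applyTo_add,
    inner_add_left, Matrix.trace_add, add_mul, mul_add,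
    Finset.sum_add_distrib, Finset.sum_sub_distrib]
  ring

theorem hessForm_smul_left (s : ℝ) (u v : Point n d) :
    hessForm P z (s • u) v = s * hessForm P z u v := by
  simp only [hessForm, slope_smul, Point.X_smul, Point.y_smul, Matrix.transpose_smul, applyTo_smul,
    real_inner_smul_left, Matrix.smul_mul, Matrix.trace_smul, smul_eq_mul, mul_add, Finset.mul_sum]
  congr 1
  refine Finset.sum_congr rfl fun i _ => ?_
  ring

theorem trace_form_comm {S : Matrix (Fin d) (Fin d) ℝ} (hS : S.IsSymm)
    (U V : Matrix (Fin d) (Fin d) ℝ) :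
    (U.transpose * S * V * S).trace = (V.transpose * S * U * S).trace := by
  rw [← Matrix.trace_transpose]
  simp only [Matrix.transpose_mul, Matrix.transpose_transpose, hS.eq]
  rw [Matrix.trace_mul_comm]
  simp only [Matrix.mul_assoc]

theorem isSymm_inv {k : ℕ} (hz : z ∈ domain k P) :
    z.X.IsSymm ∧ (z.X⁻¹).IsSymm ∧ ((1 - z.X)⁻¹).IsSymm := by
  refine ⟨?_, ?_, ?_⟩
  · simpa [Matrix.IsSymm, Matrix.IsHermitian] using hz.1.1
  · simpa [Matrix.IsSymm, Matrix.IsHermitian] using hz.1.inv.1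
  · simpa [Matrix.IsSymm, Matrix.IsHermitian] using hz.2.1.inv.1

theorem hessForm_comm {k : ℕ} (hz : z ∈ domain k P) (u v : Point n d) :
    hessForm P z u v = hessForm P z v u := by
  obtain ⟨-, h1, h2⟩ := isSymm_inv hz
  unfold hessForm
  rw [trace_form_comm h1 u.X v.X, trace_form_comm h2 u.X v.X]
  congr 1
  refine Finset.sum_congr rfl fun i _ => ?_
  rw [real_inner_comm, real_inner_comm (applyTo u.X.transpose (P i))]
  ring

theorem norm_midpoint_sq_le {E : Type*} [NormedAddCommGroup E] [InnerProductSpace ℝ E] (a b : E) :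
    2 * ‖(1 / 2 : ℝ) • (a + b)‖ ^ 2 ≤ ‖a‖ ^ 2 + ‖b‖ ^ 2 := by
  have h := parallelogram_law_with_norm ℝ a b
  rw [norm_smul, mul_pow]
  norm_num
  nlinarith [mul_self_nonneg ‖a - b‖]

/-- The trace forms control the matrix part. The reversed Cauchy–Schwarz inequality for the
symmetrized direction leaves at least 2(slope/residual)² of each cone term, and once the matrix part
vanishes this controls the vector part. Definiteness on nonsymmetric directions is what makes the
Newton system nonsingular. -/
theorem hessForm_pos {k : ℕ} (hz : z ∈ domain k P) (v : Point n d) :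
    0 ≤ hessForm P z v v ∧ (hessForm P z v v = 0 → v = 0) := by
  obtain ⟨h1, h1'⟩ := trace_form_nonneg hz.1 v.X
  obtain ⟨h2, h2'⟩ := trace_form_nonneg hz.2.1 v.X
  have key : ∀ i, 2 * (slope P z v i / residual P z i) ^ 2 ≤
      1 / residual P z i * (inner ℝ (applyTo v.X (P i)) (applyTo v.X (P i))
          + inner ℝ (applyTo v.X.transpose (P i)) (applyTo v.X.transpose (P i)))
        - 2 / residual P z i * (v.y i * v.y i)
        + 4 / residual P z i ^ 2 * (slope P z v i * slope P z v i) := by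
    intro i
    have hq := residual_pos hz i
    have hm := norm_midpoint_sq_le (applyTo v.X (P i)) (applyTo v.X.transpose (P i))
    have hd := lorentz_discriminant (η := v.y i) (u := applyTo (symPart v.X) (P i)) (hz.2.2.2 i)
    have e : applyTo (symPart v.X) (P i) =
        (1 / 2 : ℝ) • (applyTo v.X (P i) + applyTo v.X.transpose (P i)) := by
      simp [symPart]
    rw [← e] at hm
    change residual P z i * _ ≤ slope P z v i ^ 2 at hd
    rw [real_inner_self_eq_norm_sq, real_inner_self_eq_norm_sq]
    set q := residual P z i
    set σ := slope P z v i
    set A := ‖applyTo v.X (P i)‖ ^ 2 + ‖applyTo v.X.transpose (P i)‖ ^ 2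
    set B := ‖applyTo (symPart v.X) (P i)‖ ^ 2
    have : 0 ≤ (q * A - 2 * q * v.y i ^ 2 + 2 * σ ^ 2) / q ^ 2 := by
      apply div_nonneg _ (by positivity)
      nlinarith
    have e2 : 1 / q * A - 2 / q * (v.y i * v.y i) + 4 / q ^ 2 * (σ * σ) - 2 * (σ / q) ^ 2 =
      (q * A - 2 * q * v.y i ^ 2 + 2 * σ ^ 2) / q ^ 2 := by field_simp; ring
    linarith
  have h3 : 0 ≤ ∑ i, 2 * (slope P z v i / residual P z i) ^ 2 :=
    Finset.sum_nonneg fun i _ => by positivity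
  have h4 := Finset.sum_le_sum fun i (_ : i ∈ Finset.univ) => key i
  constructor
  · unfold hessForm; linarith
  · intro h
    unfold hessForm at h
    have hX : v.X = 0 := h1' (by linarith)
    have hs : ∑ i, 2 * (slope P z v i / residual P z i) ^ 2 = 0 := by linarith
    rw [Finset.sum_eq_zero_iff_of_nonneg fun i _ => by positivity] at hs
    rw [Point.ext_iff']
    refine ⟨hX, fun i => ?_⟩
    have hi := hs i (Finset.mem_univ i)
    have hq := residual_pos hz i
    have hsl : slope P z v i = 0 := by
      -- A sum of nonnegative squares vanishes, hence each square does.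
      have : slope P z v i / residual P z i = 0 := by
        have : (slope P z v i / residual P z i) ^ 2 = 0 := by linarith
        exact pow_eq_zero_iff (two_ne_zero) |>.1 this
      simpa [hq.ne'] using this
    have hy : 0 < z.y i := (norm_nonneg _).trans_lt (hz.2.2.2 i)
    simp only [slope, symPart, hX, Matrix.transpose_zero, add_zero, smul_zero, applyTo_zero,
      inner_zero_right, sub_zero] at hsl
    rcases mul_eq_zero.1 hsl with h | h
    · exact absurd h hy.ne'
    · simpa [Point.y] using h

/-- Along a line in the domain the relaxation is a linear function minus a sum of logarithms of
affine functions. -/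
theorem exists_line_factors {k : ℕ} (hz : z ∈ domain k P) {v : Point n d} (hv : v ∈ tangent n d) :
    ∃ μ : (Fin d ⊕ Fin d) ⊕ (Fin n ⊕ Fin n) → ℝ,
      (∀ s : ℝ, (∀ j, 0 < 1 + s * μ j) → z + s • v ∈ domain k P ∧
        relaxation P t (z + s • v) =
          relaxation P t z + s * (gradForm P t z v + ∑ j, μ j) - ∑ j, Real.log (1 + s * μ j)) ∧
      ∑ j, μ j ^ 2 = hessForm P z v v := by
  obtain ⟨hvs, hvt⟩ := mem_tangent.1 hv
  obtain ⟨μ₁, hdet₁, hpos₁, htr₁, hsq₁⟩ := exists_line_eigenvalues hz.1 hvs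
  have hvs' : (-v.X).IsSymm := hvs.neg
  obtain ⟨μ₂, hdet₂, hpos₂, htr₂, hsq₂⟩ := exists_line_eigenvalues hz.2.1 hvs'
  choose α β hline hcone hab hab2 using fun i =>
    exists_lorentz_roots (hz.2.2.2 i) (v.y i) (applyTo v.X (P i))
  -- There are 2d + 2n factors: the relative eigenvalues of the direction at X and of its negative
  -- at I - X, and two roots for each Lorentz form.
  refine ⟨Sum.elim (Sum.elim μ₁ μ₂) (Sum.elim α β), fun s hs => ?_, ?_⟩
  · have hs₁ : ∀ j, 0 < 1 + s * μ₁ j := fun j => hs (.inl (.inl j))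
    have hs₂ : ∀ j, 0 < 1 + s * μ₂ j := fun j => hs (.inl (.inr j))
    have hs₃ : ∀ j, 0 < 1 + s * α j := fun j => hs (.inr (.inl j))
    have hs₄ : ∀ j, 0 < 1 + s * β j := fun j => hs (.inr (.inr j))
    have e2 : 1 - (z.X + s • v.X) = (1 - z.X) + s • (-v.X) := by
      rw [smul_neg]; abel
    constructor
    · refine ⟨hpos₁ s hs₁, ?_, ?_, fun i => ?_⟩
      · simp only [Point.X_add, Point.X_smul, e2]
        exact hpos₂ s hs₂
      · simp only [Point.X_add, Point.X_smul, Matrix.trace_add, Matrix.trace_smul, hvt, smul_zero,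
          add_zero]
        exact hz.2.2.1
      · simpa using hcone i s (hs₃ i) (hs₄ i)
    · have hl : ∀ i, Real.log ((z + s • v).y i ^ 2 - ‖applyTo (z + s • v).X (P i)‖ ^ 2) =
          Real.log (z.y i ^ 2 - ‖applyTo z.X (P i)‖ ^ 2) + Real.log (1 + s * α i)
            + Real.log (1 + s * β i) := by
        intro i
        have hq : 0 < z.y i ^ 2 - ‖applyTo z.X (P i)‖ ^ 2 := residual_pos hz i
        simp only [Point.X_add, Point.X_smul, Point.y_add, Point.y_smul, applyTo_add, applyTo_smul,
          hline i s]
        rw [Real.log_mul hq.ne' (mul_pos (hs₃ i) (hs₄ i)).ne',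
          Real.log_mul (hs₃ i).ne' (hs₄ i).ne']
        ring
      have hd₁ : Real.log (z + s • v).X.det = Real.log z.X.det + ∑ j, Real.log (1 + s * μ₁ j) := by
        simp only [Point.X_add, Point.X_smul, hdet₁ s]
        rw [Real.log_mul hz.1.det_pos.ne' (Finset.prod_pos fun j _ => hs₁ j).ne',
          Real.log_prod fun j _ => (hs₁ j).ne']
      have hd₂ : Real.log (1 - (z + s • v).X).det =
          Real.log (1 - z.X).det + ∑ j, Real.log (1 + s * μ₂ j) := by
        simp only [Point.X_add, Point.X_smul, e2, hdet₂ s]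
        rw [Real.log_mul hz.2.1.det_pos.ne' (Finset.prod_pos fun j _ => hs₂ j).ne',
          Real.log_prod fun j _ => (hs₂ j).ne']
      have hsl : ∑ i, 2 / residual P z i * slope P z v i = ∑ i, α i + ∑ i, β i := by
        rw [← Finset.sum_add_distrib]
        refine Finset.sum_congr rfl fun i _ => ?_
        rw [hab i, slope, symPart_of_isSymm hvs]
        rfl
      simp only [relaxation, hl, hd₁, hd₂]
      simp only [gradForm, hsl, Fintype.sum_sum_type, Sum.elim_inl,
        Sum.elim_inr, htr₁, htr₂, Point.y_add, Point.y_smul, Finset.sum_add_distrib,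
        Matrix.mul_neg, Matrix.trace_neg, ← Finset.mul_sum]
      ring
  · simp only [Fintype.sum_sum_type, Sum.elim_inl, Sum.elim_inr, hsq₁, hsq₂, hessForm,
      Matrix.transpose_neg, Matrix.neg_mul, Matrix.mul_neg, neg_neg]
    rw [← Finset.sum_add_distrib]
    congr 1
    refine Finset.sum_congr rfl fun i _ => ?_
    rw [hab2 i, slope, symPart_of_isSymm hvs, hvs.eq, real_inner_self_eq_norm_sq]
    change 4 / residual P z i ^ 2 * _ - 2 / residual P z i * _ = _
    ring

/-- The remainder of the logarithm after the linear term is at most x²/2 · (1 - |x|)⁻¹, and the last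
factor is at most 2 here. The bound is borrowed from the complex logarithm. -/
theorem neg_log_one_add_le {x : ℝ} (hx : |x| ≤ 1 / 2) : -Real.log (1 + x) ≤ -x + x ^ 2 := by
  have hpos : 0 < 1 + x := by linarith [(abs_le.1 hx).1]
  have hn : ‖(x : ℂ)‖ = |x| := by simp
  have h := Complex.norm_log_one_add_sub_self_le (z := (x : ℂ)) (by rw [hn]; linarith)
  have e : Complex.log (1 + (x : ℂ)) - x = ((Real.log (1 + x) - x : ℝ) : ℂ) := by
    rw [← Complex.ofReal_one, ← Complex.ofReal_add, ← Complex.ofReal_log hpos.le,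
      Complex.ofReal_sub]
  rw [e, Complex.norm_real, hn, Real.norm_eq_abs, sq_abs] at h
  have h2 : (1 - |x|)⁻¹ ≤ 2 := by
    rw [inv_le_comm₀ (by linarith) (by norm_num)]
    linarith
  have h3 := (abs_le.1 h).1
  nlinarith [sq_nonneg x]

/-- The decrease of the relaxation in a step inside the Dikin ellipsoid. -/
theorem relaxation_step {k : ℕ} (hz : z ∈ domain k P) {v : Point n d} (hv : v ∈ tangent n d)
    (hB : hessForm P z v v ≤ 1 / 4) :
    z + v ∈ domain k P ∧
      relaxation P t (z + v) ≤ relaxation P t z + gradForm P t z v + hessForm P z v v := by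
  obtain ⟨μ, hμ, hsq⟩ := exists_line_factors (t := t) hz hv
  -- Each μ_j² is at most their sum, which is the Hessian form.
  have hle : ∀ j, |μ j| ≤ 1 / 2 := fun j => by
    have : μ j ^ 2 ≤ ∑ j, μ j ^ 2 :=
      Finset.single_le_sum (f := fun j => μ j ^ 2) (fun _ _ => sq_nonneg _) (Finset.mem_univ j)
    apply abs_le_of_sq_le_sq _ (by norm_num)
    rw [hsq] at this
    linarith
  have hpos : ∀ j, 0 < 1 + 1 * μ j := fun j => by
    have := (abs_le.1 (hle j)).1
    linarith
  obtain ⟨h1, h2⟩ := hμ 1 hpos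
  rw [one_smul] at h1 h2
  refine ⟨h1, ?_⟩
  have h3 := Finset.sum_le_sum fun j (_ : j ∈ Finset.univ) => neg_log_one_add_le (hle j)
  simp only [Finset.sum_add_distrib, Finset.sum_neg_distrib, hsq] at h3
  simp only [one_mul] at h2
  linarith

end Forms

/-! ### The Newton decrement as an abstract second-order quantity. -/

section Decrement

open Filter Topology

/-- Reduces the Fréchet derivatives in the definition of the decrement to calculus in one variable,
where the logarithmic factorization is explicit. -/
theorem fderiv_along_line {V : Type*} [NormedAddCommGroup V] [NormedSpace ℝ V] {ψ : V → ℝ}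
    (hψ : ContDiffAt ℝ 2 ψ 0) (v : V) {f f' : ℝ → ℝ} {a : ℝ}
    (hf : ∀ᶠ s in 𝓝 (0 : ℝ), ψ (s • v) = f s) (hf' : ∀ᶠ s in 𝓝 (0 : ℝ), HasDerivAt f (f' s) s)
    (ha : HasDerivAt f' a 0) :
    fderiv ℝ ψ 0 v = f' 0 ∧ fderiv ℝ (fderiv ℝ ψ) 0 v v = a := by
  have hlin : ∀ s : ℝ, HasDerivAt (fun s : ℝ => s • v) v s := fun s => by
    simpa using (hasDerivAt_id s).smul_const v
  have htend : Tendsto (fun s : ℝ => s • v) (𝓝 0) (𝓝 0) := by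
    have := (hlin 0).continuousAt.tendsto
    simpa using this
  have hdiff : ∀ᶠ x in 𝓝 (0 : V), DifferentiableAt ℝ ψ x := by
    filter_upwards [hψ.eventually (by norm_num)] with x hx
    exact hx.differentiableAt (by norm_num)
  have heq : ∀ᶠ s in 𝓝 (0 : ℝ), f' s = fderiv ℝ ψ (s • v) v := by
    filter_upwards [htend.eventually hdiff, hf', hf.eventually_nhds] with s h1 h2 h3
    have h4 : HasDerivAt (fun s : ℝ => ψ (s • v)) (fderiv ℝ ψ (s • v) v) s :=
      h1.hasFDerivAt.comp_hasDerivAt s (hlin s)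
    exact h2.unique (h4.congr_of_eventuallyEq (h3.mono fun _ h => h.symm))
  constructor
  · have := heq.self_of_nhds
    rw [zero_smul] at this
    exact this.symm
  · have h1 : DifferentiableAt ℝ (fderiv ℝ ψ) 0 :=
      (hψ.fderiv_right (m := 1) (by norm_num)).differentiableAt (by norm_num)
    have h2 : HasFDerivAt (fderiv ℝ ψ) (fderiv ℝ (fderiv ℝ ψ) 0) ((0 : ℝ) • v) := by
      rw [zero_smul]; exact h1.hasFDerivAt
    have h3 : HasDerivAt (fun s : ℝ => fderiv ℝ ψ (s • v)) (fderiv ℝ (fderiv ℝ ψ) 0 v) 0 :=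
      h2.comp_hasDerivAt 0 (hlin 0)
    have h4 : HasDerivAt (fun s : ℝ => fderiv ℝ ψ (s • v) v) (fderiv ℝ (fderiv ℝ ψ) 0 v v) 0 := by
      simpa using h3.clm_apply (hasDerivAt_const (0 : ℝ) v)
    exact h4.unique (ha.congr_of_eventuallyEq (heq.mono fun _ h => h.symm))

/-- The Newton decrement in terms of the Newton direction. -/
theorem newtonDecrement_eq {E : Type*} [NormedAddCommGroup E] [InnerProductSpace ℝ E]
    [FiniteDimensional ℝ E] {V : Submodule ℝ E} {φ : E → ℝ} {x : E}
    (hψ : ContDiffAt ℝ 2 (fun v : V => φ (x + v)) 0) {ℓ : V → ℝ} {B : V → V → ℝ}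
    (h1 : ∀ v, fderiv ℝ (fun v : V => φ (x + v)) 0 v = ℓ v)
    (h2 : ∀ v, fderiv ℝ (fderiv ℝ (fun v : V => φ (x + v))) 0 v v = B v v)
    (hadd : ∀ u u' v, B (u + u') v = B u v + B u' v) (hcomm : ∀ u v, B u v = B v u)
    (hpos : ∀ v, B v v = 0 → v = 0) {N : V} (hN : ∀ v, B N v = ℓ v) :
    newtonDecrement V φ x = Real.sqrt (ℓ N) := by
  have : CompleteSpace V := FiniteDimensional.complete ℝ V
  set ψ : V → ℝ := fun v => φ (x + v) with hψdef
  have hgrad : ∀ u v : V, inner ℝ (∇ ψ u) v = fderiv ℝ ψ u v := fun u v => by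
    unfold gradient
    exact InnerProductSpace.toDual_symm_apply
  have hdd : DifferentiableAt ℝ (fderiv ℝ ψ) 0 :=
    (hψ.fderiv_right (m := 1) (by norm_num)).differentiableAt (by norm_num)
  have hhess : ∀ u v : V,
      inner ℝ (fderiv ℝ (fun v => ∇ ψ v) 0 u) v = fderiv ℝ (fderiv ℝ ψ) 0 u v := by
    intro u v
    let L₀ : StrongDual ℝ V →ₗ[ℝ] V :=
      { toFun := fun f => (InnerProductSpace.toDual ℝ V).symm f
        map_add' := fun f g => map_add _ f g
        map_smul' := fun c f => by simp }
    let L : StrongDual ℝ V →L[ℝ] V :=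
      ⟨L₀, (InnerProductSpace.toDual ℝ V).symm.continuous⟩
    have h : HasFDerivAt (fun v => ∇ ψ v) (L.comp (fderiv ℝ (fderiv ℝ ψ) 0)) 0 :=
      (L.hasFDerivAt (x := fderiv ℝ ψ 0)).comp (0 : V) hdd.hasFDerivAt
    rw [h.fderiv]
    exact InnerProductSpace.toDual_symm_apply
  -- Only diagonal values of the second derivative are given; its symmetry and polarization recover
  -- the bilinear form.
  have hsymm : ∀ u v : V, fderiv ℝ (fderiv ℝ ψ) 0 u v = fderiv ℝ (fderiv ℝ ψ) 0 v u := fun u v =>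
    hψ.isSymmSndFDerivAt (by simp) u v
  have hB : ∀ u v : V, fderiv ℝ (fderiv ℝ ψ) 0 u v = B u v := by
    intro u v
    have e := h2 (u + v)
    rw [map_add (fderiv ℝ (fderiv ℝ ψ) 0), add_apply, map_add, map_add, h2, h2, hsymm v u, hadd,
      hcomm u (u + v), hcomm v (u + v), hadd, hadd, hcomm v u] at e
    linarith
  set H : V →L[ℝ] V := fderiv ℝ (fun v => ∇ ψ v) 0 with hH
  -- `ContinuousLinearMap.inverse` is zero on maps that are not invertible, so the Hessian must be
  -- shown to be an isomorphism: it is injective and the space has finite dimension.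
  have hinj : Function.Injective H := by
    rw [injective_iff_map_eq_zero]
    intro u hu
    apply hpos
    rw [← hB, ← hhess, hu, inner_zero_left]
  let e : V ≃L[ℝ] V := (LinearEquiv.ofInjectiveEndo (H : V →ₗ[ℝ] V) hinj).toContinuousLinearEquiv
  have he : (e : V →L[ℝ] V) = H := by ext; rfl
  have hHN : H N = ∇ ψ 0 := by
    refine ext_inner_right ℝ fun v => ?_
    rw [hhess, hB, hN, hgrad, h1]
  have hinv : H.inverse (∇ ψ 0) = N := by
    rw [← hHN, ← he, ContinuousLinearMap.inverse_equiv]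
    simp
  change Real.sqrt (inner ℝ (∇ ψ 0) (H.inverse (∇ ψ 0))) = _
  rw [hinv, hgrad, h1]

variable {n d : ℕ} {P : Fin n → EuclideanSpace ℝ (Fin d)} {t : ℝ} {z : Point n d}

theorem contDiff_entry (i j : Fin d) : ContDiff ℝ 2 (fun z : Point n d => z.X i j) := by
  unfold Point.X
  simp only [Matrix.of_apply]
  fun_prop

theorem contDiff_det {f : Point n d → Matrix (Fin d) (Fin d) ℝ}
    (hf : ∀ i j, ContDiff ℝ 2 fun z => f z i j) : ContDiff ℝ 2 fun z => (f z).det := by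
  simp only [Matrix.det_apply]
  refine ContDiff.sum fun σ _ => ContDiff.const_smul _ ?_
  exact contDiff_prod fun i _ => hf _ _

theorem contDiffAt_relaxation {k : ℕ} (hz : z ∈ domain k P) :
    ContDiffAt ℝ 2 (relaxation P t) z := by
  have hy : ∀ i, ContDiff ℝ 2 (fun z : Point n d => z.y i) := fun i => by
    unfold Point.y; fun_prop
  have ha : ∀ i, ContDiff ℝ 2 (fun z : Point n d => applyTo z.X (P i)) := fun i => by
    rw [contDiff_euclidean]
    intro a
    simp only [applyTo_apply]
    exact ContDiff.sum fun b _ => (contDiff_entry a b).mul contDiff_const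
  have h1 : ContDiff ℝ 2 (fun z : Point n d => z.X.det) := contDiff_det contDiff_entry
  have h2 : ContDiff ℝ 2 (fun z : Point n d => (1 - z.X).det) := contDiff_det fun i j => by
    simp only [Matrix.sub_apply]
    exact contDiff_const.sub (contDiff_entry i j)
  unfold relaxation
  refine ((ContDiffAt.sub ?_ ?_).sub (h1.contDiffAt.log hz.1.det_pos.ne')).sub
    (h2.contDiffAt.log hz.2.1.det_pos.ne')
  · exact (contDiff_const.mul (ContDiff.sum fun i _ => hy i)).contDiffAt
  · exact ContDiffAt.sum fun i _ =>
      ((((hy i).pow 2).sub ((ha i).norm_sq ℝ)).contDiffAt).log (residual_pos hz i).ne'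

/-- On each tangent line the function is affine minus a sum of logarithms, so `gradForm` and
`hessForm` are the true derivatives; a solution of the weak Newton equation then determines the
decrement. -/
theorem decrement_eq {k : ℕ} (hz : z ∈ domain k P) {N : Point n d} (hN : N ∈ tangent n d)
    (hNv : ∀ v ∈ tangent n d, hessForm P z N v = gradForm P t z v) :
    decrement P t z = Real.sqrt (gradForm P t z N) := by
  have hψ : ContDiffAt ℝ 2 (fun v : tangent n d => relaxation P t (z + v)) 0 := by
    have h0 : ContDiffAt ℝ 2 (relaxation P t) (z + ((0 : tangent n d) : Point n d)) := by
      simpa using contDiffAt_relaxation hz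
    exact ContDiffAt.comp (g := relaxation P t) (f := fun v : tangent n d => z + (v : Point n d))
      (0 : tangent n d) h0
      (contDiff_const.add (tangent n d).subtypeL.contDiff).contDiffAt
  have hline : ∀ v : tangent n d,
      fderiv ℝ (fun v : tangent n d => relaxation P t (z + v)) 0 v = gradForm P t z v ∧
      fderiv ℝ (fderiv ℝ (fun v : tangent n d => relaxation P t (z + v))) 0 v v
        = hessForm P z v v := by
    intro v
    obtain ⟨μ, hμ, hsq⟩ := exists_line_factors (t := t) hz v.2
    have hpos : ∀ᶠ s in 𝓝 (0 : ℝ), ∀ j, 0 < 1 + s * μ j := by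
      rw [eventually_all]
      intro j
      have : ContinuousAt (fun s : ℝ => 1 + s * μ j) 0 := by fun_prop
      exact this.eventually_const_lt (by simp)
    have key := fderiv_along_line hψ v
      (f := fun s => relaxation P t z + s * (gradForm P t z v + ∑ j, μ j)
        - ∑ j, Real.log (1 + s * μ j))
      (f' := fun s => (gradForm P t z v + ∑ j, μ j) - ∑ j, μ j / (1 + s * μ j))
      (a := ∑ j, μ j ^ 2) (by
        filter_upwards [hpos] with s hs
        exact (hμ s hs).2) (by
        filter_upwards [hpos] with s hs
        have h1 : HasDerivAt (fun s : ℝ => relaxation P t z + s * (gradForm P t z v + ∑ j, μ j))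
            (gradForm P t z v + ∑ j, μ j) s := by
          simpa using ((hasDerivAt_id s).mul_const (gradForm P t z v + ∑ j, μ j)).const_add
            (relaxation P t z)
        refine h1.sub (HasDerivAt.fun_sum fun j _ => ?_)
        have h2 : HasDerivAt (fun s : ℝ => 1 + s * μ j) (μ j) s := by
          simpa using ((hasDerivAt_id s).mul_const (μ j)).const_add 1
        exact h2.log (hs j).ne') (by
        have : HasDerivAt (fun s : ℝ => ∑ j, μ j / (1 + s * μ j)) (∑ j, -μ j ^ 2) 0 := by
          refine HasDerivAt.fun_sum fun j _ => ?_
          have h2 : HasDerivAt (fun s : ℝ => 1 + s * μ j) (μ j) 0 := by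
            simpa using ((hasDerivAt_id (0 : ℝ)).mul_const (μ j)).const_add 1
          have h3 := (hasDerivAt_const (0 : ℝ) (μ j)).div h2 (by simp)
          have e : ((0 : ℝ) * (1 + 0 * μ j) - μ j * μ j) / (1 + 0 * μ j) ^ 2 = -μ j ^ 2 := by
            norm_num [sq]
          rw [e] at h3
          exact h3
        have h4 := this.const_sub (gradForm P t z v + ∑ j, μ j)
        have e : -∑ j, -μ j ^ 2 = ∑ j, μ j ^ 2 := by rw [Finset.sum_neg_distrib, neg_neg]
        rw [e] at h4
        exact h4)
    refine ⟨key.1.trans ?_, key.2.trans hsq⟩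
    simp
  refine newtonDecrement_eq (V := tangent n d) (φ := relaxation P t) hψ
    (ℓ := fun v => gradForm P t z v) (B := fun u v => hessForm P z u v)
    (fun v => (hline v).1) (fun v => (hline v).2) (fun u u' v => ?_)
    (fun u v => hessForm_comm hz _ _) (fun v hv => ?_) (N := ⟨N, hN⟩) (fun v => hNv v v.2)
  · exact hessForm_add_left _ _ _
  · exact Subtype.ext ((hessForm_pos hz _).2 hv)

end Decrement

/-! ### Feasibility, the lower bound, and the values at the two initial points. -/

section Bounds

variable {n d k : ℕ} {P : Fin n → EuclideanSpace ℝ (Fin d)} {t : ℝ} {z : Point n d}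

theorem posDef_smul_one {c : ℝ} (hc : 0 < c) : (c • (1 : Matrix (Fin d) (Fin d) ℝ)).PosDef :=
  Matrix.PosDef.one.smul hc

theorem one_sub_X0 (hd : 0 < d) :
    1 - X0 d k = ((k : ℝ) / d) • (1 : Matrix (Fin d) (Fin d) ℝ) := by
  have : (d : ℝ) ≠ 0 := by positivity
  rw [X0]
  nth_rewrite 1 [← one_smul ℝ (1 : Matrix (Fin d) (Fin d) ℝ)]
  rw [← sub_smul]
  congr 1
  field_simp
  ring

/-- The points over `X₀` in the domain. -/
theorem mkPoint_X0_mem_domain (hk : 1 ≤ k) (hkd : k < d) {y : Fin n → ℝ}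
    (hy : ∀ i, ‖applyTo (X0 d k) (P i)‖ < y i) : mkPoint (X0 d k) y ∈ domain k P := by
  have hd : 0 < d := by omega
  have hd' : (0 : ℝ) < d := by positivity
  have hk' : (0 : ℝ) < k := by exact_mod_cast hk
  have hkd' : (k : ℝ) < d := by exact_mod_cast hkd
  refine ⟨posDef_smul_one (div_pos (by linarith) hd'), ?_, ?_, hy⟩
  · rw [mkPoint_X, one_sub_X0 hd]
    exact posDef_smul_one (div_pos hk' hd')
  · simp [X0]
    field_simp

theorem initialPoint_mem_domain (hk : 1 ≤ k) (hkd : k < d) : initialPoint k P ∈ domain k P := by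
  refine mkPoint_X0_mem_domain hk hkd fun i => ?_
  apply Real.lt_sqrt_of_sq_lt
  linarith [Real.exp_pos 1]

/-- The barrier of the matrix part at `X₀`. -/
theorem log_det_X0_ge (hk : 1 ≤ k) (hkd : k < d) :
    -(2 * d * Real.log d) ≤ Real.log (X0 d k).det + Real.log (1 - X0 d k).det := by
  have hd : 0 < d := by omega
  have hd' : (0 : ℝ) < d := by positivity
  have hk' : (1 : ℝ) ≤ k := by exact_mod_cast hk
  have hkd' : (k : ℝ) + 1 ≤ d := by exact_mod_cast hkd
  rw [one_sub_X0 hd, X0]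
  simp only [Matrix.det_smul, Matrix.det_one, mul_one, Fintype.card_fin, Real.log_pow]
  rw [Real.log_div (by linarith) hd'.ne', Real.log_div (by linarith) hd'.ne']
  -- Both k and d - k are at least 1, so each determinant costs at most d ln d.
  have h1 : 0 ≤ Real.log ((d : ℝ) - k) := Real.log_nonneg (by linarith)
  have h2 : 0 ≤ Real.log (k : ℝ) := Real.log_nonneg hk'
  nlinarith

/-- Testing I - X against an eigenvector of X bounds the eigenvalue by 1. -/
theorem det_le_one_of_posDef {X : Matrix (Fin d) (Fin d) ℝ} (h1 : X.PosDef)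
    (h2 : (1 - X).PosDef) : X.det ≤ 1 := by
  rw [h1.1.det_eq_prod_eigenvalues]
  refine Finset.prod_le_one (fun i _ => (h1.eigenvalues_pos i).le) fun i _ => ?_
  let x := h1.1.eigenvectorBasis i
  have hx := h1.1.mulVec_eigenvectorBasis i
  have hne : (x : Fin d → ℝ) ≠ 0 := by
    intro h
    have := h1.1.eigenvectorBasis.orthonormal.1 i
    have h0 : h1.1.eigenvectorBasis i = 0 := by ext j; exact congrFun h j
    rw [h0] at this
    simp at this
  have h3 := h2.dotProduct_mulVec_pos hne
  rw [Matrix.sub_mulVec, Matrix.one_mulVec, hx, dotProduct_sub, dotProduct_smul] at h3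
  have h4 : (0 : ℝ) ≤ star (x : Fin d → ℝ) ⬝ᵥ (x : Fin d → ℝ) := by
    exact dotProduct_star_self_nonneg (x : Fin d → ℝ)
  simp only [smul_eq_mul] at h3
  by_contra hcon
  push Not at hcon
  have : (1 - h1.1.eigenvalues i) * (star (x : Fin d → ℝ) ⬝ᵥ (x : Fin d → ℝ)) ≤ 0 :=
    mul_nonpos_of_nonpos_of_nonneg (by simpa using hcon.le) h4
  have h5 : (0 : ℝ) < (1 - h1.1.eigenvalues i) * (star (x : Fin d → ℝ) ⬝ᵥ (x : Fin d → ℝ)) := by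
    rw [sub_mul, one_mul]; simpa using h3
  linarith

/-- A lower bound of the relaxation on its domain. -/
theorem relaxation_ge (ht : 0 < t) (hz : z ∈ domain k P) :
    2 * n + 2 * n * Real.log (t / 2) ≤ relaxation P t z := by
  have h1 : Real.log z.X.det ≤ 0 :=
    Real.log_nonpos hz.1.det_pos.le (det_le_one_of_posDef hz.1 hz.2.1)
  have h2 : Real.log (1 - z.X).det ≤ 0 :=
    Real.log_nonpos hz.2.1.det_pos.le (det_le_one_of_posDef hz.2.1 (by simpa using hz.1))
  have h3 : ∀ i, 2 + 2 * Real.log (t / 2) ≤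
      t * z.y i - Real.log (z.y i ^ 2 - ‖applyTo z.X (P i)‖ ^ 2) := by
    intro i
    have hy : 0 < z.y i := (norm_nonneg _).trans_lt (hz.2.2.2 i)
    have ha : Real.log (z.y i ^ 2 - ‖applyTo z.X (P i)‖ ^ 2) ≤ 2 * Real.log (z.y i) := by
      rw [show 2 * Real.log (z.y i) = Real.log (z.y i ^ 2) by rw [Real.log_pow]; norm_num]
      exact Real.log_le_log (residual_pos hz i) (by linarith [sq_nonneg ‖applyTo z.X (P i)‖])
    -- The tangent to the logarithm at 1, i.e. at the minimizer y = 2/t of ty - 2 ln y.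
    have hb := Real.log_le_sub_one_of_pos (show 0 < t / 2 * z.y i by positivity)
    rw [Real.log_mul (by positivity) hy.ne'] at hb
    linarith
  have h4 := Finset.sum_le_sum fun i (_ : i ∈ Finset.univ) => h3 i
  simp only [Finset.sum_const, Finset.card_univ, Fintype.card_fin, nsmul_eq_mul,
    Finset.sum_sub_distrib, ← Finset.mul_sum] at h4
  unfold relaxation
  linarith

theorem y0_pos (i : Fin n) : 0 < y0 k P i :=
  Real.sqrt_pos.2 (by positivity)

theorem sum_y0_pos (hn : 1 ≤ n) : 0 < ∑ i, y0 k P i :=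
  Finset.sum_pos (fun i _ => y0_pos i) ⟨⟨0, hn⟩, Finset.mem_univ _⟩

theorem t0_pos (hn : 1 ≤ n) : 0 < t0 k P := by
  have hn' : (0 : ℝ) < n := by exact_mod_cast hn
  exact div_pos (by linarith) (sum_y0_pos hn)

theorem t0_mul_sum (hn : 1 ≤ n) : t0 k P * ∑ i, y0 k P i = 2 * n :=
  div_mul_cancel₀ _ (sum_y0_pos hn).ne'

/-- The summand e in y₀ makes every cone logarithm equal to 1, and t₀ is normalized so that the
linear term is 2n. -/
theorem relaxation_initialPoint_le (hn : 1 ≤ n) (hk : 1 ≤ k) (hkd : k < d) :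
    relaxation P (t0 k P) (initialPoint k P) ≤ n + 2 * d * Real.log d := by
  have h1 : ∀ i, Real.log ((initialPoint k P).y i ^ 2
      - ‖applyTo (initialPoint k P).X (P i)‖ ^ 2) = 1 := by
    intro i
    simp only [initialPoint, mkPoint_X, mkPoint_y, y0]
    rw [Real.sq_sqrt (by positivity)]
    simp
  have h2 : (initialPoint k P).X = X0 d k := rfl
  have h3 := log_det_X0_ge hk hkd
  have h4 : t0 k P * ∑ i, (initialPoint k P).y i = 2 * n := t0_mul_sum hn
  unfold relaxation
  simp only [h1]
  rw [h4, h2]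
  simp
  linarith

/-- The point over `X₀` at which the algorithm starts. -/
def startPoint (k : ℕ) (P : Fin n → EuclideanSpace ℝ (Fin d)) : Point n d :=
  mkPoint (X0 d k) fun i => ‖applyTo (X0 d k) (P i)‖ + 2 / t0 k P

theorem startPoint_mem_domain (hn : 1 ≤ n) (hk : 1 ≤ k) (hkd : k < d) :
    startPoint k P ∈ domain k P :=
  mkPoint_X0_mem_domain hk hkd fun i => by
    have := t0_pos (k := k) (P := P) hn
    simp [this]

/-- The first bracket is the lower bound of `relaxation_ge`, so the excess is free of t₀. The offset
2/t₀ makes each residual at least (2/t₀)², and the linear term is at most 4n: 2n from the offsets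
and 2n from ∑ ‖X₀p_i‖ ≤ ∑ (y₀)_i. -/
theorem relaxation_startPoint_le (hn : 1 ≤ n) (hk : 1 ≤ k) (hkd : k < d) :
    relaxation P (t0 k P) (startPoint k P) ≤
      (2 * n + 2 * n * Real.log (t0 k P / 2)) + (2 * n + 2 * d * Real.log d) := by
  have ht := t0_pos (k := k) (P := P) hn
  set t := t0 k P with htd
  have h1 : ∀ i, -(2 * Real.log (t / 2)) ≤ Real.log ((startPoint k P).y i ^ 2
      - ‖applyTo (startPoint k P).X (P i)‖ ^ 2) := by
    intro i
    simp only [startPoint, mkPoint_X, mkPoint_y, ← htd]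
    rw [show -(2 * Real.log (t / 2)) = Real.log ((2 / t) ^ 2) by
      rw [Real.log_pow, ← inv_div t 2, Real.log_inv]; push_cast; ring]
    apply Real.log_le_log (by positivity)
    have : 0 ≤ ‖applyTo (X0 d k) (P i)‖ * (2 / t) := by positivity
    nlinarith
  have h2 : ∑ i, ‖applyTo (X0 d k) (P i)‖ ≤ ∑ i, y0 k P i :=
    Finset.sum_le_sum fun i _ => Real.le_sqrt_of_sq_le (by linarith [Real.exp_pos 1])
  have h3 := log_det_X0_ge hk hkd
  have h4 : t * ∑ i, (startPoint k P).y i ≤ 4 * n := by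
    simp only [startPoint, mkPoint_y, Finset.sum_add_distrib, Finset.sum_const, Finset.card_univ,
      Fintype.card_fin, nsmul_eq_mul, ← htd]
    have := mul_le_mul_of_nonneg_left h2 ht.le
    rw [t0_mul_sum hn] at this
    have e : t * (n * (2 / t)) = 2 * n := by field_simp
    rw [mul_add, e]
    linarith
  have h5 := Finset.sum_le_sum fun i (_ : i ∈ Finset.univ) => h1 i
  simp only [Finset.sum_const, Finset.card_univ, Fintype.card_fin, nsmul_eq_mul] at h5
  have h6 : (startPoint k P).X = X0 d k := rfl
  unfold relaxation
  rw [h6] at h5 ⊢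
  linarith

theorem relaxation_initialPoint_sub_sInf_le (hn : 1 ≤ n) (hk : 1 ≤ k) (hkd : k < d)
    (ht : 1 < t0 k P) :
    relaxation P (t0 k P) (initialPoint k P) - sInf (relaxation P (t0 k P) '' domain k P)
      ≤ 2 * (n : ℝ) + 4 * (d : ℝ) * Real.log d := by
  have h1 := relaxation_initialPoint_le (P := P) hn hk hkd
  -- For t₀ > 1 the lower bound exceeds 2n(1 - ln 2), which is nonnegative.
  have h2 : 0 ≤ sInf (relaxation P (t0 k P) '' domain k P) := by
    refine Real.sInf_nonneg ?_
    rintro _ ⟨z, hz, rfl⟩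
    refine le_trans ?_ (relaxation_ge (t0_pos hn) hz)
    have hl : Real.log (1 / 2) ≤ Real.log (t0 k P / 2) :=
      Real.log_le_log (by norm_num) (by linarith)
    have h2 : Real.log (1 / 2) = -Real.log 2 := by rw [one_div, Real.log_inv]
    have h3 := Real.log_two_lt_d9
    have hn' : (0 : ℝ) ≤ n := by positivity
    nlinarith
  have h3 : 0 ≤ (d : ℝ) * Real.log d := mul_nonneg (by positivity) (Real.log_natCast_nonneg d)
  have hn' : (0 : ℝ) ≤ n := by positivity
  linarith

end Bounds

/-! ### The bordered Newton system. -/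

section Kkt

variable {n d : ℕ}

/-- Indices of the unknowns of the Newton system: the matrix direction, the vector direction, one
multiplier for every Lorentz cone, the multiplier of the trace constraint, and the scale. -/
abbrev KktIndex (n d : ℕ) : Type := (Fin d × Fin d) ⊕ Fin n ⊕ Fin n ⊕ Unit ⊕ Unit

/-- The matrix of the Newton system, from the inverses `S` and `Y` of `X` and `I - X`, the matrix
`C = ∑ (2 / q_i) p_i p_iᵀ` and the vectors `w_i = X p_i`. -/
def kktOf (S Y C : Matrix (Fin d) (Fin d) ℝ) (w p : Fin n → Fin d → ℝ) (y q : Fin n → ℝ) (t : ℝ) :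
    Matrix (KktIndex n d) (KktIndex n d) ℝ := fun r c =>
  match r, c with
  | .inl (a, b), .inl (c, e) => S a c * S b e + Y a c * Y b e
      + ((if a = c then C b e else 0) + (if b = e then C a c else 0)) / 2
  | .inl _, .inr (.inl _) => 0
  | .inl (a, b), .inr (.inr (.inl i)) => -((w i a * p i b + p i a * w i b) / 2)
  | .inl (a, b), .inr (.inr (.inr (.inl _))) => if a = b then 1 else 0
  | .inl (a, b), .inr (.inr (.inr (.inr _))) => Y a b - S a b
  | .inr (.inl _), .inl _ => 0
  | .inr (.inl i), .inr (.inl j) => if i = j then -(2 / q i) else 0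
  | .inr (.inl i), .inr (.inr (.inl j)) => if i = j then y i else 0
  | .inr (.inl _), .inr (.inr (.inr (.inl _))) => 0
  | .inr (.inl _), .inr (.inr (.inr (.inr _))) => t
  | .inr (.inr (.inl i)), .inl (a, b) => -((w i a * p i b + p i a * w i b) / 2)
  | .inr (.inr (.inl i)), .inr (.inl j) => if i = j then y i else 0
  -- This row defines the auxiliary unknown of the i-th cone. It stands for the rank-one term 4/q_i²
  -- · slope², whose direct assembly over all n cones would be too expensive.
  | .inr (.inr (.inl i)), .inr (.inr (.inl j)) => if i = j then -(q i ^ 2 / 4) else 0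
  | .inr (.inr (.inl _)), .inr (.inr (.inr (.inl _))) => 0
  | .inr (.inr (.inl i)), .inr (.inr (.inr (.inr _))) => -(q i / 2)
  | .inr (.inr (.inr (.inl _))), .inl (a, b) => if a = b then 1 else 0
  | .inr (.inr (.inr (.inl _))), .inr _ => 0
  | .inr (.inr (.inr (.inr _))), .inl (a, b) => Y a b - S a b
  | .inr (.inr (.inr (.inr _))), .inr (.inl _) => t
  | .inr (.inr (.inr (.inr _))), .inr (.inr (.inl i)) => -(q i / 2)
  | .inr (.inr (.inr (.inr _))), .inr (.inr (.inr (.inl _))) => 0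
  -- Eliminating the n cone unknowns adds n to this corner; the value -(n + 1) leaves -1.
  | .inr (.inr (.inr (.inr _))), .inr (.inr (.inr (.inr _))) => -(n + 1)

variable (P : Fin n → EuclideanSpace ℝ (Fin d)) (t : ℝ) (z : Point n d)

/-- The Newton system at `z`. -/
def kkt : Matrix (KktIndex n d) (KktIndex n d) ℝ :=
  kktOf z.X⁻¹ (1 - z.X)⁻¹ (Matrix.of fun a b => ∑ i, 2 / residual P z i * (P i a * P i b))
    (fun i a => applyTo z.X (P i) a) (fun i a => P i a) z.y (residual P z) t

/-- The direction in a vector of unknowns. -/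
def direction (x : KktIndex n d → ℝ) : Point n d :=
  mkPoint (Matrix.of fun a b => x (.inl (a, b))) fun i => x (.inr (.inl i))

variable {P t z}

theorem slope_eq_sum (v : Point n d) (i : Fin n) :
    slope P z v i = z.y i * v.y i - ∑ a, ∑ b, v.X a b *
      ((applyTo z.X (P i) a * P i b + P i a * applyTo z.X (P i) b) / 2) := by
  unfold slope
  congr 1
  rw [PiLp.inner_apply]
  simp only [RCLike.inner_apply, conj_trivial, applyTo_apply (symPart v.X)]
  set w := applyTo z.X (P i)
  have e : ∑ a, ∑ b, v.X a b * ((w a * P i b + P i a * w b) / 2) =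
      (∑ a, ∑ b, v.X a b * (w a * P i b) / 2) + ∑ a, ∑ b, v.X b a * (w a * P i b) / 2 := by
    rw [Finset.sum_comm (f := fun a b => v.X b a * (w a * P i b) / 2), ← Finset.sum_add_distrib]
    refine Finset.sum_congr rfl fun a _ => ?_
    rw [← Finset.sum_add_distrib]
    refine Finset.sum_congr rfl fun b _ => ?_
    ring
  rw [e, ← Finset.sum_add_distrib]
  refine Finset.sum_congr rfl fun a _ => ?_
  rw [Finset.sum_mul, ← Finset.sum_add_distrib]
  refine Finset.sum_congr rfl fun b _ => ?_
  simp only [symPart, Matrix.smul_apply, Matrix.add_apply, Matrix.transpose_apply, smul_eq_mul]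
  ring

theorem trace_form_eq_sum {S : Matrix (Fin d) (Fin d) ℝ} (hS : S.IsSymm)
    (U V : Matrix (Fin d) (Fin d) ℝ) :
    (V.transpose * S * U * S).trace =
      ∑ a, ∑ b, V a b * ∑ c, ∑ e, S a c * S b e * U c e := by
  have h : ∀ a b, (S * U * S) a b = ∑ c, ∑ e, S a c * S b e * U c e := by
    intro a b
    simp only [Matrix.mul_apply, Finset.sum_mul]
    rw [Finset.sum_comm]
    refine Finset.sum_congr rfl fun c _ => Finset.sum_congr rfl fun e _ => ?_
    rw [hS.apply b e]
    ring
  have h2 : V.transpose * S * U * S = V.transpose * (S * U * S) := by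
    simp only [Matrix.mul_assoc]
  rw [h2]
  simp only [Matrix.trace, Matrix.diag_apply, Matrix.mul_apply (M := V.transpose),
    Matrix.transpose_apply, h]
  rw [Finset.sum_comm]

theorem trace_mul_eq_sum {S : Matrix (Fin d) (Fin d) ℝ} (hS : S.IsSymm)
    (V : Matrix (Fin d) (Fin d) ℝ) : (S * V).trace = ∑ a, ∑ b, V a b * S a b := by
  simp only [Matrix.trace, Matrix.diag_apply, Matrix.mul_apply]
  rw [Finset.sum_comm]
  refine Finset.sum_congr rfl fun a _ => Finset.sum_congr rfl fun b _ => ?_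
  rw [hS.apply a b]
  ring

theorem inner_applyTo (U V : Matrix (Fin d) (Fin d) ℝ) (p : EuclideanSpace ℝ (Fin d)) :
    inner ℝ (applyTo V p) (applyTo U p) = ∑ a, ∑ b, V a b * ∑ e, p b * p e * U a e := by
  rw [PiLp.inner_apply]
  simp only [RCLike.inner_apply, conj_trivial, applyTo_apply]
  refine Finset.sum_congr rfl fun a _ => ?_
  rw [mul_comm, Finset.sum_mul]
  refine Finset.sum_congr rfl fun b _ => ?_
  rw [Finset.mul_sum, Finset.mul_sum]
  refine Finset.sum_congr rfl fun e _ => ?_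
  ring

theorem sum_mul_sum_swap (V : Matrix (Fin d) (Fin d) ℝ) (f : Fin n → ℝ)
    (K : Fin n → Fin d → Fin d → ℝ) :
    ∑ a, ∑ b, V a b * ∑ i, f i * K i a b = ∑ i, f i * ∑ a, ∑ b, V a b * K i a b := by
  simp only [Finset.mul_sum]
  rw [Finset.sum_comm]
  conv_rhs => rw [Finset.sum_comm]; enter [2, a]; rw [Finset.sum_comm]
  rw [Finset.sum_comm]
  refine Finset.sum_congr rfl fun a _ => Finset.sum_congr rfl fun b _ =>
    Finset.sum_congr rfl fun i _ => ?_
  ring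

/-- The points enter the norm part of the Hessian only through the matrix ∑ (2/g_i) p_i p_iᵀ, so its
d⁴ entries are read off a table of d² numbers. -/
theorem inner_sum_eq (U V : Matrix (Fin d) (Fin d) ℝ) (g : Fin n → ℝ) :
    ∑ a, ∑ b, V a b * ∑ c, ∑ e, ((if a = c then ∑ i, 2 / g i * (P i b * P i e) else 0)
        + (if b = e then ∑ i, 2 / g i * (P i a * P i c) else 0)) / 2 * U c e =
      ∑ i, 1 / g i * (inner ℝ (applyTo V (P i)) (applyTo U (P i))
        + inner ℝ (applyTo V.transpose (P i)) (applyTo U.transpose (P i))) := by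
  have h : ∀ a b, ∑ c, ∑ e, ((if a = c then ∑ i, 2 / g i * (P i b * P i e) else 0)
        + (if b = e then ∑ i, 2 / g i * (P i a * P i c) else 0)) / 2 * U c e =
      ∑ i, 1 / g i * (∑ e, P i b * P i e * U a e + ∑ c, P i a * P i c * U c b) := by
    intro a b
    have e1 : ∀ c e, ((if a = c then ∑ i, 2 / g i * (P i b * P i e) else 0)
        + (if b = e then ∑ i, 2 / g i * (P i a * P i c) else 0)) / 2 * U c e =
        (if a = c then (∑ i, 1 / g i * (P i b * P i e)) * U c e else 0) +
        (if b = e then (∑ i, 1 / g i * (P i a * P i c)) * U c e else 0) := by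
      intro c e
      have e0 : ∀ f : Fin n → ℝ, ∑ i, 2 / g i * f i = 2 * ∑ i, 1 / g i * f i := fun f => by
        rw [Finset.mul_sum]
        exact Finset.sum_congr rfl fun i _ => by ring
      rw [e0, e0]
      split_ifs <;> ring
    simp only [e1, Finset.sum_add_distrib, mul_add]
    rw [Finset.sum_comm]
    simp only [Finset.sum_ite_eq, Finset.mem_univ, if_true, Finset.sum_mul, Finset.mul_sum]
    rw [Finset.sum_comm, Finset.sum_comm (f := fun c i => 1 / g i * (P i a * P i c) * U c b)]
    congr 1 <;>
    · refine Finset.sum_congr rfl fun i _ => Finset.sum_congr rfl fun e _ => ?_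
      ring
  simp only [h, inner_applyTo, Matrix.transpose_apply]
  refine (sum_mul_sum_swap V (fun i => 1 / g i) fun i a b =>
    ∑ e, P i b * P i e * U a e + ∑ c, P i a * P i c * U c b).trans ?_
  refine Finset.sum_congr rfl fun i _ => ?_
  rw [Finset.sum_comm (f := fun a b => V b a * _)]
  simp only [mul_add, Finset.sum_add_distrib]

-- The row equations paired with arbitrary directions, after elimination of the cone unknowns: the
-- scale multiplies the gradient, and the last row ties the gradient of the solution to the scale.
-- The right-hand side ρ = 0 serves for nonsingularity and ρ = 1 for the Newton step.
open Matrix in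
theorem kkt_weak {k : ℕ} (hz : z ∈ domain k P) {x : KktIndex n d → ℝ} {ρ : ℝ}
    (hx : kkt P t z *ᵥ x = fun r => if r = .inr (.inr (.inr (.inr ()))) then ρ else 0) :
    (∀ v : Point n d, hessForm P z (direction x) v +
        x (.inr (.inr (.inr (.inr ())))) * gradForm P t z v +
        x (.inr (.inr (.inr (.inl ())))) * v.X.trace = 0) ∧
      (direction x).X.trace = 0 ∧
      gradForm P t z (direction x) = ρ + x (.inr (.inr (.inr (.inr ())))) ∧
      ∀ i, x (.inr (.inr (.inl i))) = 4 / residual P z i ^ 2 * slope P z (direction x) i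
        - 2 / residual P z i * x (.inr (.inr (.inr (.inr ())))) := by
  obtain ⟨-, hS, hY⟩ := isSymm_inv hz
  have hq := residual_pos hz
  set h := direction x with hh
  set S := z.X⁻¹ with hSd
  set Y := (1 - z.X)⁻¹ with hYd
  set q := residual P z with hqd
  set τ := x (.inr (.inr (.inr (.inr ())))) with hτ
  set ν := x (.inr (.inr (.inr (.inl ())))) with hν
  set β : Fin n → ℝ := fun i => x (.inr (.inr (.inl i))) with hβ
  have hX : ∀ a b, x (.inl (a, b)) = h.X a b := fun a b => rfl
  have hη : ∀ i, x (.inr (.inl i)) = h.y i := fun i => rfl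
  have rowU : ∀ a b, (∑ c, ∑ e, S a c * S b e * h.X c e) + (∑ c, ∑ e, Y a c * Y b e * h.X c e)
      + (∑ c, ∑ e, ((if a = c then ∑ i, 2 / q i * (P i b * P i e) else 0)
        + (if b = e then ∑ i, 2 / q i * (P i a * P i c) else 0)) / 2 * h.X c e)
      + (∑ i, -β i * ((applyTo z.X (P i) a * P i b + P i a * applyTo z.X (P i) b) / 2))
      + (if a = b then 1 else 0) * ν + (Y a b - S a b) * τ = 0 := by
    intro a b
    have := congrFun hx (.inl (a, b))
    simp only [Matrix.mulVec, dotProduct, kkt, kktOf, Fintype.sum_sum_type, Fintype.sum_prod_type,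
      reduceCtorEq, if_false, hX, Matrix.of_apply, zero_mul, Finset.sum_const_zero, zero_add,
      Finset.univ_unique, Finset.sum_singleton] at this
    simp only [← hSd, ← hYd, ← hqd] at this
    refine Eq.trans ?_ this
    have e : ∀ i, -β i * ((applyTo z.X (P i) a * P i b + P i a * applyTo z.X (P i) b) / 2) =
        -((applyTo z.X (P i) a * P i b + P i a * applyTo z.X (P i) b) / 2)
          * x (.inr (.inr (.inl i))) := fun i => by simp only [hβ]; ring
    have e2 : ∀ p₁ p₂ p₃ u : ℝ, (p₁ + p₂ + p₃) * u = p₁ * u + p₂ * u + p₃ * u := by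
      intros; ring
    simp only [e, e2, Finset.sum_add_distrib]
    ring
  have rowη : ∀ i, -(2 / q i) * h.y i + z.y i * β i + t * τ = 0 := by
    intro i
    have := congrFun hx (.inr (.inl i))
    simpa [Matrix.mulVec, dotProduct, kkt, kktOf, Fintype.sum_sum_type, Fintype.sum_prod_type,
      ← add_assoc, hη] using this
  have rowβ : ∀ i, slope P z h i - q i ^ 2 / 4 * β i - q i / 2 * τ = 0 := by
    intro i
    have := congrFun hx (.inr (.inr (.inl i)))
    simp only [Matrix.mulVec, dotProduct, kkt, kktOf, Fintype.sum_sum_type, Fintype.sum_prod_type,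
      reduceCtorEq, if_false, hX, hη, zero_mul, zero_add, Sum.inr.injEq, ite_mul,
      Finset.univ_unique, Finset.sum_singleton, Finset.sum_ite_eq, Finset.mem_univ, if_true] at this
    rw [slope_eq_sum]
    refine Eq.trans ?_ this
    simp only [neg_mul, Finset.sum_neg_distrib, mul_comm (h.X _ _)]
    change _ = _ + (_ + (-(q i ^ 2 / 4 * β i) + -(q i / 2 * τ)))
    ring
  have rowν : h.X.trace = 0 := by
    have := congrFun hx (.inr (.inr (.inr (.inl ()))))
    simpa [Matrix.mulVec, dotProduct, kkt, kktOf, Fintype.sum_sum_type, Fintype.sum_prod_type,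
      hX, Matrix.trace] using this
  have rowτ : (∑ a, ∑ b, h.X a b * (Y a b - S a b)) + t * ∑ i, h.y i - ∑ i, q i / 2 * β i
      - (n + 1) * τ = ρ := by
    have := congrFun hx (.inr (.inr (.inr (.inr ()))))
    simp only [Matrix.mulVec, dotProduct, kkt, kktOf, Fintype.sum_sum_type, Fintype.sum_prod_type,
      hX, hη, zero_mul, zero_add,
      Finset.univ_unique, Finset.sum_singleton, if_true] at this
    rw [← this, Finset.mul_sum]
    simp only [neg_mul, Finset.sum_neg_distrib, mul_comm (h.X _ _)]
    change _ = _ + (_ + (-(∑ i, q i / 2 * β i) + -((n + 1) * τ)))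
    ring
  have hβi : ∀ i, β i = 4 / q i ^ 2 * slope P z h i - 2 / q i * τ := by
    intro i
    have h1 := rowβ i
    have h2 := (hq i).ne'
    have h3 : slope P z h i = q i ^ 2 / 4 * β i + q i / 2 * τ := by linarith
    rw [h3]
    field_simp
    ring
  refine ⟨fun v => ?_, rowν, ?_, hβi⟩
  · have E : ∑ a, ∑ b, v.X a b * ((∑ c, ∑ e, S a c * S b e * h.X c e)
        + (∑ c, ∑ e, Y a c * Y b e * h.X c e)
        + (∑ c, ∑ e, ((if a = c then ∑ i, 2 / q i * (P i b * P i e) else 0)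
          + (if b = e then ∑ i, 2 / q i * (P i a * P i c) else 0)) / 2 * h.X c e)
        + (∑ i, -β i * ((applyTo z.X (P i) a * P i b + P i a * applyTo z.X (P i) b) / 2))
        + (if a = b then 1 else 0) * ν + (Y a b - S a b) * τ) = 0 := by
      simp only [rowU, mul_zero, Finset.sum_const_zero]
    simp only [mul_add, Finset.sum_add_distrib] at E
    rw [← trace_form_eq_sum hS, ← trace_form_eq_sum hY, inner_sum_eq, sum_mul_sum_swap] at E
    have eν : ∑ a, ∑ b, v.X a b * ((if a = b then 1 else 0) * ν) = ν * v.X.trace := by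
      simp [Matrix.trace, Finset.mul_sum, mul_comm]
    have eτ : ∑ a, ∑ b, v.X a b * ((Y a b - S a b) * τ) =
        τ * ((Y * v.X).trace - (S * v.X).trace) := by
      rw [trace_mul_eq_sum hS, trace_mul_eq_sum hY]
      simp only [Finset.mul_sum, mul_sub, sub_mul, Finset.sum_sub_distrib]
      congr 1 <;>
      · refine Finset.sum_congr rfl fun a _ => Finset.sum_congr rfl fun b _ => ?_
        ring
    rw [eν, eτ] at E
    have F : ∑ i, v.y i * (-(2 / q i) * h.y i + z.y i * β i + t * τ) = 0 := by
      simp only [rowη, mul_zero, Finset.sum_const_zero]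
    -- Substituting the formula for the cone unknowns restores the slope products of the Hessian and
    -- the slope part of the gradient.
    have G : ∑ i, -β i * ∑ a, ∑ b, v.X a b *
        ((applyTo z.X (P i) a * P i b + P i a * applyTo z.X (P i) b) / 2) +
        ∑ i, v.y i * (-(2 / q i) * h.y i + z.y i * β i + t * τ) =
        ∑ i, (-(2 / q i * (v.y i * h.y i)) + 4 / q i ^ 2 * (slope P z v i * slope P z h i)) +
        τ * (t * ∑ i, v.y i - ∑ i, 2 / q i * slope P z v i) := by
      rw [mul_sub, Finset.mul_sum, Finset.mul_sum, Finset.mul_sum, ← Finset.sum_sub_distrib,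
        ← Finset.sum_add_distrib, ← Finset.sum_add_distrib]
      refine Finset.sum_congr rfl fun i _ => ?_
      have e := slope_eq_sum (P := P) (z := z) v i
      have e' : ∑ a, ∑ b, v.X a b *
        ((applyTo z.X (P i) a * P i b + P i a * applyTo z.X (P i) b) / 2) =
          z.y i * v.y i - slope P z v i := by linarith
      rw [e', hβi i]
      ring
    rw [hessForm_comm hz, hessForm, gradForm]
    simp only [Finset.sum_add_distrib, Finset.sum_sub_distrib, Finset.sum_neg_distrib] at G ⊢
    linarith
  · rw [gradForm, trace_mul_eq_sum hS, trace_mul_eq_sum hY, ← hqd]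
    have e : ∑ i, q i / 2 * β i = ∑ i, 2 / q i * slope P z h i - n * τ := by
      have : (n : ℝ) * τ = ∑ _i : Fin n, τ := by simp
      rw [this, ← Finset.sum_sub_distrib]
      refine Finset.sum_congr rfl fun i _ => ?_
      have h2 := (hq i).ne'
      rw [hβi i]
      field_simp
      ring
    simp only [mul_sub, Finset.sum_sub_distrib] at rowτ
    linarith

end Kkt

/-! ### The damped Newton step. -/

section NewtonStep

open Matrix

variable {n d k : ℕ} {P : Fin n → EuclideanSpace ℝ (Fin d)} {t : ℝ} {z : Point n d}

/-- The scale unknown of the Newton system. -/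
abbrev scaleIndex (n d : ℕ) : KktIndex n d := .inr (.inr (.inr (.inr ())))

/-- Transposition of the matrix component. -/
def flip (u : Point n d) : Point n d := mkPoint u.X.transpose u.y

theorem slope_flip (u : Point n d) (i : Fin n) : slope P z (flip u) i = slope P z u i := by
  simp only [slope, flip, mkPoint_X, mkPoint_y, symPart, Matrix.transpose_transpose,
    add_comm u.X.transpose]

theorem trace_form_transpose {S : Matrix (Fin d) (Fin d) ℝ} (hS : S.IsSymm)
    (U V : Matrix (Fin d) (Fin d) ℝ) :
    (U * S * V.transpose * S).trace = (U.transpose * S * V * S).trace := by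
  rw [← Matrix.trace_transpose]
  simp only [Matrix.transpose_mul, Matrix.transpose_transpose, hS.eq]
  rw [← Matrix.mul_assoc, ← Matrix.mul_assoc, Matrix.trace_mul_comm]
  simp only [Matrix.mul_assoc]

/-- Invariance under transposition makes symmetric and antisymmetric directions orthogonal; hence
the solution of the unrestricted system is symmetric. -/
theorem hessForm_flip (hz : z ∈ domain k P) (u v : Point n d) :
    hessForm P z (flip u) (flip v) = hessForm P z u v := by
  obtain ⟨-, h1, h2⟩ := isSymm_inv hz
  unfold hessForm
  simp only [slope_flip]
  simp only [flip, mkPoint_X, mkPoint_y, Matrix.transpose_transpose, trace_form_transpose h1,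
    trace_form_transpose h2, add_comm (inner ℝ (applyTo u.X.transpose _) _)]

theorem gradForm_flip (hz : z ∈ domain k P) (u : Point n d) :
    gradForm P t z (flip u) = gradForm P t z u := by
  obtain ⟨-, h1, h2⟩ := isSymm_inv hz
  have h : ∀ S : Matrix (Fin d) (Fin d) ℝ, S.IsSymm → (S * u.X.transpose).trace = (S * u.X).trace :=
    fun S hS => by
      rw [← Matrix.trace_transpose, Matrix.transpose_mul, hS.eq, Matrix.transpose_transpose,
        Matrix.trace_mul_comm]
  unfold gradForm
  simp only [slope_flip]
  simp only [flip, mkPoint_X, mkPoint_y, h _ h1, h _ h2]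

/-- Testing a kernel vector against its own direction gives Hessian form + τ² = 0, so direction and
scale vanish. Testing against the identity matrix kills the trace multiplier, and the cone unknowns
are determined by the rest. -/
theorem kkt_isUnit_det (hz : z ∈ domain k P) (hd : 0 < d) : IsUnit (kkt P t z).det := by
  rw [isUnit_iff_ne_zero]
  intro h0
  obtain ⟨x, hx0, hx⟩ := Matrix.exists_mulVec_eq_zero_iff.2 h0
  obtain ⟨h1, h2, h3, h4⟩ := kkt_weak (ρ := 0) hz (x := x) (t := t) (by rw [hx]; ext; simp)
  rw [zero_add] at h3
  have h5 := h1 (direction x)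
  rw [h2, h3] at h5
  have h6 := hessForm_pos hz (direction x)
  have hdir : direction x = 0 := h6.2 (by nlinarith [mul_self_nonneg (x (scaleIndex n d))])
  have hτ : x (scaleIndex n d) = 0 := by
    have : x (scaleIndex n d) * x (scaleIndex n d) = 0 := by nlinarith
    exact mul_self_eq_zero.1 this
  have hν : x (.inr (.inr (.inr (.inl ())))) = 0 := by
    have h7 := h1 (mkPoint 1 0)
    rw [hτ, hdir, show (0 : Point n d) = (0 : ℝ) • 0 by simp, hessForm_smul_left] at h7
    simp only [mkPoint_X, Matrix.trace_one, Fintype.card_fin, zero_mul, zero_add] at h7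
    have : (d : ℝ) ≠ 0 := by positivity
    simpa [this] using h7
  apply hx0
  funext r
  rcases r with ⟨a, b⟩ | i | i | _ | _
  · exact congrFun (congrFun (Point.ext_iff'.1 hdir).1 a) b
  · exact (Point.ext_iff'.1 hdir).2 i
  · rw [h4 i, hτ, hdir, show (0 : Point n d) = (0 : ℝ) • 0 by simp, slope_smul]
    simp
  · exact hν
  · exact hτ

/-- The damped Newton step read off the last column of the inverse of the Newton system. -/
theorem newton_step (hz : z ∈ domain k P) (hd : 0 < d) {x : KktIndex n d → ℝ}
    (hx : ∀ r, x r = (kkt P t z)⁻¹ r (scaleIndex n d)) {κ : ℝ} (hκ : κ = -x (scaleIndex n d)) :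
    0 < κ ∧ κ ≤ 1 ∧ decrement P t z = Real.sqrt ((1 - κ) / κ) ∧
      z - direction x ∈ domain k P ∧
      relaxation P t (z - direction x) ≤ relaxation P t z - (1 - κ) ^ 2 := by
  have hu := kkt_isUnit_det (t := t) hz hd
  have hcol : kkt P t z *ᵥ x = fun r => if r = .inr (.inr (.inr (.inr ()))) then 1 else 0 := by
    funext r
    have := congrFun (congrFun (Matrix.mul_nonsing_inv _ hu) r) (scaleIndex n d)
    rw [Matrix.mul_apply, Matrix.one_apply] at this
    simpa only [Matrix.mulVec, dotProduct, hx] using this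
  obtain ⟨h1, h2, h3, -⟩ := kkt_weak hz hcol
  set τ := x (.inr (.inr (.inr (.inr ())))) with hτ
  set h := direction x with hh
  have hτκ : τ = -κ := by rw [hκ]; simp [τ]
  -- On the antisymmetric part of `h` both gradient and trace vanish, so the weak equation makes it
  -- Hessian-orthogonal to `h`, and by flip invariance to itself.
  have hanti : h - flip h = 0 := by
    apply (hessForm_pos hz _).2
    have e : ∀ u v w : Point n d,
        hessForm P z (u - v) w = hessForm P z u w - hessForm P z v w := fun u v w => by
      rw [sub_eq_add_neg, ← neg_one_smul ℝ v, hessForm_add_left, hessForm_smul_left]; ring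
    have hf : flip (h - flip h) = (-1 : ℝ) • (h - flip h) := by
      rw [Point.ext_iff']
      simp [flip]
    have a1 := h1 (h - flip h)
    have g0 : gradForm P t z (h - flip h) = 0 := by
      have := gradForm_flip (t := t) hz (h - flip h)
      rw [hf, gradForm_smul] at this
      linarith
    have t0 : (h - flip h).X.trace = 0 := by simp [flip, Matrix.trace_sub]
    have a2 : hessForm P z (flip h) (h - flip h) = -hessForm P z h (h - flip h) := by
      have := hessForm_flip hz h (h - flip h)
      rw [hf, hessForm_comm hz, hessForm_smul_left, hessForm_comm hz] at this
      linarith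
    rw [e, a2]
    rw [g0, t0] at a1
    linarith
  have htan : h ∈ tangent n d := by
    rw [mem_tangent]
    refine ⟨?_, h2⟩
    have := (Point.ext_iff'.1 (sub_eq_zero.1 hanti)).1
    exact this.symm
  have hB : ∀ v ∈ tangent n d, hessForm P z h v = κ * gradForm P t z v := by
    intro v hv
    have := h1 v
    rw [(mem_tangent.1 hv).2, hτκ] at this
    linarith
  have hg : gradForm P t z h = 1 - κ := by rw [h3, hτκ]; ring
  -- So h is κ times the Newton direction and κ = 1/(1 + λ²). Nonnegativity of this value confines κ
  -- to [0, 1]; κ = 0 is excluded because then h = 0, while its gradient value would be 1.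
  have hhh : hessForm P z h h = κ * (1 - κ) := by rw [hB h htan, hg]
  obtain ⟨hp, hp0⟩ := hessForm_pos hz h
  rw [hhh] at hp hp0
  have hκ0 : 0 < κ := by
    rcases lt_trichotomy κ 0 with hneg | h0 | hpos
    · nlinarith
    · exfalso
      have hz0 : h = (0 : ℝ) • 0 := by rw [hp0 (by rw [h0]; ring)]; simp
      rw [hz0, gradForm_smul, h0] at hg
      norm_num at hg
    · exact hpos
  have hκ1 : κ ≤ 1 := by
    by_contra hcon
    push Not at hcon
    nlinarith
  refine ⟨hκ0, hκ1, ?_, ?_⟩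
  · rw [decrement_eq hz ((tangent n d).smul_mem κ⁻¹ htan) (fun v hv => by
      rw [hessForm_smul_left, hB v hv, inv_mul_cancel_left₀ hκ0.ne']), gradForm_smul, hg,
      inv_mul_eq_div]
  · have hnb : hessForm P z ((-1 : ℝ) • h) ((-1 : ℝ) • h) = κ * (1 - κ) := by
      rw [hessForm_smul_left, hessForm_comm hz, hessForm_smul_left, hhh]; ring
    -- κ(1 - κ) ≤ 1/4 always holds, so the step lies in the Dikin ellipsoid without any line search.
    -- The change is at most -(1 - κ) + κ(1 - κ) = -(1 - κ)².
    obtain ⟨s1, s2⟩ := relaxation_step (t := t) hz ((tangent n d).smul_mem (-1) htan)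
      (by rw [hnb]; nlinarith [sq_nonneg (κ - 1 / 2)])
    rw [hnb, gradForm_smul, hg] at s2
    have e : z + (-1 : ℝ) • h = z - h := by simp [sub_eq_add_neg]
    rw [e] at s1 s2
    exact ⟨s1, by nlinarith⟩

end NewtonStep

/-! ### Frame properties of programs, and the lower bound on ω. -/

section Machine

@[simp] theorem writeNat_real (s : Memory) (c i x : ℕ) : (s.writeNat c i x).real = s.real := rfl
@[simp] theorem writeReal_nat (s : Memory) (b i : ℕ) (x : ℝ) :
    (s.writeReal b i x).nat = s.nat := rfl
@[simp] theorem writeNat_nat_same (s : Memory) (c i x : ℕ) :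
    (s.writeNat c i x).nat c = Function.update (s.nat c) i x := by simp [Memory.writeNat]
@[simp] theorem writeReal_real_same (s : Memory) (b i : ℕ) (x : ℝ) :
    (s.writeReal b i x).real b = Function.update (s.real b) i x := by simp [Memory.writeReal]
theorem writeNat_nat_ne (s : Memory) {c c' : ℕ} (h : c' ≠ c) (i x : ℕ) :
    (s.writeNat c i x).nat c' = s.nat c' := by simp [Memory.writeNat, h]
theorem writeReal_real_ne (s : Memory) {b b' : ℕ} (h : b' ≠ b) (i : ℕ) (x : ℝ) :
    (s.writeReal b i x).real b' = s.real b' := by simp [Memory.writeReal, h]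

/-- A strict upper bound for the names of the arrays to which a program writes. -/
def Prog.bound : Prog → ℕ
  | .skip => 0
  | .setNat b _ _ => b + 1
  | .setReal b _ _ => b + 1
  | .seq p q => max p.bound q.bound
  | .ite _ p q => max p.bound q.bound
  | .while _ p => p.bound

/-- Array names are literals in the program text, so a program can only touch finitely many arrays.
This protects the working data from the unknown inversion program. -/
theorem Exec.frame {p : Prog} {s s' : Memory} {τ : ℕ} (h : Exec p s s' τ) :
    ∀ b, p.bound ≤ b → s'.nat b = s.nat b ∧ s'.real b = s.real b := by
  induction h with
  | skip s => exact fun _ _ => ⟨rfl, rfl⟩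
  | setNat s b i u =>
    intro c hc
    simp only [Prog.bound] at hc
    exact ⟨writeNat_nat_ne _ (by omega) _ _, rfl⟩
  | setReal s b i u =>
    intro c hc
    simp only [Prog.bound] at hc
    exact ⟨rfl, writeReal_real_ne _ (by omega) _ _⟩
  | seq _ _ ih₁ ih₂ =>
    intro b hb
    simp only [Prog.bound, max_le_iff] at hb
    rw [(ih₂ b hb.2).1, (ih₂ b hb.2).2]
    exact ih₁ b hb.1
  | iteTrue _ _ ih =>
    intro b hb
    simp only [Prog.bound, max_le_iff] at hb
    exact ih b hb.1
  | iteFalse _ _ ih =>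
    intro b hb
    simp only [Prog.bound, max_le_iff] at hb
    exact ih b hb.2
  | whileTrue _ _ _ ih₁ ih₂ =>
    intro b hb
    rw [(ih₂ b hb).1, (ih₂ b hb).2]
    exact ih₁ b hb
  | whileFalse _ => exact fun _ _ => ⟨rfl, rfl⟩

/-- In `τ` steps at most `τ` cells of an array are changed. -/
theorem Exec.exists_changed {p : Prog} {s s' : Memory} {τ : ℕ} (h : Exec p s s' τ) (b : ℕ) :
    ∃ F : Finset ℕ, F.card ≤ τ ∧ ∀ i ∉ F, s'.real b i = s.real b i := by
  induction h with
  | skip s => exact ⟨∅, by simp, fun _ _ => rfl⟩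
  | setNat s c i u => exact ⟨∅, by simp, fun _ _ => rfl⟩
  | setReal s c i u =>
    refine ⟨{i.eval s}, by simp, fun j hj => ?_⟩
    by_cases hc : b = c
    · subst hc
      simp only [Finset.mem_singleton] at hj
      simp [hj]
    · rw [writeReal_real_ne _ hc]
  | seq _ _ ih₁ ih₂ =>
    obtain ⟨F₁, h₁, h₁'⟩ := ih₁
    obtain ⟨F₂, h₂, h₂'⟩ := ih₂
    refine ⟨F₁ ∪ F₂, (Finset.card_union_le _ _).trans (by omega), fun i hi => ?_⟩
    simp only [Finset.mem_union, not_or] at hi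
    rw [h₂' i hi.2, h₁' i hi.1]
  | iteTrue _ _ ih => obtain ⟨F, h, h'⟩ := ih; exact ⟨F, by omega, h'⟩
  | iteFalse _ _ ih => obtain ⟨F, h, h'⟩ := ih; exact ⟨F, by omega, h'⟩
  | whileTrue _ _ _ ih₁ ih₂ =>
    obtain ⟨F₁, h₁, h₁'⟩ := ih₁
    obtain ⟨F₂, h₂, h₂'⟩ := ih₂
    refine ⟨F₁ ∪ F₂, (Finset.card_union_le _ _).trans (by omega), fun i hi => ?_⟩
    simp only [Finset.mem_union, not_or] at hi
    rw [h₂' i hi.2, h₁' i hi.1]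
  | whileFalse _ => exact ⟨∅, by simp, fun _ _ => rfl⟩

/-- Inversion takes at least quadratic time, since the output has `m²` entries. -/
theorem InversionTime.two_le {ω : ℝ} (h : InversionTime ω) : 2 ≤ ω := by
  obtain ⟨inv, C, hinv⟩ := h
  have key : ∀ m : ℕ, 1 ≤ m → (m : ℝ) ^ (2 : ℝ) ≤ C * (m : ℝ) ^ ω := by
    intro m hm
    have hlt : ∀ i j : Fin m, (i : ℕ) * m + j < m * m := fun i j => by
      calc (i : ℕ) * m + j < i * m + m := by omega
        _ = (i + 1) * m := by ring
        _ ≤ m * m := Nat.mul_le_mul_right _ i.2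
    -- The input is the identity, and the output array is prefilled with 2, which is not an entry of
    -- the inverse; all m² output cells must therefore change.
    let s : Memory :=
      { nat := fun _ _ => m
        real := fun b r => if b = 0 then (if r / m = r % m then 1 else 0) else 2 }
    obtain ⟨s', τ, hex, hτ, hout⟩ := hinv m hm 1 (by simp) s rfl (fun i j => by
      have h1 : ((i : ℕ) * m + j) / m = i := by
        rw [mul_comm, Nat.mul_add_div hm, Nat.div_eq_of_lt j.2, add_zero]
      have h2 : ((i : ℕ) * m + j) % m = j := by
        rw [mul_comm, Nat.mul_add_mod, Nat.mod_eq_of_lt j.2]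
      simp [s, h1, h2, Matrix.one_apply, Fin.ext_iff])
    obtain ⟨F, hF, hF'⟩ := hex.exists_changed 1
    have hsub : Finset.range (m * m) ⊆ F := by
      intro r hr
      rw [Finset.mem_range] at hr
      by_contra hrF
      have h1 := hF' r hrF
      have hr1 : r / m < m := Nat.div_lt_of_lt_mul hr
      have h2 := hout ⟨r / m, hr1⟩ ⟨r % m, Nat.mod_lt _ hm⟩
      simp only [Nat.div_add_mod'] at h2
      rw [h1] at h2
      simp only [s, one_ne_zero, if_false, inv_one, Matrix.one_apply] at h2
      split_ifs at h2 <;> norm_num at h2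
    have hc := Finset.card_le_card hsub
    rw [Finset.card_range] at hc
    have : ((m * m : ℕ) : ℝ) ≤ τ := by exact_mod_cast hc.trans hF
    push_cast at this
    rw [show ((m : ℝ) ^ (2 : ℝ)) = m * m by norm_num [sq]]
    linarith
  by_contra hcon
  push Not at hcon
  -- If ω < 2, then m² ≤ C m^ω fails for large m.
  have htend : Filter.Tendsto (fun m : ℕ => (m : ℝ) ^ (2 - ω)) Filter.atTop Filter.atTop :=
    (tendsto_rpow_atTop (by linarith)).comp tendsto_natCast_atTop_atTop
  obtain ⟨m, hm1, hm2⟩ := ((htend.eventually_gt_atTop C).and (Filter.eventually_ge_atTop 1)).exists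
  have hm0 : (0 : ℝ) < m := by exact_mod_cast hm2
  have h1 := key m hm2
  rw [Real.rpow_sub hm0, lt_div_iff₀ (Real.rpow_pos_of_pos hm0 _)] at hm1
  linarith

/-! ### Timed specifications of loops and assignments. -/

/-- The program halts within time `T` in a memory satisfying `Q`. -/
def Runs (p : Prog) (s : Memory) (T : ℝ) (Q : Memory → Prop) : Prop :=
  ∃ (s' : Memory) (τ : ℕ), Exec p s s' τ ∧ (τ : ℝ) ≤ T ∧ Q s'

theorem Runs.mono {p : Prog} {s : Memory} {T T' : ℝ} {Q Q' : Memory → Prop} (h : Runs p s T Q)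
    (hT : T ≤ T') (hQ : ∀ s', Q s' → Q' s') : Runs p s T' Q' := by
  obtain ⟨s', τ, h1, h2, h3⟩ := h
  exact ⟨s', τ, h1, h2.trans hT, hQ _ h3⟩

theorem Runs.seq {p q : Prog} {s : Memory} {T T' : ℝ} {Q Q' : Memory → Prop} (h : Runs p s T Q)
    (h' : ∀ s', Q s' → Runs q s' T' Q') : Runs (.seq p q) s (T + T') Q' := by
  obtain ⟨s', τ, h1, h2, h3⟩ := h
  obtain ⟨s'', τ', h1', h2', h3'⟩ := h' s' h3
  exact ⟨s'', τ + τ', h1.seq h1', by push_cast; linarith, h3'⟩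

theorem runs_setNat (s : Memory) (b : ℕ) (i u : NExp) :
    Runs (.setNat b i u) s (i.cost + u.cost + 1)
      (fun s' => s' = s.writeNat b (i.eval s) (u.eval s)) :=
  ⟨_, _, Exec.setNat s b i u, by push_cast; rfl, rfl⟩

theorem runs_setReal (s : Memory) (b : ℕ) (i : NExp) (u : RExp) :
    Runs (.setReal b i u) s (i.cost + u.cost + 1)
      (fun s' => s' = s.writeReal b (i.eval s) (u.eval s)) :=
  ⟨_, _, Exec.setReal s b i u, by push_cast; rfl, rfl⟩

/-- A while loop controlled by a potential that decreases with every execution of the body. -/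
theorem runs_while {c : Test} {p : Prog} {T : ℝ} (hT : 0 ≤ T) {I : ℕ → Memory → Prop}
    (h0 : ∀ s, ¬ I 0 s)
    (hstep : ∀ j s, I (j + 1) s → c.Holds s → Runs p s T (I j)) :
    ∀ j s, I j s → Runs (.while c p) s (j * (T + c.cost))
      (fun s' => ¬ c.Holds s' ∧ ∃ j, I j s') := by
  intro j
  induction j with
  | zero => exact fun s hs => absurd hs (h0 s)
  | succ j ih =>
    intro s hs
    by_cases hc : c.Holds s
    · obtain ⟨s', τ, h1, h2, h3⟩ := hstep j s hs hc
      obtain ⟨s'', τ', h1', h2', h3'⟩ := ih s' h3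
      exact ⟨s'', _, Exec.whileTrue hc h1 h1', by push_cast; linarith, h3'⟩
    -- Level 0 is unreachable, so at least one unit of potential remains to pay for the failing
    -- test.
    · refine ⟨s, _, Exec.whileFalse hc, ?_, hc, j + 1, hs⟩
      have : 0 ≤ (j : ℝ) * (T + c.cost) := by positivity
      push_cast
      linarith

/-- The scalar variable with name `c`. -/
abbrev NExp.var (c : ℕ) : NExp := .get c (.lit 0)

/-- Execute the body for `c = 0, …, N - 1`. -/
def forLoop (c : ℕ) (N : NExp) (body : Prog) : Prog :=
  .seq (.setNat c (.lit 0) (.lit 0)) (.while (.natLt (.var c) N)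
    (.seq body (.setNat c (.lit 0) (.add (.var c) (.lit 1)))))

theorem runs_forLoop {c : ℕ} {N : NExp} {body : Prog} {K : ℕ} {T : ℝ} (hT : 0 ≤ T)
    {I : ℕ → Memory → Prop} (hc : ∀ i s, I i s → s.nat c 0 = i) (hN : ∀ i s, I i s → N.eval s = K)
    (hbody : ∀ i < K, ∀ s, I i s →
      Runs body s T (fun s' => s'.nat c 0 = i ∧ I (i + 1) (s'.writeNat c 0 (i + 1))))
    {s : Memory} (h0 : I 0 (s.writeNat c 0 0)) :
    Runs (forLoop c N body) s ((K + 1) * (T + N.cost + 9)) (I K) := by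
  have key : ∀ j i s, i + j = K → I i s →
      Runs (.while (.natLt (.var c) N)
        (.seq body (.setNat c (.lit 0) (.add (.var c) (.lit 1))))) s
        (j * (T + N.cost + 9) + (N.cost + 3)) (I K) := by
    intro j
    induction j with
    | zero =>
      intro i s hij hI
      have hi : i = K := by omega
      subst hi
      refine ⟨s, _, Exec.whileFalse ?_, ?_, hI⟩
      · simp [Test.Holds, NExp.eval, hc _ _ hI, hN _ _ hI]
      · simp [Test.cost, NExp.cost]; linarith
    | succ j ih =>
      intro i s hij hI
      obtain ⟨s', τ, h1, h2, h3, h4⟩ := hbody i (by omega) s hI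
      obtain ⟨s'', τ', h1', h2', h3'⟩ := ih (i + 1) _ (by omega) h4
      have hset := Exec.setNat s' c (.lit 0) (.add (.var c) (.lit 1))
      simp only [NExp.eval, h3] at hset
      refine ⟨s'', _, Exec.whileTrue ?_ (h1.seq hset) h1', ?_, h3'⟩
      · simp [Test.Holds, NExp.eval, hc _ _ hI, hN _ _ hI]; omega
      · simp only [Test.cost, NExp.cost]; push_cast; linarith
  have hset := Exec.setNat s c (.lit 0) (.lit 0)
  obtain ⟨s', τ, h1, h2, h3⟩ := key K 0 _ (by omega) h0
  refine ⟨s', _, hset.seq h1, ?_, h3⟩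
  simp only [NExp.cost]; push_cast; linarith

/-- Real expressions with case distinctions. -/
inductive CExp where
  | ret (u : RExp)
  | cond (u v : NExp) (p q : CExp)

/-- Value of a conditional expression. -/
def CExp.eval (s : Memory) : CExp → ℝ
  | .ret u => u.eval s
  | .cond u v p q => if u.eval s < v.eval s then p.eval s else q.eval s

/-- Bound for the number of operations in the evaluation of a conditional expression. -/
def CExp.cost : CExp → ℕ
  | .ret u => u.cost
  | .cond u v p q => u.cost + v.cost + 1 + (p.cost + q.cost)

/-- Assignment of a conditional expression. -/
def CExp.assign (b : ℕ) (i : NExp) : CExp → Prog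
  | .ret u => .setReal b i u
  | .cond u v p q => .ite (.natLt u v) (p.assign b i) (q.assign b i)

theorem CExp.runs_assign (s : Memory) (b : ℕ) (i : NExp) (e : CExp) :
    Runs (e.assign b i) s (i.cost + e.cost + 1)
      (fun s' => s' = s.writeReal b (i.eval s) (e.eval s)) := by
  induction e with
  | ret u => exact runs_setReal s b i u
  | cond u v p q ihp ihq =>
    by_cases h : u.eval s < v.eval s
    · obtain ⟨s', τ, h1, h2, h3⟩ := ihp
      refine ⟨s', _, Exec.iteTrue h h1, ?_, by simpa [CExp.eval, h] using h3⟩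
      simp only [Test.cost, CExp.cost]; push_cast
      have : (0 : ℝ) ≤ q.cost := by positivity
      linarith
    · obtain ⟨s', τ, h1, h2, h3⟩ := ihq
      refine ⟨s', _, Exec.iteFalse h h1, ?_, by simpa [CExp.eval, h] using h3⟩
      simp only [Test.cost, CExp.cost]; push_cast
      have : (0 : ℝ) ≤ p.cost := by positivity
      linarith

/-- The memories agree up to the scalars `c₁`, `c₂` and the real array `b`. -/
structure Agree (c₁ c₂ b : ℕ) (s s' : Memory) : Prop where
  nat : ∀ c, c ≠ c₁ → c ≠ c₂ → s'.nat c = s.nat c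
  real : ∀ b', b' ≠ b → s'.real b' = s.real b'

theorem Agree.refl (c₁ c₂ b : ℕ) (s : Memory) : Agree c₁ c₂ b s s :=
  ⟨fun _ _ _ => rfl, fun _ _ => rfl⟩

theorem Agree.writeReal {c₁ c₂ b : ℕ} {s s' : Memory} (h : Agree c₁ c₂ b s s') (i : ℕ) (x : ℝ) :
    Agree c₁ c₂ b s (s'.writeReal b i x) :=
  ⟨h.nat, fun b' hb => by rw [writeReal_real_ne _ hb, h.real b' hb]⟩

theorem Agree.writeNat {c₁ c₂ b : ℕ} {s s' : Memory} (h : Agree c₁ c₂ b s s') {c : ℕ}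
    (hc : c = c₁ ∨ c = c₂) (i x : ℕ) : Agree c₁ c₂ b s (s'.writeNat c i x) :=
  ⟨fun c' h1 h2 => by
    rw [writeNat_nat_ne _ (by rcases hc with rfl | rfl <;> assumption), h.nat c' h1 h2], h.real⟩

/-- `b[r] := e` for `r < N`; the counter `c₁` holds `r`. -/
def fill (c₁ b : ℕ) (N : NExp) (e : CExp) : Prog := forLoop c₁ N (e.assign b (.var c₁))

/-- The expression may rely on the r-th cell of `b` being still untouched when it is evaluated; this
permits updates in place. -/
theorem runs_fill {c₁ c₂ b R : ℕ} {N : NExp} {e : CExp} {s : Memory} (F : ℕ → ℝ) {T : ℝ}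
    (hT : ((R : ℝ) + 1) * (e.cost + N.cost + 12) ≤ T)
    (hN : ∀ s', Agree c₁ c₂ b s s' → N.eval s' = R)
    (he : ∀ r < R, ∀ s', Agree c₁ c₂ b s s' → s'.nat c₁ 0 = r → s'.real b r = s.real b r →
      e.eval s' = F r) :
    Runs (fill c₁ b N e) s T
      (fun s' => Agree c₁ c₂ b s s' ∧ ∀ r < R, s'.real b r = F r) := by
  have := runs_forLoop (c := c₁) (N := N) (body := e.assign b (.var c₁)) (K := R)
    (T := e.cost + 3) (by positivity)
    (I := fun i s' => s'.nat c₁ 0 = i ∧ Agree c₁ c₂ b s s' ∧ (∀ r < i, s'.real b r = F r) ∧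
      ∀ r, i ≤ r → s'.real b r = s.real b r)
    (fun i s h => h.1) (fun i s h => hN s h.2.1) (fun i hi s' ⟨h1, h2, h3, h4⟩ => by
      refine (CExp.runs_assign s' b (.var c₁) e).mono ?_ ?_
      · simp only [NExp.cost]; push_cast; linarith
      · rintro s'' rfl
        simp only [NExp.eval, h1]
        refine ⟨by simpa using h1, by simp, (h2.writeReal _ _).writeNat (Or.inl rfl) _ _, ?_, ?_⟩
        · intro r hr
          simp only [writeNat_real, writeReal_real_same]
          by_cases hri : r = i
          · subst hri
            rw [Function.update_self]
            exact he r hi s' h2 h1 (h4 r le_rfl)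
          · rw [Function.update_of_ne hri]
            exact h3 r (by omega)
        · intro r hr
          simp only [writeNat_real, writeReal_real_same]
          rw [Function.update_of_ne (by omega)]
          exact h4 r (by omega))
    (s := s) ⟨by simp, (Agree.refl _ _ _ _).writeNat (Or.inl rfl) _ _, by simp, by simp⟩
  refine this.mono (le_trans (le_of_eq ?_) hT) fun s' h => ⟨h.2.1, h.2.2.1⟩
  ring

/-- `b[r] := ∑ e` for `r < N`, where the sum extends over `l < L`; the counters `c₁` and `c₂` hold
`r` and `l`. -/
def fillSum (c₁ c₂ b : ℕ) (N L : NExp) (e : RExp) : Prog :=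
  forLoop c₁ N (.seq (.setReal b (.var c₁) (.ofNat (.lit 0)))
    (forLoop c₂ L (.setReal b (.var c₁) (.add (.get b (.var c₁)) e))))

theorem runs_fillSum {c₁ c₂ b R M : ℕ} {N L : NExp} {e : RExp} {s : Memory} (F : ℕ → ℕ → ℝ)
    (hc : c₁ ≠ c₂) {T : ℝ}
    (hT : ((R : ℝ) + 1) * (M + 1) * (e.cost + N.cost + L.cost + 40) ≤ T)
    (hN : ∀ s', Agree c₁ c₂ b s s' → N.eval s' = R)
    (hL : ∀ s', Agree c₁ c₂ b s s' → L.eval s' = M)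
    (he : ∀ r < R, ∀ l < M, ∀ s', Agree c₁ c₂ b s s' → s'.nat c₁ 0 = r → s'.nat c₂ 0 = l →
      e.eval s' = F r l) :
    Runs (fillSum c₁ c₂ b N L e) s T
      (fun s' => Agree c₁ c₂ b s s' ∧ ∀ r < R, s'.real b r = ∑ l ∈ Finset.range M, F r l) := by
  -- The cell `b[r]` is its own accumulator, so the inner loop must also be shown to preserve the
  -- sums already stored in the other cells.
  have inner : ∀ r < R, ∀ s', Agree c₁ c₂ b s s' → s'.nat c₁ 0 = r → s'.real b r = 0 →
      Runs (forLoop c₂ L (.setReal b (.var c₁) (.add (.get b (.var c₁)) e))) s'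
        ((M + 1) * ((e.cost + 8) + L.cost + 9))
        (fun s'' => Agree c₁ c₂ b s s'' ∧ s''.nat c₁ 0 = r ∧
          s''.real b r = ∑ l ∈ Finset.range M, F r l ∧
          ∀ r', r' ≠ r → s''.real b r' = s'.real b r') := by
    intro r hr s' h1 h2 h3
    refine (runs_forLoop (c := c₂) (N := L) (K := M) (T := e.cost + 8) (by positivity)
      (I := fun i s'' => s''.nat c₂ 0 = i ∧ Agree c₁ c₂ b s s'' ∧ s''.nat c₁ 0 = r ∧
          s''.real b r = ∑ l ∈ Finset.range i, F r l ∧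
          ∀ r', r' ≠ r → s''.real b r' = s'.real b r')
      (fun i s h => h.1) (fun i s h => hL s h.2.1) (fun i hi s'' ⟨a1, a2, a3, a4, a5⟩ => ?_)
      (s := s') ⟨by simp, h1.writeNat (Or.inr rfl) _ _, ?_, by simpa using h3, by simp⟩).mono le_rfl
      fun s'' h => h.2
    · refine (runs_setReal s'' b (.var c₁) (.add (.get b (.var c₁)) e)).mono ?_ ?_
      · simp only [NExp.cost, RExp.cost]; push_cast; linarith
      · rintro _ rfl
        simp only [NExp.eval, RExp.eval, a3, a4, he r hr i hi s'' a2 a3 a1]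
        refine ⟨by simpa using a1, by simp, (a2.writeReal _ _).writeNat (Or.inr rfl) _ _, ?_, ?_,
          ?_⟩
        · rw [writeNat_nat_ne _ hc]; exact a3
        · simp [Finset.sum_range_succ]
        · intro r' hr'
          simp only [writeNat_real, writeReal_real_same]
          rw [Function.update_of_ne hr']
          exact a5 r' hr'
    · rw [writeNat_nat_ne _ hc]; exact h2
  have := runs_forLoop (c := c₁) (N := N) (body := .seq (.setReal b (.var c₁) (.ofNat (.lit 0)))
    (forLoop c₂ L (.setReal b (.var c₁) (.add (.get b (.var c₁)) e)))) (K := R)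
    (T := 5 + (M + 1) * ((e.cost + 8) + L.cost + 9)) (by positivity)
    (I := fun i s' => s'.nat c₁ 0 = i ∧ Agree c₁ c₂ b s s' ∧
      (∀ r < i, s'.real b r = ∑ l ∈ Finset.range M, F r l))
    (fun i s h => h.1) (fun i s h => hN s h.2.1) (fun i hi s' ⟨h1, h2, h3⟩ => by
      refine Runs.seq (Q := fun s'' => Agree c₁ c₂ b s s'' ∧ s''.nat c₁ 0 = i ∧
        s''.real b i = 0 ∧ ∀ r < i, s''.real b r = ∑ l ∈ Finset.range M, F r l)
        ((runs_setReal s' b (.var c₁) (.ofNat (.lit 0))).mono ?_ ?_) ?_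
      · simp only [NExp.cost, RExp.cost]; norm_num
      · rintro _ rfl
        simp only [NExp.eval, RExp.eval, h1]
        refine ⟨h2.writeReal _ _, h1, by simp, fun r hr => ?_⟩
        rw [writeReal_real_same, Function.update_of_ne (by omega)]
        exact h3 r hr
      · rintro s'' ⟨a1, a2, a3, a4⟩
        refine (inner i hi s'' a1 a2 a3).mono le_rfl ?_
        rintro s₃ ⟨b1, b2, b3, b4⟩
        refine ⟨b2, by simp, b1.writeNat (Or.inl rfl) _ _, fun r hr => ?_⟩
        simp only [writeNat_real]
        by_cases hri : r = i
        · rw [hri]; exact b3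
        · rw [b4 r hri]
          exact a4 r (by omega))
    (s := s) ⟨by simp, (Agree.refl _ _ _ _).writeNat (Or.inl rfl) _ _, by simp⟩
  refine this.mono (le_trans ?_ hT) fun s' h => h.2
  have h1 : (0 : ℝ) ≤ R := by positivity
  have h2 : (0 : ℝ) ≤ M := by positivity
  have h3 : (0 : ℝ) ≤ e.cost := by positivity
  have h4 : (0 : ℝ) ≤ N.cost := by positivity
  have h5 : (0 : ℝ) ≤ L.cost := by positivity
  rw [mul_assoc]
  gcongr
  nlinarith [mul_nonneg h2 h4]

/-- Tables of quotients and remainders modulo `D`, for all numbers up to `N`. -/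
def divTable (c hi lo : ℕ) (N D : NExp) : Prog :=
  .seq (.setNat hi (.lit 0) (.lit 0)) (.seq (.setNat lo (.lit 0) (.lit 0))
    (forLoop c N (.ite (.natLt (.add (.get lo (.var c)) (.lit 1)) D)
      (.seq (.setNat hi (.add (.var c) (.lit 1)) (.get hi (.var c)))
        (.setNat lo (.add (.var c) (.lit 1)) (.add (.get lo (.var c)) (.lit 1))))
      (.seq (.setNat hi (.add (.var c) (.lit 1)) (.add (.get hi (.var c)) (.lit 1)))
        (.setNat lo (.add (.var c) (.lit 1)) (.lit 0))))))

/-- Division of natural numbers is no machine operation, and matrix entries are addressed by one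
linear index; the tables recover row and column in constant time. Entry r + 1 is computed from entry
r, so R passes fill the indices 0, …, R. -/
theorem runs_divTable {c hi lo R m : ℕ} {N D : NExp} {s : Memory} (hm : 0 < m)
    (h1 : c ≠ hi) (h2 : c ≠ lo) (h3 : hi ≠ lo) {T : ℝ}
    (hT : ((R : ℝ) + 2) * (N.cost + D.cost + 60) ≤ T)
    (hN : ∀ s' : Memory, (∀ c', c' ≠ c → c' ≠ hi → c' ≠ lo → s'.nat c' = s.nat c') → N.eval s' = R)
    (hD : ∀ s' : Memory, (∀ c', c' ≠ c → c' ≠ hi → c' ≠ lo → s'.nat c' = s.nat c') →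
      D.eval s' = m) :
    Runs (divTable c hi lo N D) s T (fun s' =>
      (∀ c', c' ≠ c → c' ≠ hi → c' ≠ lo → s'.nat c' = s.nat c') ∧ s'.real = s.real ∧
      ∀ r ≤ R, s'.nat hi r = r / m ∧ s'.nat lo r = r % m) := by
  have hdm : ∀ r q : ℕ, ∀ l < m, r = q * m + l → r / m = q ∧ r % m = l := by
    rintro r q l hl rfl
    constructor
    · rw [mul_comm, Nat.mul_add_div hm, Nat.div_eq_of_lt hl, add_zero]
    · rw [mul_comm, Nat.mul_add_mod, Nat.mod_eq_of_lt hl]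
  have loop := fun s₀ h₀ => runs_forLoop (c := c) (N := N)
    (body := (.ite (.natLt (.add (.get lo (.var c)) (.lit 1)) D)
      (.seq (.setNat hi (.add (.var c) (.lit 1)) (.get hi (.var c)))
        (.setNat lo (.add (.var c) (.lit 1)) (.add (.get lo (.var c)) (.lit 1))))
      (.seq (.setNat hi (.add (.var c) (.lit 1)) (.add (.get hi (.var c)) (.lit 1)))
        (.setNat lo (.add (.var c) (.lit 1)) (.lit 0))))) (K := R)
    (T := D.cost + 30) (by positivity)
    (I := fun i s' => s'.nat c 0 = i ∧
      (∀ c', c' ≠ c → c' ≠ hi → c' ≠ lo → s'.nat c' = s.nat c') ∧ s'.real = s.real ∧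
      ∀ r ≤ i, s'.nat hi r = r / m ∧ s'.nat lo r = r % m)
    (fun i s h => h.1) (fun i s' h => hN s' h.2.1) (fun i hi' s' ⟨a1, a2, a3, a4⟩ => by
      have hdiv := Nat.div_add_mod' i m
      have hlt := Nat.mod_lt i hm
      by_cases hlo : i % m + 1 < m
      · have hstep := hdm (i + 1) (i / m) (i % m + 1) hlo (by omega)
        refine ⟨_, _, Exec.iteTrue ?_ ((Exec.setNat _ _ _ _).seq (Exec.setNat _ _ _ _)), ?_, ?_⟩
        · simpa [Test.Holds, NExp.eval, a1, (a4 i le_rfl).2, hD s' a2] using hlo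
        · simp only [Test.cost, NExp.cost]; push_cast; linarith
        · simp only [NExp.eval, writeNat_nat_ne _ h1, writeNat_nat_ne _ h2,
            writeNat_nat_ne _ h3.symm, a1, (a4 i le_rfl).1, (a4 i le_rfl).2]
          refine ⟨trivial, by simp, fun c' b1 b2 b3 => ?_, a3, fun r hr => ?_⟩
          · rw [writeNat_nat_ne _ b1, writeNat_nat_ne _ b3, writeNat_nat_ne _ b2, a2 c' b1 b2 b3]
          · rw [writeNat_nat_ne _ h1.symm, writeNat_nat_ne _ h2.symm, writeNat_nat_ne _ h3,
              writeNat_nat_same, writeNat_nat_same, writeNat_nat_ne _ h3.symm]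
            rcases Nat.le_succ_iff.1 hr with hr | rfl
            · rw [Function.update_of_ne (by omega), Function.update_of_ne (by omega)]
              exact a4 r hr
            · simp [hstep.1, hstep.2]
      · have hstep := hdm (i + 1) (i / m + 1) 0 hm (by rw [add_mul]; omega)
        refine ⟨_, _, Exec.iteFalse ?_ ((Exec.setNat _ _ _ _).seq (Exec.setNat _ _ _ _)), ?_, ?_⟩
        · simpa [Test.Holds, NExp.eval, a1, (a4 i le_rfl).2, hD s' a2] using hlo
        · simp only [Test.cost, NExp.cost]; push_cast; linarith
        · simp only [NExp.eval, writeNat_nat_ne _ h1, writeNat_nat_ne _ h2, a1, (a4 i le_rfl).1]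
          refine ⟨trivial, by simp, fun c' b1 b2 b3 => ?_, a3, fun r hr => ?_⟩
          · rw [writeNat_nat_ne _ b1, writeNat_nat_ne _ b3, writeNat_nat_ne _ b2, a2 c' b1 b2 b3]
          · rw [writeNat_nat_ne _ h1.symm, writeNat_nat_ne _ h2.symm, writeNat_nat_ne _ h3,
              writeNat_nat_same, writeNat_nat_same, writeNat_nat_ne _ h3.symm]
            rcases Nat.le_succ_iff.1 hr with hr | rfl
            · rw [Function.update_of_ne (by omega), Function.update_of_ne (by omega)]
              exact a4 r hr
            · simp [hstep.1, hstep.2])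
    (s := s₀) h₀
  unfold divTable
  refine ((runs_setNat s hi (.lit 0) (.lit 0)).seq fun s₁ hs₁ =>
    (runs_setNat s₁ lo (.lit 0) (.lit 0)).seq fun s₂ hs₂ => loop s₂ ?_).mono (le_trans ?_ hT)
    fun s' h => h.2
  · subst hs₁
    subst hs₂
    simp only [NExp.eval]
    refine ⟨by simp, fun c' b1 b2 b3 => ?_, rfl, fun r hr => ?_⟩
    · rw [writeNat_nat_ne _ b1, writeNat_nat_ne _ b3, writeNat_nat_ne _ b2]
    · obtain rfl : r = 0 := by omega
      rw [writeNat_nat_ne _ h1.symm, writeNat_nat_ne _ h2.symm, writeNat_nat_ne _ h3,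
              writeNat_nat_same, writeNat_nat_same]
      simp
  · simp only [NExp.cost]
    push_cast
    nlinarith [Nat.cast_nonneg (α := ℝ) R, Nat.cast_nonneg (α := ℝ) N.cost,
      Nat.cast_nonneg (α := ℝ) D.cost]

end Machine

/-! ### Numbering of the unknowns and memory layout. -/

section Layout

/-- The order of the Newton system. -/
abbrev kktSize (n d : ℕ) : ℕ := d * d + (n + (n + (1 + 1)))

/-- The numbering of the unknowns of the Newton system. -/
def kktEquiv (n d : ℕ) : KktIndex n d ≃ Fin (kktSize n d) :=
  (Equiv.sumCongr finProdFinEquiv ((Equiv.sumCongr (Equiv.refl _) ((Equiv.sumCongr (Equiv.refl _)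
    ((Equiv.sumCongr finOneEquiv.symm finOneEquiv.symm).trans finSumFinEquiv)).trans
      finSumFinEquiv)).trans finSumFinEquiv)).trans finSumFinEquiv

variable {n d : ℕ}

theorem kktEquiv_matrix (a b : Fin d) : (kktEquiv n d (.inl (a, b)) : ℕ) = a * d + b := by
  simp [kktEquiv]; ring
theorem kktEquiv_vector (i : Fin n) : (kktEquiv n d (.inr (.inl i)) : ℕ) = d * d + i := by
  simp [kktEquiv]
theorem kktEquiv_cone (i : Fin n) : (kktEquiv n d (.inr (.inr (.inl i))) : ℕ) = d * d + (n + i) := by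
  simp [kktEquiv]
theorem kktEquiv_trace (u : Unit) :
    (kktEquiv n d (.inr (.inr (.inr (.inl u)))) : ℕ) = d * d + (n + n) := by
  simp [kktEquiv]
  rfl
theorem kktEquiv_scale (u : Unit) :
    (kktEquiv n d (.inr (.inr (.inr (.inr u)))) : ℕ) = d * d + (n + (n + 1)) := by
  simp [kktEquiv]
  rfl

theorem mul_add_div_mod {m : ℕ} (i : ℕ) (j : Fin m) : (i * m + j) / m = i ∧ (i * m + j) % m = j := by
  have hm : 0 < m := j.pos
  constructor
  · rw [mul_comm, Nat.mul_add_div hm, Nat.div_eq_of_lt j.2, add_zero]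
  · rw [mul_comm, Nat.mul_add_mod, Nat.mod_eq_of_lt j.2]

theorem mul_add_lt {l m : ℕ} (i : Fin l) (j : Fin m) : (i : ℕ) * m + j < l * m :=
  calc (i : ℕ) * m + j < i * m + m := by omega
    _ = (i + 1) * m := by ring
    _ ≤ l * m := Nat.mul_le_mul_right _ i.2

theorem exists_mul_add {l m r : ℕ} (hr : r < l * m) :
    ∃ (i : Fin l) (j : Fin m), r = i * m + j := by
  have hm : 0 < m := Nat.pos_of_ne_zero (by rintro rfl; simp at hr)
  exact ⟨⟨r / m, Nat.div_lt_of_lt_mul (by rwa [mul_comm])⟩, ⟨r % m, Nat.mod_lt _ hm⟩,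
    (Nat.div_add_mod' r m).symm⟩

/-- The scalars and the tables of quotients and remainders are in place; the names of the arrays
of the program are the numbers from `B` on. -/
structure Tables (B n d : ℕ) (s : Memory) : Prop where
  points : s.nat B 0 = n
  dim : s.nat (B + 1) 0 = d
  size : s.nat (B + 3) 0 = kktSize n d
  hi : ∀ r < (n + d) * d, s.nat (B + 4) r = r / d
  lo : ∀ r < (n + d) * d, s.nat (B + 5) r = r % d
  hiM : ∀ r < kktSize n d * kktSize n d, s.nat (B + 6) r = r / kktSize n d
  loM : ∀ r < kktSize n d * kktSize n d, s.nat (B + 7) r = r % kktSize n d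

theorem Tables.congr {B : ℕ} {s s' : Memory} (h : Tables B n d s)
    (hs : ∀ c, B ≤ c → c < B + 8 → s'.nat c = s.nat c) : Tables B n d s' := by
  refine ⟨?_, ?_, ?_, ?_, ?_, ?_, ?_⟩
  · rw [hs _ (by omega) (by omega)]; exact h.points
  · rw [hs _ (by omega) (by omega)]; exact h.dim
  · rw [hs _ (by omega) (by omega)]; exact h.size
  · rw [hs _ (by omega) (by omega)]; exact h.hi
  · rw [hs _ (by omega) (by omega)]; exact h.lo
  · rw [hs _ (by omega) (by omega)]; exact h.hiM
  · rw [hs _ (by omega) (by omega)]; exact h.loM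

/-- The intended contents of the real array with name `B + j`. -/
def Content (P : Fin n → EuclideanSpace ℝ (Fin d)) (t : ℝ) (z : Point n d) (j : ℕ)
    (x : ℕ → ℝ) : Prop :=
  match j with
  | 0 => ∀ (i : Fin n) (a : Fin d), x (i * d + a) = P i a
  | 1 => ∀ a b : Fin d, x (a * d + b) = z.X a b
  | 2 => ∀ i : Fin n, x i = z.y i
  | 3 => x 0 = t
  | 4 => ∀ (i : Fin n) (a : Fin d), x (i * d + a) = applyTo z.X (P i) a
  | 5 => ∀ i : Fin n, x i = ‖applyTo z.X (P i)‖ ^ 2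
  | 6 => ∀ i : Fin n, x i = residual P z i
  | 7 => ∀ a b : Fin d, x (a * d + b) = z.X⁻¹ a b
  | 8 => ∀ a b : Fin d, x (a * d + b) = (1 - z.X)⁻¹ a b
  | 9 => ∀ a b : Fin d, x (a * d + b) = ∑ i, 2 / residual P z i * (P i a * P i b)
  | 10 => ∀ a b : Fin d, x (a * d + b) = (1 : Matrix (Fin d) (Fin d) ℝ) a b
  | _ => True

/-- The tables and the real arrays with names `B + j`, `j ∈ J`, have the intended contents. -/
structure Holds (B : ℕ) (P : Fin n → EuclideanSpace ℝ (Fin d)) (t : ℝ) (z : Point n d)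
    (J : Finset ℕ) (s : Memory) : Prop where
  tables : Tables B n d s
  content : ∀ j ∈ J, Content P t z j (s.real (B + j))

variable {P : Fin n → EuclideanSpace ℝ (Fin d)} {t : ℝ} {z : Point n d} {B : ℕ} {J : Finset ℕ}
  {s s' : Memory}

/-- The bookkeeping rule of every subroutine: overwriting one array with its intended contents adds
its index to the set of valid arrays and leaves the others valid. -/
theorem Holds.insert_agree {j : ℕ} (h : Holds B P t z J s)
    (ha : Agree (B + 8) (B + 9) (B + j) s s') (hj : Content P t z j (s'.real (B + j))) :
    Holds B P t z (insert j J) s' := by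
  refine ⟨h.tables.congr fun c _ _ => ha.nat c (by omega) (by omega), fun i hi => ?_⟩
  by_cases hij : i = j
  · rw [hij]; exact hj
  · rw [ha.real _ (by omega)]
    exact h.content i (Finset.mem_of_mem_insert_of_ne hi hij)

theorem Holds.congr (h : Holds B P t z J s) (hn : ∀ c, B ≤ c → c < B + 8 → s'.nat c = s.nat c)
    (hr : ∀ b, B ≤ b → s'.real b = s.real b) : Holds B P t z J s' :=
  ⟨h.tables.congr hn, fun i hi => by rw [hr _ (by omega)]; exact h.content i hi⟩

theorem Holds.mono {J' : Finset ℕ} (h : Holds B P t z J s) (hJ : J' ⊆ J) : Holds B P t z J' s :=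
  ⟨h.tables, fun i hi => h.content i (hJ hi)⟩

/-- The number of executions of the body of a loop in the program is at most this. -/
def loopBound (n d : ℕ) : ℝ := 17 * ((n : ℝ) + (d : ℝ) ^ 2) ^ 2

theorem loopBound_size (hn : 1 ≤ n) (hd : 2 ≤ d) :
    ((kktSize n d * kktSize n d : ℕ) : ℝ) + 2 ≤ loopBound n d := by
  have hn' : (1 : ℝ) ≤ n := by exact_mod_cast hn
  have hd' : (2 : ℝ) ≤ d := by exact_mod_cast hd
  unfold loopBound
  have h1 : (kktSize n d : ℝ) ≤ 3 * ((n : ℝ) + (d : ℝ) ^ 2) := by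
    simp only [kktSize]
    push_cast
    nlinarith
  have h2 : (5 : ℝ) ≤ (n : ℝ) + (d : ℝ) ^ 2 := by nlinarith
  have h0 : (0 : ℝ) ≤ kktSize n d := by positivity
  push_cast at *
  nlinarith

theorem le_loopBound (hn : 1 ≤ n) (hd : 2 ≤ d) {R : ℕ} (hR : R ≤ kktSize n d * kktSize n d) :
    (R : ℝ) + 2 ≤ loopBound n d := by
  have := loopBound_size hn hd
  have h2 : (R : ℝ) ≤ ((kktSize n d * kktSize n d : ℕ) : ℝ) := by exact_mod_cast hR
  linarith

theorem mul_le_loopBound (hn : 1 ≤ n) (hd : 2 ≤ d) {R M : ℕ}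
    (h : (R + 1) * (M + 1) ≤ kktSize n d * kktSize n d) :
    ((R : ℝ) + 1) * (M + 1) ≤ loopBound n d := by
  have := loopBound_size hn hd
  have h2 : (((R + 1) * (M + 1) : ℕ) : ℝ) ≤ ((kktSize n d * kktSize n d : ℕ) : ℝ) := by
    exact_mod_cast h
  push_cast at h2 this
  linarith

theorem cost_le {x y k c : ℝ} (hxy : x ≤ y) (hx : 0 ≤ x) (hc : 0 ≤ c) (hk : k ≤ c) :
    x * k ≤ c * y := by
  rw [mul_comm c]
  exact (mul_le_mul_of_nonneg_left hk hx).trans (mul_le_mul_of_nonneg_right hxy hc)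

end Layout

/-! ### Programs for the images, norms, residuals and the weighted Gram matrix. -/

section Programs

/-- The first counter of a double loop. -/
abbrev cnt₁ (B : ℕ) : NExp := .var (B + 8)
/-- The second counter of a double loop. -/
abbrev cnt₂ (B : ℕ) : NExp := .var (B + 9)

/-- `w_i := X p_i`. -/
def imageProg (B : ℕ) : Prog :=
  fillSum (B + 8) (B + 9) (B + 4) (.mul (.var B) (.var (B + 1))) (.var (B + 1))
    (.mul (.get (B + 1) (.add (.mul (.get (B + 5) (cnt₁ B)) (.var (B + 1))) (cnt₂ B)))
      (.get B (.add (.mul (.get (B + 4) (cnt₁ B)) (.var (B + 1))) (cnt₂ B))))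

/-- The squared norms of the `w_i`. -/
def normProg (B : ℕ) : Prog :=
  fillSum (B + 8) (B + 9) (B + 5) (.var B) (.var (B + 1))
    (.mul (.get (B + 4) (.add (.mul (cnt₁ B) (.var (B + 1))) (cnt₂ B)))
      (.get (B + 4) (.add (.mul (cnt₁ B) (.var (B + 1))) (cnt₂ B))))

/-- `q_i := y_i² - ‖w_i‖²`. -/
def residualProg (B : ℕ) : Prog :=
  fill (B + 8) (B + 6) (.var B)
    (.ret (.sub (.mul (.get (B + 2) (cnt₁ B)) (.get (B + 2) (cnt₁ B))) (.get (B + 5) (cnt₁ B))))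

/-- `C := ∑ (2 / q_i) p_i p_iᵀ`. -/
def gramProg (B : ℕ) : Prog :=
  fillSum (B + 8) (B + 9) (B + 9) (.mul (.var (B + 1)) (.var (B + 1))) (.var B)
    (.mul (.div (.ofNat (.lit 2)) (.get (B + 6) (cnt₂ B)))
      (.mul (.get B (.add (.mul (cnt₂ B) (.var (B + 1))) (.get (B + 4) (cnt₁ B))))
        (.get B (.add (.mul (cnt₂ B) (.var (B + 1))) (.get (B + 5) (cnt₁ B))))))

variable {n d : ℕ} {P : Fin n → EuclideanSpace ℝ (Fin d)} {t : ℝ} {z : Point n d} {B : ℕ}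
  {J : Finset ℕ} {s : Memory}

theorem runs_imageProg (hn : 1 ≤ n) (hd : 2 ≤ d) (h : Holds B P t z J s) (h0 : 0 ∈ J)
    (h1 : 1 ∈ J) : Runs (imageProg B) s (1000 * loopBound n d) (Holds B P t z (insert 4 J)) := by
  have hT := h.tables
  have hle : n * d ≤ (n + d) * d := Nat.mul_le_mul_right _ (by omega)
  refine (runs_fillSum (R := n * d) (M := d) (fun r l =>
    s.real (B + 1) (r % d * d + l) * s.real B (r / d * d + l)) (by simp) (T := 1000 * loopBound n d)
    ?_ ?_ ?_ ?_).mono le_rfl ?_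
  · have := mul_le_loopBound hn hd (R := n * d) (M := d) (by
      have : n * d * 1 ≤ n * d * d := Nat.mul_le_mul_left _ (by omega)
      simp only [kktSize]; nlinarith)
    refine cost_le this (by positivity) (by norm_num) ?_
    norm_num [RExp.cost, NExp.cost]
  · intro s' ha
    simp [NExp.eval, ha.nat, hT.points, hT.dim]
  · intro s' ha
    simp [NExp.eval, ha.nat, hT.dim]
  · intro r hr l hl s' ha e1 e2
    simp [RExp.eval, NExp.eval, ha.nat, ha.real, hT.dim, e1, e2, hT.hi r (by omega),
      hT.lo r (by omega)]
  · rintro s' ⟨ha, hF⟩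
    refine h.insert_agree ha fun i a => ?_
    rw [hF _ (mul_add_lt i a), applyTo_apply, Finset.sum_range]
    simp only [(mul_add_div_mod (i : ℕ) a).1, (mul_add_div_mod (i : ℕ) a).2]
    refine Finset.sum_congr rfl fun l _ => ?_
    have e1 := h.content 0 h0 i l
    have e2 := h.content 1 h1 a l
    rw [e2]
    congr 1

theorem runs_normProg (hn : 1 ≤ n) (hd : 2 ≤ d) (h : Holds B P t z J s) (h4 : 4 ∈ J) :
    Runs (normProg B) s (1000 * loopBound n d) (Holds B P t z (insert 5 J)) := by
  have hT := h.tables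
  refine (runs_fillSum (R := n) (M := d) (fun r l =>
    s.real (B + 4) (r * d + l) * s.real (B + 4) (r * d + l)) (by simp) (T := 1000 * loopBound n d)
    ?_ ?_ ?_ ?_).mono le_rfl ?_
  · have := mul_le_loopBound hn hd (R := n) (M := d) (by simp only [kktSize]; nlinarith)
    refine cost_le this (by positivity) (by norm_num) ?_
    norm_num [RExp.cost, NExp.cost]
  · intro s' ha
    simp [NExp.eval, ha.nat, hT.points]
  · intro s' ha
    simp [NExp.eval, ha.nat, hT.dim]
  · intro r hr l hl s' ha e1 e2
    simp [RExp.eval, NExp.eval, ha.nat, ha.real, hT.dim, e1, e2]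
  · rintro s' ⟨ha, hF⟩
    refine h.insert_agree ha fun i => ?_
    rw [hF _ i.2, Finset.sum_range, EuclideanSpace.real_norm_sq_eq]
    refine Finset.sum_congr rfl fun l _ => ?_
    have e1 := h.content 4 h4 i l
    rw [e1, sq]

theorem runs_residualProg (hn : 1 ≤ n) (hd : 2 ≤ d) (h : Holds B P t z J s) (h2 : 2 ∈ J)
    (h5 : 5 ∈ J) :
    Runs (residualProg B) s (1000 * loopBound n d) (Holds B P t z (insert 6 J)) := by
  have hT := h.tables
  refine (runs_fill (R := n) (c₂ := B + 9) (fun r =>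
    s.real (B + 2) r * s.real (B + 2) r - s.real (B + 5) r) (T := 1000 * loopBound n d)
    ?_ ?_ ?_).mono le_rfl ?_
  · have := le_loopBound hn hd (R := n) (by simp only [kktSize]; nlinarith)
    refine cost_le (x := (n : ℝ) + 1) (by linarith) (by positivity) (by norm_num) ?_
    norm_num [CExp.cost, RExp.cost, NExp.cost]
  · intro s' ha
    simp [NExp.eval, ha.nat, hT.points]
  · intro r hr s' ha e1 e2
    simp [CExp.eval, RExp.eval, NExp.eval, ha.real, e1]
  · rintro s' ⟨ha, hF⟩
    refine h.insert_agree ha fun i => ?_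
    rw [hF _ i.2, h.content 2 h2 i, h.content 5 h5 i, residual, sq (z.y i)]

theorem runs_gramProg (hn : 1 ≤ n) (hd : 2 ≤ d) (h : Holds B P t z J s) (h0 : 0 ∈ J)
    (h6 : 6 ∈ J) :
    Runs (gramProg B) s (1000 * loopBound n d) (Holds B P t z (insert 9 J)) := by
  have hT := h.tables
  have hle : d * d ≤ (n + d) * d := Nat.mul_le_mul_right _ (by omega)
  refine (runs_fillSum (R := d * d) (M := n) (fun r l =>
    2 / s.real (B + 6) l * (s.real B (l * d + r / d) * s.real B (l * d + r % d))) (by simp)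
    (T := 1000 * loopBound n d) ?_ ?_ ?_ ?_).mono le_rfl ?_
  · have := mul_le_loopBound hn hd (R := d * d) (M := n) (by simp only [kktSize]; nlinarith)
    refine cost_le this (by positivity) (by norm_num) ?_
    norm_num [RExp.cost, NExp.cost]
  · intro s' ha
    simp [NExp.eval, ha.nat, hT.dim]
  · intro s' ha
    simp [NExp.eval, ha.nat, hT.points]
  · intro r hr l hl s' ha e1 e2
    simp [RExp.eval, NExp.eval, ha.nat, ha.real, hT.dim, e1, e2, hT.hi r (by omega),
      hT.lo r (by omega)]
  · rintro s' ⟨ha, hF⟩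
    refine h.insert_agree ha fun a b => ?_
    rw [hF _ (mul_add_lt a b), Finset.sum_range]
    simp only [(mul_add_div_mod (a : ℕ) b).1, (mul_add_div_mod (a : ℕ) b).2]
    refine Finset.sum_congr rfl fun l _ => ?_
    have e1 := h.content 0 h0 l a
    have e2 := h.content 0 h0 l b
    have e3 := h.content 6 h6 l
    rw [e3]
    simp only [add_zero] at e1 e2
    rw [e1, e2]

end Programs

/-! ### Calling the inversion program and assembling the Newton system. -/

section NewtonSystem

/-- The program inverts `m × m` matrices in time `C m^ω`. -/
def Inverts (inv : Prog) (C ω : ℝ) : Prop :=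
  ∀ (m : ℕ), 1 ≤ m → ∀ A : Matrix (Fin m) (Fin m) ℝ, IsUnit A.det →
    ∀ s : Memory, s.nat 0 0 = m → (∀ i j : Fin m, s.real 0 (i * m + j) = A i j) →
      ∃ (s' : Memory) (τ : ℕ), Exec inv s s' τ ∧ (τ : ℝ) ≤ C * (m : ℝ) ^ ω ∧
        ∀ i j : Fin m, s'.real 1 (i * m + j) = A⁻¹ i j

variable {n d : ℕ} {P : Fin n → EuclideanSpace ℝ (Fin d)} {t : ℝ} {z : Point n d} {B : ℕ}
  {J : Finset ℕ} {s : Memory} {inv : Prog} {C ω : ℝ}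

theorem Holds.agree_low {s' : Memory} {b : ℕ} (h : Holds B P t z J s) (hb : b < B)
    (ha : Agree (B + 8) (B + 9) b s s') : Holds B P t z J s' :=
  h.congr (fun c _ _ => ha.nat c (by omega) (by omega)) fun _ _ => ha.real _ (by omega)

/-- All working data sits in arrays named at least `B`, beyond the reach of `inv`, so it survives
the call; only the result in real array 1 is learned about the lower arrays. -/
theorem runs_inverse (hinv : Inverts inv C ω) (hB : inv.bound ≤ B) (hB3 : 3 ≤ B)
    (h : Holds B P t z J s) {m : ℕ} (hm : 1 ≤ m) {N : NExp} (hN : N.eval s = m)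
    {A : Matrix (Fin m) (Fin m) ℝ} (hA : IsUnit A.det)
    (hs : ∀ i j : Fin m, s.real 0 (i * m + j) = A i j) :
    Runs (.seq (.setNat 0 (.lit 0) N) inv) s ((N.cost + 2) + C * (m : ℝ) ^ ω)
      (fun s' => Holds B P t z J s' ∧ ∀ i j : Fin m, s'.real 1 (i * m + j) = A⁻¹ i j) := by
  refine ((runs_setNat s 0 (.lit 0) N).mono (T' := N.cost + 2) ?_ fun _ h => h).seq fun s₁ hs₁ => ?_
  · simp only [NExp.cost]; push_cast; linarith
  · subst hs₁
    simp only [NExp.eval, hN]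
    obtain ⟨s', τ, h1, h2, h3⟩ := hinv m hm A hA (s.writeNat 0 0 m) (by simp) hs
    refine ⟨s', τ, h1, h2, h.congr (fun c hc _ => ?_) (fun b hb => ?_), h3⟩
    · rw [(h1.frame c (by omega)).1, writeNat_nat_ne _ (by omega)]
    · rw [(h1.frame b (by omega)).2]; rfl

/-- Store the inverse of the `d × d` matrix with entries `src` in the array `B + j`. -/
def inverseProg (inv : Prog) (B j : ℕ) (src : RExp) : Prog :=
  .seq (fill (B + 8) 0 (.mul (.var (B + 1)) (.var (B + 1))) (.ret src))
    (.seq (.seq (.setNat 0 (.lit 0) (.var (B + 1))) inv)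
      (fill (B + 8) (B + j) (.mul (.var (B + 1)) (.var (B + 1))) (.ret (.get 1 (cnt₁ B)))))

theorem runs_inverseProg (hinv : Inverts inv C ω) (hB : inv.bound ≤ B) (hB3 : 3 ≤ B)
    (hn : 1 ≤ n) (hd : 2 ≤ d) (h : Holds B P t z J s) {j : ℕ} {src : RExp}
    (hsrc : src.cost ≤ 100) {A : Matrix (Fin d) (Fin d) ℝ} (hA : IsUnit A.det)
    (hs : ∀ a b : Fin d, ∀ s', Holds B P t z J s' → s'.nat (B + 8) 0 = a * d + b →
      src.eval s' = A a b)
    (hj : ∀ x : ℕ → ℝ, (∀ a b : Fin d, x (a * d + b) = A⁻¹ a b) → Content P t z j x) :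
    Runs (inverseProg inv B j src) s (2010 * loopBound n d + C * (d : ℝ) ^ ω)
      (Holds B P t z (insert j J)) := by
  have hT := h.tables
  have hb := le_loopBound hn hd (R := d * d) (by simp only [kktSize]; nlinarith)
  have hb2 : (2 : ℝ) ≤ loopBound n d := by
    have : (0 : ℝ) ≤ (d * d : ℕ) := by positivity
    linarith
  -- The filled value is specified as a function of the linear index; the branch with value 0 lies
  -- outside the filled range.
  refine (((runs_fill (R := d * d) (c₂ := B + 9) (fun r => if h : r < d * d then
      A ⟨r / d, Nat.div_lt_of_lt_mul h⟩ ⟨r % d, Nat.mod_lt _ (by omega)⟩ else 0)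
      (T := 1000 * loopBound n d) ?_ ?_ ?_).mono le_rfl
      (Q' := fun s' => Holds B P t z J s' ∧ ∀ a b : Fin d, s'.real 0 (a * d + b) = A a b) ?_).seq
    (T' := (((NExp.var (B + 1)).cost + 2) + C * (d : ℝ) ^ ω) + 1000 * loopBound n d)
    fun s₁ hs₁ => (runs_inverse hinv hB hB3 hs₁.1 (by omega) ?_ hA hs₁.2).seq
      (T' := 1000 * loopBound n d) fun s₂ hs₂ =>
      (runs_fill (R := d * d) (c₂ := B + 9) (fun r => s₂.real 1 r) ?_ ?_ ?_).mono le_rfl ?_).mono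
      ?_ fun _ h => h
  · refine cost_le (x := ((d * d : ℕ) : ℝ) + 1) (by linarith) (by positivity) (by norm_num) ?_
    have : (src.cost : ℝ) ≤ 100 := by exact_mod_cast hsrc
    simp only [CExp.cost, NExp.cost]
    push_cast
    linarith
  · intro s' ha
    simp [NExp.eval, ha.nat, hT.dim]
  · intro r hr s' ha e1 e2
    obtain ⟨a, b, rfl⟩ := exists_mul_add hr
    rw [dif_pos hr]
    simp only [(mul_add_div_mod (a : ℕ) b).1, (mul_add_div_mod (a : ℕ) b).2]
    exact hs a b s' (h.agree_low (by omega) ha) e1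
  · rintro s' ⟨ha, hF⟩
    refine ⟨h.agree_low (by omega) ha, fun a b => ?_⟩
    rw [hF _ (mul_add_lt a b), dif_pos (mul_add_lt a b)]
    simp only [(mul_add_div_mod (a : ℕ) b).1, (mul_add_div_mod (a : ℕ) b).2]
  · simp [NExp.eval, hs₁.1.tables.dim]
  · refine cost_le (x := ((d * d : ℕ) : ℝ) + 1) (by linarith) (by positivity) (by norm_num) ?_
    norm_num [CExp.cost, RExp.cost, NExp.cost]
  · intro s' ha
    simp [NExp.eval, ha.nat, hs₂.1.tables.dim]
  · intro r hr s' ha e1 e2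
    rw [CExp.eval, RExp.eval, ha.real _ (by omega)]
    simp [NExp.eval, e1]
  · rintro s' ⟨ha, hF⟩
    refine hs₂.1.insert_agree ha (hj _ fun a b => ?_)
    rw [hF _ (mul_add_lt a b), hs₂.2]
  · norm_num [NExp.cost]
    linarith

/-- Case distinction on equality. -/
def CExp.ifEq (u v : NExp) (p q : CExp) : CExp := .cond u v q (.cond v u q p)

theorem CExp.eval_ifEq (s : Memory) (u v : NExp) (p q : CExp) :
    (CExp.ifEq u v p q).eval s = if u.eval s = v.eval s then p.eval s else q.eval s := by
  simp only [CExp.ifEq, CExp.eval]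
  split_ifs <;> first | rfl | omega

/-- The entry of the Newton system at the position given by the counter. -/
def kktEntry (B : ℕ) : CExp :=
  let row : NExp := .get (B + 6) (cnt₁ B)
  let col : NExp := .get (B + 7) (cnt₁ B)
  let dim : NExp := .var (B + 1)
  let endX : NExp := .mul dim dim
  let endY : NExp := .add endX (.var B)
  let endCone : NExp := .add endX (.add (.var B) (.var B))
  let endTrace : NExp := .add endX (.add (.var B) (.add (.var B) (.lit 1)))
  let hi (u : NExp) : NExp := .get (B + 4) u
  let lo (u : NExp) : NExp := .get (B + 5) u
  let entry (b : ℕ) (u v : NExp) : RExp := .get b (.add (.mul u dim) v)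
  let vec (u : NExp) : NExp := .sub u endX
  let cone (u : NExp) : NExp := .sub (.sub u endX) (.var B)
  let zero : CExp := .ret (.ofNat (.lit 0))
  let two : RExp := .ofNat (.lit 2)
  let neg (u : RExp) : CExp := .ret (.sub (.ofNat (.lit 0)) u)
  let coupling (i r : NExp) : CExp :=
    neg (.div (.add (.mul (entry (B + 4) i (hi r)) (entry B i (lo r)))
      (.mul (entry B i (hi r)) (entry (B + 4) i (lo r)))) two)
  let linear (r : NExp) : CExp := .ret (.sub (.get (B + 8) r) (.get (B + 7) r))
  let scale : CExp := .ret (.get (B + 3) (.lit 0))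
  let half (i : NExp) : CExp := neg (.div (.get (B + 6) i) two)
  let kron (b : ℕ) : RExp := .mul (entry b (hi row) (hi col)) (entry b (lo row) (lo col))
  .cond row endX
    (.cond col endX
      (.ret (.add (.add (kron (B + 7)) (kron (B + 8)))
        (.div (.add (.mul (entry (B + 10) (hi row) (hi col)) (entry (B + 9) (lo row) (lo col)))
          (.mul (entry (B + 10) (lo row) (lo col)) (entry (B + 9) (hi row) (hi col)))) two)))
      (.cond col endY zero (.cond col endCone (coupling (cone col) row)
        (.cond col endTrace (.ret (.get (B + 10) row)) (linear row)))))
  (.cond row endY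
    (.cond col endX zero
      (.cond col endY (.ifEq (vec row) (vec col) (neg (.div two (.get (B + 6) (vec row)))) zero)
      (.cond col endCone (.ifEq (vec row) (cone col) (.ret (.get (B + 2) (vec row))) zero)
        (.cond col endTrace zero scale))))
  (.cond row endCone
    (.cond col endX (coupling (cone row) col)
      (.cond col endY (.ifEq (cone row) (vec col) (.ret (.get (B + 2) (cone row))) zero)
      (.cond col endCone (.ifEq (cone row) (cone col)
        (neg (.div (.mul (.get (B + 6) (cone row)) (.get (B + 6) (cone row))) (.ofNat (.lit 4))))
          zero)
        (.cond col endTrace zero (half (cone row))))))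
  (.cond row endTrace
    (.cond col endX (.ret (.get (B + 10) col)) zero)
    (.cond col endX (linear col) (.cond col endY scale (.cond col endCone (half (cone col))
      (.cond col endTrace zero (neg (.add (.ofNat (.var B)) (.ofNat (.lit 1)))))))))))

/-- Comparing row and column with the ends of the five blocks selects one of 25 cases, in each of
which the table lookups give the entry directly. -/
theorem eval_kktEntry {ρ : ℕ} (h : Holds B P t z {0, 1, 2, 3, 4, 5, 6, 7, 8, 9, 10} s)
    (hρ : s.nat (B + 8) 0 = ρ) {r c : KktIndex n d} (hr : s.nat (B + 6) ρ = kktEquiv n d r)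
    (hc : s.nat (B + 7) ρ = kktEquiv n d c) : (kktEntry B).eval s = kkt P t z r c := by
  have hn := h.tables.points
  have hdim := h.tables.dim
  have hhi : ∀ a b : Fin d, s.nat (B + 4) (a * d + b) = a := fun a b => by
    rw [h.tables.hi _ ((mul_add_lt a b).trans_le (Nat.mul_le_mul_right _ (by omega))),
      (mul_add_div_mod (a : ℕ) b).1]
  have hlo : ∀ a b : Fin d, s.nat (B + 5) (a * d + b) = b := fun a b => by
    rw [h.tables.lo _ ((mul_add_lt a b).trans_le (Nat.mul_le_mul_right _ (by omega))),
      (mul_add_div_mod (a : ℕ) b).2]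
  have c0 : ∀ (i : Fin n) (a : Fin d), s.real B (i * d + a) = P i a := h.content 0 (by simp)
  have c2 : ∀ i : Fin n, s.real (B + 2) i = z.y i := h.content 2 (by simp)
  have c3 : s.real (B + 3) 0 = t := h.content 3 (by simp)
  have c4 : ∀ (i : Fin n) (a : Fin d), s.real (B + 4) (i * d + a) = applyTo z.X (P i) a :=
    h.content 4 (by simp)
  have c6 : ∀ i : Fin n, s.real (B + 6) i = residual P z i := h.content 6 (by simp)
  have c7 : ∀ a b : Fin d, s.real (B + 7) (a * d + b) = z.X⁻¹ a b := h.content 7 (by simp)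
  have c8 : ∀ a b : Fin d, s.real (B + 8) (a * d + b) = (1 - z.X)⁻¹ a b := h.content 8 (by simp)
  have c9 : ∀ a b : Fin d, s.real (B + 9) (a * d + b) =
    ∑ i, 2 / residual P z i * (P i a * P i b) := h.content 9 (by simp)
  have c10 : ∀ a b : Fin d, s.real (B + 10) (a * d + b) = (1 : Matrix (Fin d) (Fin d) ℝ) a b :=
    h.content 10 (by simp)
  have hlt : ∀ a b : Fin d, (a : ℕ) * d + b < d * d := mul_add_lt
  simp only [kktEntry, CExp.eval, CExp.eval_ifEq, RExp.eval, NExp.eval, hρ, hr, hc, hn, hdim]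
  rcases r with ⟨a, b⟩ | i | i | u | u <;> rcases c with ⟨a', b'⟩ | j | j | u' | u' <;>
    simp [kktEquiv_matrix, kktEquiv_vector, kktEquiv_cone, kktEquiv_trace, kktEquiv_scale, hlt,
      kkt, kktOf, hhi, hlo, c0, c2, c3, c4, c6, c7, c8, c9, c10, Fin.ext_iff, Matrix.one_apply, sq]

end NewtonSystem

/-! ### The Newton iteration on the machine. -/

section NewtonIteration

variable {n d k : ℕ} {P : Fin n → EuclideanSpace ℝ (Fin d)} {t : ℝ} {z : Point n d} {B : ℕ}
  {J : Finset ℕ} {s : Memory} {inv : Prog} {C ω : ℝ}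

/-- Set up and invert the Newton system. -/
def systemProg (inv : Prog) (B : ℕ) : Prog :=
  .seq (fill (B + 8) 0 (.mul (.var (B + 3)) (.var (B + 3))) (kktEntry B))
    (.seq (.setNat 0 (.lit 0) (.var (B + 3))) inv)

theorem runs_systemProg (hinv : Inverts inv C ω) (hB : inv.bound ≤ B) (hB3 : 3 ≤ B)
    (hn : 1 ≤ n) (hd : 2 ≤ d) (h : Holds B P t z {0, 1, 2, 3, 4, 5, 6, 7, 8, 9, 10} s)
    (hz : z ∈ domain k P) :
    Runs (systemProg inv B) s (10010 * loopBound n d + C * (kktSize n d : ℝ) ^ ω)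
      (fun s' => Holds B P t z {0, 1, 2, 3, 4, 5, 6, 7, 8, 9, 10} s' ∧ ∀ r c : KktIndex n d,
        s'.real 1 (kktEquiv n d r * kktSize n d + kktEquiv n d c) = (kkt P t z)⁻¹ r c) := by
  have hT := h.tables
  have hb := le_loopBound hn hd (R := kktSize n d * kktSize n d) le_rfl
  have hb2 : (2 : ℝ) ≤ loopBound n d := by
    have : (0 : ℝ) ≤ (kktSize n d * kktSize n d : ℕ) := by positivity
    linarith
  have hm1 : 1 ≤ kktSize n d := by simp only [kktSize]; omega
  let A : Matrix (Fin (kktSize n d)) (Fin (kktSize n d)) ℝ := (kkt P t z).submatrix (kktEquiv n d).symm (kktEquiv n d).symm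
  have hA : IsUnit A.det := by
    rw [Matrix.det_submatrix_equiv_self]
    exact kkt_isUnit_det hz (by omega)
  refine (((runs_fill (R := kktSize n d * kktSize n d) (c₂ := B + 9) (fun r => if h : r < kktSize n d * kktSize n d then
      A ⟨r / kktSize n d, Nat.div_lt_of_lt_mul h⟩ ⟨r % kktSize n d, Nat.mod_lt _ hm1⟩ else 0)
      (T := 10000 * loopBound n d) ?_ ?_ ?_).mono le_rfl
      (Q' := fun s' => Holds B P t z {0, 1, 2, 3, 4, 5, 6, 7, 8, 9, 10} s' ∧
        ∀ i j : Fin (kktSize n d), s'.real 0 (i * kktSize n d + j) = A i j) ?_).seq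
    (T' := ((NExp.var (B + 3)).cost + 2) + C * (kktSize n d : ℝ) ^ ω)
    fun s₁ hs₁ => (runs_inverse hinv hB hB3 hs₁.1 hm1 ?_ hA hs₁.2)).mono ?_ ?_
  · refine cost_le (x := ((kktSize n d * kktSize n d : ℕ) : ℝ) + 1) (by linarith) (by positivity) (by norm_num) ?_
    norm_num [kktEntry, CExp.ifEq, CExp.cost, RExp.cost, NExp.cost]
  · intro s' ha
    simp [NExp.eval, ha.nat, hT.size]
  · intro r hr s' ha e1 e2
    have h' := h.agree_low (by omega) ha
    obtain ⟨i, j, rfl⟩ := exists_mul_add hr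
    rw [dif_pos hr]
    simp only [(mul_add_div_mod (i : ℕ) j).1, (mul_add_div_mod (i : ℕ) j).2]
    refine eval_kktEntry h' e1 ?_ ?_
    · rw [Equiv.apply_symm_apply, h'.tables.hiM _ hr]
      exact (mul_add_div_mod (i : ℕ) j).1
    · rw [Equiv.apply_symm_apply, h'.tables.loM _ hr]
      exact (mul_add_div_mod (i : ℕ) j).2
  · rintro s' ⟨ha, hF⟩
    refine ⟨h.agree_low (by omega) ha, fun a b => ?_⟩
    rw [hF _ (mul_add_lt a b), dif_pos (mul_add_lt a b)]
    simp only [(mul_add_div_mod (a : ℕ) b).1, (mul_add_div_mod (a : ℕ) b).2]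
  · simp [NExp.eval, hs₁.1.tables.size]
  · norm_num [NExp.cost]
    linarith
  · rintro s' ⟨h1, h2⟩
    refine ⟨h1, fun r c => ?_⟩
    -- Inversion commutes with the renumbering of the unknowns.
    rw [h2, Matrix.inv_submatrix_equiv]
    simp

/-- From the current point compute the inverse of the Newton system. -/
def computeProg (inv : Prog) (B : ℕ) : Prog :=
  .seq (imageProg B) (.seq (normProg B) (.seq (residualProg B) (.seq (gramProg B)
    (.seq (inverseProg inv B 7 (.get (B + 1) (cnt₁ B)))
      (.seq (inverseProg inv B 8 (.sub (.get (B + 10) (cnt₁ B)) (.get (B + 1) (cnt₁ B))))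
        (systemProg inv B))))))

/-- The memory holds the current point `z`, and the inverse of its Newton system. -/
def HoldsNewton (B : ℕ) (P : Fin n → EuclideanSpace ℝ (Fin d)) (t : ℝ) (z : Point n d)
    (s : Memory) : Prop :=
  Holds B P t z {0, 1, 2, 3, 10} s ∧ ∀ r c : KktIndex n d,
    s.real 1 (kktEquiv n d r * kktSize n d + kktEquiv n d c) = (kkt P t z)⁻¹ r c

theorem runs_computeProg (hinv : Inverts inv C ω) (hB : inv.bound ≤ B) (hB3 : 3 ≤ B)
    (hn : 1 ≤ n) (hd : 2 ≤ d) (h : Holds B P t z {0, 1, 2, 3, 10} s) (hz : z ∈ domain k P) :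
    Runs (computeProg inv B) s
      (20000 * loopBound n d + C * (2 * (d : ℝ) ^ ω + (kktSize n d : ℝ) ^ ω))
      (HoldsNewton B P t z) := by
  have hL : 0 ≤ loopBound n d := by unfold loopBound; positivity
  refine ((runs_imageProg hn hd h (by simp) (by simp)).seq fun s₁ h₁ =>
    (runs_normProg hn hd h₁ (by simp)).seq fun s₂ h₂ =>
    (runs_residualProg hn hd h₂ (by simp) (by simp)).seq fun s₃ h₃ =>
    (runs_gramProg hn hd h₃ (by simp) (by simp)).seq fun s₄ h₄ =>
    (runs_inverseProg (j := 7) (A := z.X) hinv hB hB3 hn hd h₄ (by norm_num [RExp.cost, NExp.cost])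
      hz.1.det_pos.ne'.isUnit ?_ fun _ hx => hx).seq fun s₅ h₅ =>
    (runs_inverseProg (j := 8) (A := 1 - z.X) hinv hB hB3 hn hd h₅ (by norm_num [RExp.cost, NExp.cost])
      hz.2.1.det_pos.ne'.isUnit ?_ fun _ hx => hx).seq fun s₆ h₆ =>
    runs_systemProg hinv hB hB3 hn hd (h₆.mono (by decide)) hz).mono ?_
    fun s' hs' => ⟨hs'.1.mono (by decide), hs'.2⟩
  · intro a b s' h' hab
    have := h'.content 1 (by simp) a b
    simpa [RExp.eval, NExp.eval, hab] using this
  · intro a b s' h' hab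
    have e1 := h'.content 1 (by simp) a b
    have e2 := h'.content 10 (by simp) a b
    rw [RExp.eval, RExp.eval, RExp.eval, NExp.eval, NExp.eval, hab, e1, e2]
    rfl
  · linarith

/-- Subtract the direction in the last column of the inverse from the current point. -/
def updateProg (B : ℕ) : Prog :=
  .seq (fill (B + 8) (B + 1) (.mul (.var (B + 1)) (.var (B + 1)))
      (.ret (.sub (.get (B + 1) (cnt₁ B))
        (.get 1 (.add (.mul (cnt₁ B) (.var (B + 3))) (.sub (.var (B + 3)) (.lit 1)))))))
    (fill (B + 8) (B + 2) (.var B)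
      (.ret (.sub (.get (B + 2) (cnt₁ B))
        (.get 1 (.add (.mul (.add (.mul (.var (B + 1)) (.var (B + 1))) (cnt₁ B)) (.var (B + 3)))
          (.sub (.var (B + 3)) (.lit 1)))))))

theorem direction_X (x : KktIndex n d → ℝ) (a b : Fin d) :
    (direction x).X a b = x (.inl (a, b)) := rfl

theorem direction_y (x : KktIndex n d → ℝ) (i : Fin n) :
    (direction x).y i = x (.inr (.inl i)) := rfl

theorem kktEquiv_scale_eq : (kktEquiv n d (scaleIndex n d) : ℕ) = kktSize n d - 1 := by
  rw [kktEquiv_scale, kktSize]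
  omega

theorem runs_updateProg (hB3 : 3 ≤ B) (hn : 1 ≤ n) (hd : 2 ≤ d) (h : HoldsNewton B P t z s) :
    Runs (updateProg B) s (2000 * loopBound n d)
      (Holds B P t (z - direction fun r => (kkt P t z)⁻¹ r (scaleIndex n d)) {0, 1, 2, 3, 10}) := by
  obtain ⟨h, hinv⟩ := h
  have hT := h.tables
  have hb := le_loopBound hn hd (R := d * d) (by simp only [kktSize]; nlinarith)
  have hb' := le_loopBound hn hd (R := n) (by simp only [kktSize]; nlinarith)
  set m := kktSize n d with hm
  -- The scale unknown is numbered last, so the direction is in column m - 1 of the inverse. Real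
  -- array 1 stays intact because the two fills write above `B`.
  refine ((runs_fill (R := d * d) (c₂ := B + 9)
      (fun r => s.real (B + 1) r - s.real 1 (r * m + (m - 1)))
      (T := 1000 * loopBound n d) ?_ ?_ ?_).seq (T' := 1000 * loopBound n d)
    fun s₁ hs₁ => (runs_fill (R := n) (c₂ := B + 9)
      (fun r => s₁.real (B + 2) r - s.real 1 ((d * d + r) * m + (m - 1))) ?_ ?_ ?_).mono le_rfl ?_).mono
      ?_ fun _ h => h
  · refine cost_le (x := ((d * d : ℕ) : ℝ) + 1) (by linarith) (by positivity) (by norm_num) ?_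
    norm_num [CExp.cost, RExp.cost, NExp.cost]
  · intro s' ha
    simp [NExp.eval, ha.nat, hT.dim]
  · intro r hr s' ha e1 e2
    simp only [CExp.eval, RExp.eval, NExp.eval, e1, e2]
    rw [ha.real 1 (by omega), ha.nat (B + 3) (by omega) (by omega), hT.size]
  · refine cost_le (x := (n : ℝ) + 1) (by linarith) (by positivity) (by norm_num) ?_
    norm_num [CExp.cost, RExp.cost, NExp.cost]
  · intro s' ha
    simp [NExp.eval, ha.nat, hs₁.1.nat, hT.points]
  · intro r hr s' ha e1 e2
    simp only [CExp.eval, RExp.eval, NExp.eval, e1, e2]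
    rw [ha.real 1 (by omega), hs₁.1.real 1 (by omega), ha.nat (B + 3) (by omega) (by omega),
      ha.nat (B + 1) (by omega) (by omega), hs₁.1.nat (B + 3) (by omega) (by omega),
      hs₁.1.nat (B + 1) (by omega) (by omega), hT.size, hT.dim]
  · rintro s' ⟨ha', hF'⟩
    obtain ⟨ha, hF⟩ := hs₁
    have hreal : ∀ b, b ≠ B + 1 → b ≠ B + 2 → s'.real b = s.real b := fun b h1 h2 => by
      rw [ha'.real b h2, ha.real b h1]
    refine ⟨hT.congr fun c _ _ => ?_, fun j hj => ?_⟩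
    · rw [ha'.nat c (by omega) (by omega), ha.nat c (by omega) (by omega)]
    · simp only [Finset.mem_insert, Finset.mem_singleton] at hj
      have c0 : ∀ (i : Fin n) (a : Fin d), s.real (B + 0) (i * d + a) = P i a :=
        h.content 0 (by simp)
      have c1 : ∀ a b : Fin d, s.real (B + 1) (a * d + b) = z.X a b := h.content 1 (by simp)
      have c2 : ∀ i : Fin n, s.real (B + 2) i = z.y i := h.content 2 (by simp)
      have c3 : s.real (B + 3) 0 = t := h.content 3 (by simp)
      have c10 : ∀ a b : Fin d, s.real (B + 10) (a * d + b) = (1 : Matrix (Fin d) (Fin d) ℝ) a b :=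
        h.content 10 (by simp)
      rcases hj with rfl | rfl | rfl | rfl | rfl
      · change ∀ (i : Fin n) (a : Fin d), s'.real (B + 0) (i * d + a) = P i a
        rw [hreal _ (by omega) (by omega)]
        exact c0
      · change ∀ a b : Fin d, s'.real (B + 1) (a * d + b) = (z - _ : Point n d).X a b
        intro a b
        rw [ha'.real _ (by omega), hF _ (mul_add_lt a b), c1, ← kktEquiv_matrix (n := n) a b,
          ← kktEquiv_scale_eq, hinv, Point.X_sub, Matrix.sub_apply, direction_X]
      · change ∀ i : Fin n, s'.real (B + 2) i = (z - _ : Point n d).y i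
        intro i
        rw [hF' _ i.2, ha.real _ (by omega), c2, ← kktEquiv_vector i, ← kktEquiv_scale_eq, hinv,
          Point.y_sub, direction_y]
      · change s'.real (B + 3) 0 = t
        rw [hreal _ (by omega) (by omega)]
        exact c3
      · change ∀ a b : Fin d, s'.real (B + 10) (a * d + b) = (1 : Matrix (Fin d) (Fin d) ℝ) a b
        rw [hreal _ (by omega) (by omega)]
        exact c10
  · linarith

/-- The Newton decrement exceeds `1 / 100`. -/
def continueTest (B : ℕ) : Test :=
  .realLt (.mul (.ofNat (.lit 10001)) (.sub (.ofNat (.lit 0))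
    (.get 1 (.sub (.mul (.var (B + 3)) (.var (B + 3))) (.lit 1))))) (.ofNat (.lit 10000))

/-- The corner of the inverse is -κ with κ = 1/(1 + λ²), so the threshold λ = 1/100 is κ =
10000/10001; the test needs neither λ nor a square root. -/
theorem continueTest_holds (h : HoldsNewton B P t z s) :
    (continueTest B).Holds s ↔
      10001 * (-(kkt P t z)⁻¹ (scaleIndex n d) (scaleIndex n d)) < 10000 := by
  obtain ⟨h, hinv⟩ := h
  have e : kktSize n d * kktSize n d - 1 =
      kktEquiv n d (scaleIndex n d) * kktSize n d + kktEquiv n d (scaleIndex n d) := by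
    rw [kktEquiv_scale_eq]
    have : 1 ≤ kktSize n d := by rw [kktSize]; omega
    obtain ⟨q, hq⟩ := Nat.exists_eq_add_of_le this
    rw [hq, Nat.add_sub_cancel_left, show (1 + q) * (1 + q) = q * (1 + q) + q + 1 by ring,
      Nat.add_sub_cancel]
  simp only [continueTest, Test.Holds, RExp.eval, NExp.eval, h.tables.size, e, hinv]
  norm_num

/-- The Newton iteration. -/
def newtonProg (inv : Prog) (B : ℕ) : Prog :=
  .while (continueTest B) (.seq (updateProg B) (computeProg inv B))

theorem runs_newtonProg (hinv : Inverts inv C ω) (hC : 0 ≤ C) (hB : inv.bound ≤ B) (hB3 : 3 ≤ B)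
    (hn : 1 ≤ n) (hd : 2 ≤ d) (ht : 0 < t) (h : HoldsNewton B P t z s) (hz : z ∈ domain k P) {j : ℕ}
    (hj : relaxation P t z < (2 * n + 2 * n * Real.log (t / 2)) + j * (1 / 10001) ^ 2) :
    Runs (newtonProg inv B) s
      (j * (22100 * loopBound n d + C * (2 * (d : ℝ) ^ ω + (kktSize n d : ℝ) ^ ω)))
      (fun s' => ∃ z' : Point n d, Holds B P t z' {0, 1, 2, 3, 10} s' ∧ z' ∈ domain k P ∧
        decrement P t z' ≤ 1 / 100) := by
  have hL : 17 ≤ loopBound n d := by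
    have hn' : (1 : ℝ) ≤ n := by exact_mod_cast hn
    unfold loopBound
    nlinarith [sq_nonneg (d : ℝ)]
  have hC' : 0 ≤ C * (2 * (d : ℝ) ^ ω + (kktSize n d : ℝ) ^ ω) := by positivity
  have key := runs_while (c := continueTest B) (p := .seq (updateProg B) (computeProg inv B))
    (T := 2000 * loopBound n d
      + (20000 * loopBound n d + C * (2 * (d : ℝ) ^ ω + (kktSize n d : ℝ) ^ ω)))
    (by positivity)
    -- The potential counts the remaining steps: the value exceeds the lower bound by less than j
    -- units of (1/10001)². Level 0 contradicts `relaxation_ge`.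
    (I := fun j s' => ∃ z' : Point n d, HoldsNewton B P t z' s' ∧ z' ∈ domain k P ∧
      relaxation P t z' < (2 * n + 2 * n * Real.log (t / 2)) + j * (1 / 10001) ^ 2)
    (by
      rintro s' ⟨z', -, h1, h2⟩
      have := relaxation_ge ht h1
      simp only [Nat.cast_zero, zero_mul, add_zero] at h2
      linarith)
    (by
      rintro j s' ⟨z', h1, h2, h3⟩ hc
      rw [continueTest_holds h1] at hc
      obtain ⟨k0, k1, -, k2, k3⟩ := newton_step (t := t) h2 (by omega) (fun r => rfl) rfl
      refine (runs_updateProg hB3 hn hd h1).seq fun s₁ hs₁ =>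
        (runs_computeProg hinv hB hB3 hn hd hs₁ k2).mono le_rfl fun s₂ hs₂ => ⟨_, hs₂, k2, ?_⟩
      refine lt_of_le_of_lt k3 ?_
      push_cast at h3
      -- The passed test gives 1 - κ > 1/10001, so the decrease (1 - κ)² is worth at least one unit.
      nlinarith)
    j s ⟨z, h, hz, hj⟩
  refine key.mono ?_ ?_
  · refine mul_le_mul_of_nonneg_left ?_ (by positivity)
    have : ((continueTest B).cost : ℝ) ≤ 100 := by
      norm_num [continueTest, Test.cost, RExp.cost, NExp.cost]
    linarith
  · rintro s' ⟨hc, j', z', h1, h2, -⟩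
    refine ⟨z', h1.1, h2, ?_⟩
    rw [continueTest_holds h1] at hc
    obtain ⟨k0, k1, k2, -⟩ := newton_step (t := t) h2 (by omega) (fun r => rfl) rfl
    rw [k2]
    apply Real.sqrt_le_iff.2
    refine ⟨by norm_num, ?_⟩
    rw [div_le_iff₀ k0]
    push Not at hc
    linarith

end NewtonIteration

/-! ### Initialization, output and the total running time. -/

section Initialization

variable {n d k : ℕ} {P : Fin n → EuclideanSpace ℝ (Fin d)} {t : ℝ} {z : Point n d} {B : ℕ}
  {J : Finset ℕ} {s : Memory} {inv : Prog} {C ω : ℝ}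

/-- Read the sizes and set up the tables. -/
def tableProg (B : ℕ) : Prog :=
  .seq (.setNat B (.lit 0) (.get 0 (.lit 0))) (.seq (.setNat (B + 1) (.lit 0) (.get 0 (.lit 1)))
    (.seq (.setNat (B + 2) (.lit 0) (.get 0 (.lit 2)))
      (.seq (.setNat (B + 3) (.lit 0) (.add (.mul (.var (B + 1)) (.var (B + 1)))
        (.add (.var B) (.add (.var B) (.lit 2)))))
        (.seq (divTable (B + 8) (B + 4) (B + 5) (.mul (.add (.var B) (.var (B + 1))) (.var (B + 1)))
          (.var (B + 1)))
          (divTable (B + 8) (B + 6) (B + 7) (.mul (.var (B + 3)) (.var (B + 3)))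
            (.var (B + 3)))))))

theorem runs_tableProg (hB3 : 3 ≤ B) (hn : 1 ≤ n) (hd : 2 ≤ d) (h0 : s.nat 0 0 = n)
    (h1 : s.nat 0 1 = d) (h2 : s.nat 0 2 = k) :
    Runs (tableProg B) s (1000 * loopBound n d) (fun s' =>
      Tables B n d s' ∧ s'.nat (B + 2) 0 = k ∧ s'.real = s.real) := by
  have hb := le_loopBound hn hd (R := kktSize n d * kktSize n d) le_rfl
  have hb' := le_loopBound hn hd (R := (n + d) * d) (by
    have h : n + d ≤ kktSize n d := by simp only [kktSize]; nlinarith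
    exact Nat.mul_le_mul h (by omega))
  have hL : (2 : ℝ) ≤ loopBound n d := by
    have : (0 : ℝ) ≤ ((n + d) * d : ℕ) := by positivity
    linarith
  refine ((runs_setNat _ _ _ _).seq fun s₁ e₁ => (runs_setNat _ _ _ _).seq fun s₂ e₂ =>
    (runs_setNat _ _ _ _).seq fun s₃ e₃ => ((runs_setNat _ _ _ _).mono le_rfl
      (Q' := fun s₄ => s₄.nat B 0 = n ∧ s₄.nat (B + 1) 0 = d ∧ s₄.nat (B + 2) 0 = k ∧
        s₄.nat (B + 3) 0 = kktSize n d ∧ s₄.real = s.real) ?_).seq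
    fun s₄ e₄ => (runs_divTable (R := (n + d) * d) (m := d) (T := 100 * loopBound n d) (by omega)
      (by omega) (by omega) (by omega) ?_ ?_ ?_).seq fun s₅ e₅ =>
    (runs_divTable (R := kktSize n d * kktSize n d) (m := kktSize n d) (T := 100 * loopBound n d)
      (by rw [kktSize]; omega) (by omega) (by omega) (by omega) ?_ ?_ ?_).mono le_rfl ?_).mono ?_
    fun _ h => h
  · rintro s₄ e₄
    subst e₁ e₂ e₃ e₄
    have hB0 : (0 : ℕ) ≠ B := by omega
    simp [NExp.eval, writeNat_nat_ne, h0, h1, h2, hB0]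
  · refine cost_le hb' (by positivity) (by norm_num) ?_
    norm_num [NExp.cost]
  · intro s' hs'
    simp [NExp.eval, hs', e₄.1, e₄.2.1]
  · intro s' hs'
    simp [NExp.eval, hs', e₄.2.1]
  · refine cost_le hb (by positivity) (by norm_num) ?_
    norm_num [NExp.cost]
  · intro s' hs'
    simp only [NExp.eval]
    rw [hs' (B + 3) (by omega) (by omega) (by omega), e₅.1 (B + 3) (by omega) (by omega) (by omega),
      e₄.2.2.2.1]
  · intro s' hs'
    simp only [NExp.eval]
    rw [hs' (B + 3) (by omega) (by omega) (by omega), e₅.1 (B + 3) (by omega) (by omega) (by omega),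
      e₄.2.2.2.1]
  · rintro s' ⟨a1, a2, a3⟩
    obtain ⟨b1, b2, b3⟩ := e₅
    obtain ⟨c1, c2, c3, c4, c5⟩ := e₄
    refine ⟨⟨?_, ?_, ?_, fun r hr => ?_, fun r hr => ?_, fun r hr => (a3 r hr.le).1,
      fun r hr => (a3 r hr.le).2⟩, ?_, ?_⟩
    · rw [a1 _ (by omega) (by omega) (by omega), b1 _ (by omega) (by omega) (by omega), c1]
    · rw [a1 _ (by omega) (by omega) (by omega), b1 _ (by omega) (by omega) (by omega), c2]
    · rw [a1 _ (by omega) (by omega) (by omega), b1 _ (by omega) (by omega) (by omega), c4]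
    · rw [a1 _ (by omega) (by omega) (by omega), (b3 r hr.le).1]
    · rw [a1 _ (by omega) (by omega) (by omega), (b3 r hr.le).2]
    · rw [a1 _ (by omega) (by omega) (by omega), b1 _ (by omega) (by omega) (by omega), c3]
    · rw [a2, b2, c5]
  · simp only [NExp.cost]
    push_cast
    linarith

/-- Store the points, the identity matrix and `X₀`. -/
def matrixProg (B : ℕ) : Prog :=
  .seq (fill (B + 8) (B + 0) (.mul (.var B) (.var (B + 1))) (.ret (.get 0 (cnt₁ B))))
    (.seq (fill (B + 8) (B + 10) (.mul (.var (B + 1)) (.var (B + 1)))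
        (.ifEq (.get (B + 4) (cnt₁ B)) (.get (B + 5) (cnt₁ B)) (.ret (.ofNat (.lit 1)))
          (.ret (.ofNat (.lit 0)))))
      (fill (B + 8) (B + 1) (.mul (.var (B + 1)) (.var (B + 1)))
        (.ret (.mul (.div (.sub (.ofNat (.var (B + 1))) (.ofNat (.var (B + 2))))
          (.ofNat (.var (B + 1)))) (.get (B + 10) (cnt₁ B))))))

theorem runs_matrixProg (hB3 : 3 ≤ B) (hn : 1 ≤ n) (hd : 2 ≤ d) (hT : Tables B n d s)
    (hk : s.nat (B + 2) 0 = k) (hP : ∀ (i : Fin n) (j : Fin d), s.real 0 (i * d + j) = P i j) :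
    Runs (matrixProg B) s (1000 * loopBound n d)
      (Holds B P (t0 k P) (startPoint k P) {1, 10, 0}) := by
  have hb := le_loopBound hn hd (R := d * d) (by simp only [kktSize]; nlinarith)
  have hb' := le_loopBound hn hd (R := n * d) (by simp only [kktSize]; nlinarith)
  have hle : d * d ≤ (n + d) * d := Nat.mul_le_mul_right _ (by omega)
  -- The target point is fixed from the outset and the index set records which parts are already
  -- stored. Images and norms depend on X alone, so they can be computed before t₀ and y, which need
  -- them.
  have hH : Holds B P (t0 k P) (startPoint k P) ∅ s := ⟨hT, by simp⟩
  refine (((runs_fill (R := n * d) (c₂ := B + 9) (s.real 0) (T := 100 * loopBound n d)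
      ?_ ?_ ?_).mono le_rfl
      (Q' := fun s' => Holds B P (t0 k P) (startPoint k P) {0} s' ∧ s'.nat (B + 2) 0 = k) ?_).seq
    (T' := 100 * loopBound n d + 100 * loopBound n d)
    fun s₁ hs₁ => ((runs_fill (R := d * d) (c₂ := B + 9) (fun r => if r / d = r % d then 1 else 0)
      (T := 100 * loopBound n d) ?_ ?_ ?_).mono le_rfl
      (Q' := fun s' => Holds B P (t0 k P) (startPoint k P) {10, 0} s' ∧
        s'.nat (B + 2) 0 = k) ?_).seq
      (T' := 100 * loopBound n d) fun s₂ hs₂ =>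
      (runs_fill (R := d * d) (c₂ := B + 9)
        (fun r => ((d : ℝ) - k) / d * s₂.real (B + 10) r) ?_ ?_ ?_).mono le_rfl ?_).mono
      ?_ fun _ h => h
  · refine cost_le (x := ((n * d : ℕ) : ℝ) + 1) (by linarith) (by positivity) (by norm_num) ?_
    norm_num [CExp.cost, RExp.cost, NExp.cost]
  · intro s' ha
    simp [NExp.eval, ha.nat, hT.points, hT.dim]
  · intro r hr s' ha e1 e2
    rw [CExp.eval, RExp.eval, ha.real _ (by omega)]
    simp [NExp.eval, e1]
  · rintro s' ⟨ha, hF⟩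
    refine ⟨hH.insert_agree ha fun i a => ?_, by rw [ha.nat _ (by omega) (by omega), hk]⟩
    rw [hF _ (mul_add_lt i a), hP]
  · refine cost_le (x := ((d * d : ℕ) : ℝ) + 1) (by linarith) (by positivity) (by norm_num) ?_
    norm_num [CExp.ifEq, CExp.cost, RExp.cost, NExp.cost]
  · intro s' ha
    simp [NExp.eval, ha.nat, hs₁.1.tables.dim]
  · intro r hr s' ha e1 e2
    simp [CExp.eval_ifEq, CExp.eval, RExp.eval, NExp.eval, ha.nat, e1,
      hs₁.1.tables.hi r (by omega), hs₁.1.tables.lo r (by omega)]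
  · rintro s' ⟨ha, hF⟩
    refine ⟨hs₁.1.insert_agree ha fun a b => ?_, by rw [ha.nat _ (by omega) (by omega), hs₁.2]⟩
    rw [hF _ (mul_add_lt a b), Matrix.one_apply]
    simp only [(mul_add_div_mod (a : ℕ) b).1, (mul_add_div_mod (a : ℕ) b).2, Fin.ext_iff]
  · refine cost_le (x := ((d * d : ℕ) : ℝ) + 1) (by linarith) (by positivity) (by norm_num) ?_
    norm_num [CExp.cost, RExp.cost, NExp.cost]
  · intro s' ha
    simp [NExp.eval, ha.nat, hs₂.1.tables.dim]
  · intro r hr s' ha e1 e2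
    simp [CExp.eval, RExp.eval, NExp.eval, ha.nat, ha.real, e1, hs₂.1.tables.dim, hs₂.2]
  · rintro s' ⟨ha, hF⟩
    refine hs₂.1.insert_agree ha fun a b => ?_
    rw [hF _ (mul_add_lt a b), hs₂.1.content 10 (by simp) a b]
    rfl
  · have : 0 ≤ loopBound n d := by unfold loopBound; positivity
    linarith

/-- Compute `t₀` and the initial `y`. -/
def scaleProg (B : ℕ) : Prog :=
  .seq (fillSum (B + 8) (B + 9) (B + 11) (.lit 1) (.var B)
      (.sqrt (.add (.get (B + 5) (cnt₂ B)) .euler)))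
    (.seq (.setReal (B + 3) (.lit 0)
        (.div (.mul (.ofNat (.lit 2)) (.ofNat (.var B))) (.get (B + 11) (.lit 0))))
      (fill (B + 8) (B + 2) (.var B) (.ret (.add (.sqrt (.get (B + 5) (cnt₁ B)))
        (.div (.ofNat (.lit 2)) (.get (B + 3) (.lit 0)))))))

theorem runs_scaleProg (hn : 1 ≤ n) (hd : 2 ≤ d)
    (h : Holds B P (t0 k P) (startPoint k P) J s) (h5 : 5 ∈ J) :
    Runs (scaleProg B) s (1000 * loopBound n d)
      (Holds B P (t0 k P) (startPoint k P) (insert 2 (insert 3 (insert 11 J)))) := by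
  have hT := h.tables
  have hb := mul_le_loopBound hn hd (R := 1) (M := n) (by simp only [kktSize]; nlinarith)
  have hb' := le_loopBound hn hd (R := n) (by simp only [kktSize]; nlinarith)
  have hL : (2 : ℝ) ≤ loopBound n d := by
    have : (0 : ℝ) ≤ n := by positivity
    linarith
  have c5 : ∀ i : Fin n, s.real (B + 5) i = ‖applyTo (X0 d k) (P i)‖ ^ 2 := h.content 5 h5
  refine (((runs_fillSum (R := 1) (M := n)
      (fun _ l => Real.sqrt (s.real (B + 5) l + Real.exp 1)) (by omega)
      (T := 100 * loopBound n d) ?_ ?_ ?_ ?_).mono le_rfl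
      (Q' := fun s' => Holds B P (t0 k P) (startPoint k P) (insert 11 J) s' ∧
        s'.real (B + 11) 0 = ∑ i, y0 k P i) ?_).seq
    fun s₁ hs₁ => ((runs_setReal _ _ _ _).mono le_rfl
      (Q' := Holds B P (t0 k P) (startPoint k P) (insert 3 (insert 11 J))) ?_).seq
    fun s₂ hs₂ => (runs_fill (R := n) (c₂ := B + 9)
        (fun r => Real.sqrt (s₂.real (B + 5) r) + 2 / s₂.real (B + 3) 0)
        (T := 100 * loopBound n d) ?_ ?_ ?_).mono le_rfl ?_).mono
      ?_ fun _ h => h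
  · refine cost_le hb (by positivity) (by norm_num) ?_
    norm_num [RExp.cost, NExp.cost]
  · intro s' ha
    simp [NExp.eval]
  · intro s' ha
    simp [NExp.eval, ha.nat, hT.points]
  · intro r hr l hl s' ha e1 e2
    simp [RExp.eval, NExp.eval, ha.real, e2]
  · rintro s' ⟨ha, hF⟩
    refine ⟨h.insert_agree ha trivial, ?_⟩
    rw [hF 0 (by omega), Finset.sum_range]
    refine Finset.sum_congr rfl fun i _ => ?_
    rw [c5 i, y0]
  · rintro s' rfl
    refine hs₁.1.insert_agree ((Agree.refl _ _ _ _).writeReal _ _) ?_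
    change (Memory.writeReal _ _ _ _).real (B + 3) 0 = t0 k P
    simp [RExp.eval, NExp.eval, hs₁.1.tables.points, hs₁.2, t0]
  · refine cost_le (x := (n : ℝ) + 1) (by linarith) (by positivity) (by norm_num) ?_
    norm_num [CExp.cost, RExp.cost, NExp.cost]
  · intro s' ha
    simp [NExp.eval, ha.nat, hs₂.tables.points]
  · intro r hr s' ha e1 e2
    simp [CExp.eval, RExp.eval, NExp.eval, ha.real, e1]
  · rintro s' ⟨ha, hF⟩
    refine hs₂.insert_agree ha ?_
    change ∀ i : Fin n, s'.real (B + 2) i = ‖applyTo (X0 d k) (P i)‖ + 2 / t0 k P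
    intro i
    have c5' : s₂.real (B + 5) i = ‖applyTo (X0 d k) (P i)‖ ^ 2 :=
      hs₂.content 5 (by simp [h5]) i
    have c3 : s₂.real (B + 3) 0 = t0 k P := hs₂.content 3 (by simp)
    -- The values (y₀)_i enter only through their sum in t₀; the stored y uses the norms themselves.
    rw [hF _ i.2, c5', c3, Real.sqrt_sq (norm_nonneg _)]
  · norm_num [RExp.cost, NExp.cost]
    linarith

/-- Move to the starting point. -/
def initProg (B : ℕ) : Prog :=
  .seq (tableProg B) (.seq (matrixProg B) (.seq (imageProg B) (.seq (normProg B) (scaleProg B))))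

theorem runs_initProg (hB3 : 3 ≤ B) (hn : 1 ≤ n) (hd : 2 ≤ d) (h : HoldsInput s k P) :
    Runs (initProg B) s (5000 * loopBound n d)
      (Holds B P (t0 k P) (startPoint k P) {0, 1, 2, 3, 10}) := by
  obtain ⟨h0, h1, h2, h3⟩ := h
  refine ((runs_tableProg hB3 hn hd h0 h1 h2).seq fun s₁ hs₁ =>
    (runs_matrixProg (P := P) hB3 hn hd hs₁.1 hs₁.2.1 (by rw [hs₁.2.2]; exact h3)).seq
      fun s₂ hs₂ => (runs_imageProg hn hd hs₂ (by simp) (by simp)).seq fun s₃ hs₃ =>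
      (runs_normProg hn hd hs₃ (by simp)).seq fun s₄ hs₄ =>
      runs_scaleProg hn hd hs₄ (by simp)).mono (by linarith) fun s' hs' => hs'.mono (by decide)

/-- Write the current point to the output arrays. -/
def outputProg (B : ℕ) : Prog :=
  .seq (fill (B + 8) 1 (.mul (.var (B + 1)) (.var (B + 1))) (.ret (.get (B + 1) (cnt₁ B))))
    (fill (B + 8) 2 (.var B) (.ret (.get (B + 2) (cnt₁ B))))

theorem runs_outputProg (hB3 : 3 ≤ B) (hn : 1 ≤ n) (hd : 2 ≤ d)
    (h : Holds B P t z {0, 1, 2, 3, 10} s) :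
    Runs (outputProg B) s (1000 * loopBound n d) (fun s' => HoldsOutput s' z) := by
  have hT := h.tables
  have hb := le_loopBound hn hd (R := d * d) (by simp only [kktSize]; nlinarith)
  have hb' := le_loopBound hn hd (R := n) (by simp only [kktSize]; nlinarith)
  have c1 : ∀ a b : Fin d, s.real (B + 1) (a * d + b) = z.X a b := h.content 1 (by simp)
  have c2 : ∀ i : Fin n, s.real (B + 2) i = z.y i := h.content 2 (by simp)
  refine ((runs_fill (R := d * d) (c₂ := B + 9) (s.real (B + 1)) (T := 500 * loopBound n d)
      ?_ ?_ ?_).seq (T' := 500 * loopBound n d) fun s₁ hs₁ =>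
    (runs_fill (R := n) (c₂ := B + 9) (s.real (B + 2)) ?_ ?_ ?_).mono le_rfl ?_).mono (by linarith)
      fun _ h => h
  · refine cost_le (x := ((d * d : ℕ) : ℝ) + 1) (by linarith) (by positivity) (by norm_num) ?_
    norm_num [CExp.cost, RExp.cost, NExp.cost]
  · intro s' ha
    simp [NExp.eval, ha.nat, hT.dim]
  · intro r hr s' ha e1 e2
    rw [CExp.eval, RExp.eval, ha.real _ (by omega)]
    simp [NExp.eval, e1]
  · refine cost_le (x := (n : ℝ) + 1) (by linarith) (by positivity) (by norm_num) ?_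
    norm_num [CExp.cost, RExp.cost, NExp.cost]
  · intro s' ha
    simp [NExp.eval, ha.nat, hs₁.1.nat, hT.points]
  · intro r hr s' ha e1 e2
    rw [CExp.eval, RExp.eval, ha.real _ (by omega), hs₁.1.real _ (by omega)]
    simp [NExp.eval, e1]
  · rintro s' ⟨ha, hF⟩
    refine ⟨fun a b => ?_, fun i => ?_⟩
    · rw [ha.real _ (by omega), hs₁.2 _ (mul_add_lt a b), c1]
    · rw [hF _ i.2, c2]

/-- The program that computes a point with small Newton decrement. -/
def mainProg (inv : Prog) : Prog :=
  let B := inv.bound + 3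
  .seq (initProg B) (.seq (computeProg inv B) (.seq (newtonProg inv B) (outputProg B)))

/-- For m = 1 the time bound is C itself, and a running time is nonnegative. -/
theorem Inverts.nonneg (hinv : Inverts inv C ω) : 0 ≤ C := by
  obtain ⟨s', τ, -, h, -⟩ := hinv 1 le_rfl 1 (by simp) ⟨fun _ _ => 1, fun _ _ => 1⟩ rfl
    (fun i j => by rw [Subsingleton.elim i j]; simp)
  simp only [Nat.cast_one, Real.one_rpow, mul_one] at h
  exact (Nat.cast_nonneg τ).trans h

theorem loopBound_le (hω : 2 ≤ ω) (hn : 1 ≤ n) :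
    loopBound n d ≤ 17 * ((n : ℝ) + (d : ℝ) ^ 2) ^ ω := by
  have hn' : (1 : ℝ) ≤ n := by exact_mod_cast hn
  have h1 : (1 : ℝ) ≤ (n : ℝ) + (d : ℝ) ^ 2 := by nlinarith [sq_nonneg (d : ℝ)]
  have := Real.rpow_le_rpow_of_exponent_le h1 hω
  rw [Real.rpow_two] at this
  unfold loopBound
  linarith

theorem inverse_cost_le (hω : 2 ≤ ω) (hn : 1 ≤ n) (hd : 2 ≤ d) :
    2 * (d : ℝ) ^ ω + (kktSize n d : ℝ) ^ ω ≤ (2 + 3 ^ ω) * ((n : ℝ) + (d : ℝ) ^ 2) ^ ω := by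
  have hn' : (1 : ℝ) ≤ n := by exact_mod_cast hn
  have hd' : (2 : ℝ) ≤ d := by exact_mod_cast hd
  have h1 : (d : ℝ) ^ ω ≤ ((n : ℝ) + (d : ℝ) ^ 2) ^ ω :=
    Real.rpow_le_rpow (by positivity) (by nlinarith) (by linarith)
  have h2 : (kktSize n d : ℝ) ^ ω ≤ (3 * ((n : ℝ) + (d : ℝ) ^ 2)) ^ ω := by
    refine Real.rpow_le_rpow (by positivity) ?_ (by linarith)
    simp only [kktSize]
    push_cast
    nlinarith
  rw [Real.mul_rpow (by norm_num) (by positivity)] at h2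
  linarith

theorem runs_mainProg (hinv : Inverts inv C ω) (hω : 2 ≤ ω) (hn : 1 ≤ n) (hk : 1 ≤ k)
    (hkd : k < d) (h : HoldsInput s k P) :
    Runs (mainProg inv) s (300000001 * (400000 + C * (2 + 3 ^ ω)) *
        (((n : ℝ) + (d : ℝ) ^ 2) ^ ω * ((n : ℝ) + (d : ℝ) * Real.log d)))
      (fun s' => ∃ z : Point n d, HoldsOutput s' z ∧ z ∈ domain k P ∧
        decrement P (t0 k P) z ≤ 1 / 100) := by
  have hd : 2 ≤ d := by omega
  have hC := hinv.nonneg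
  have hn' : (1 : ℝ) ≤ n := by exact_mod_cast hn
  have hlog : 0 ≤ (d : ℝ) * Real.log d := mul_nonneg (by positivity) (Real.log_natCast_nonneg d)
  -- The offset 3 also keeps the working arrays apart from real arrays 0, 1, 2, which carry input,
  -- inverse and output.
  set B := inv.bound + 3 with hBdef
  have hB : inv.bound ≤ B := by omega
  have hB3 : 3 ≤ B := by omega
  have hmem := startPoint_mem_domain (P := P) hn hk hkd
  have hstart := relaxation_startPoint_le (P := P) hn hk hkd
  -- The iteration budget is the initial excess over the lower bound, divided by the guaranteed
  -- decrease (1/10001)² and rounded up strictly.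
  obtain ⟨j, hj1, hj2⟩ : ∃ j : ℕ,
      2 * n + 2 * d * Real.log d < j * (1 / 10001 : ℝ) ^ 2 ∧
      (j : ℝ) ≤ (2 * n + 2 * d * Real.log d) * 10001 ^ 2 + 1 := by
    refine ⟨⌊(2 * n + 2 * d * Real.log d) * 10001 ^ 2⌋₊ + 1, ?_, ?_⟩
    · have := Nat.lt_floor_add_one ((2 * n + 2 * d * Real.log d) * 10001 ^ 2)
      push_cast
      rw [one_div, inv_pow, ← div_eq_mul_inv, lt_div_iff₀ (by norm_num)]
      exact this
    · push_cast
      have h0 : 0 ≤ (2 * n + 2 * d * Real.log d) * 10001 ^ 2 := by nlinarith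
      linarith [Nat.floor_le h0]
  refine ((runs_initProg hB3 hn hd h).seq fun s₁ hs₁ =>
    (runs_computeProg hinv hB hB3 hn hd hs₁ hmem).seq fun s₂ hs₂ =>
    (runs_newtonProg hinv hC hB hB3 hn hd (t0_pos hn) hs₂ hmem (j := j) (by linarith)).seq
      (T' := 1000 * loopBound n d) (fun s₃ ⟨z, hz1, hz2, hz3⟩ =>
        (runs_outputProg hB3 hn hd hz1).mono le_rfl fun s₄ hs₄ => ⟨z, hs₄, hz2, hz3⟩)).mono ?_
    fun _ h => h
  have hL := loopBound_le (d := d) hω hn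
  have hI := mul_le_mul_of_nonneg_left (inverse_cost_le hω hn hd) hC
  set S := (n : ℝ) + (d : ℝ) * Real.log d with hS
  have hS1 : 1 ≤ S := by linarith
  set W := ((n : ℝ) + (d : ℝ) ^ 2) ^ ω with hW
  have hW0 : 0 ≤ W := by positivity
  set D := C * (2 + (3 : ℝ) ^ ω) with hD
  have hD0 : 0 ≤ D := by positivity
  rw [← mul_assoc C, ← hD] at hI
  have hiter : 22100 * loopBound n d + C * (2 * (d : ℝ) ^ ω + (kktSize n d : ℝ) ^ ω) ≤
      (400000 + D) * W := by linarith
  have hj3 : (j : ℝ) ≤ 200040003 * S := by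
    have : (2 * n + 2 * d * Real.log d) = 2 * S := by rw [hS]; ring
    rw [this] at hj2
    linarith
  have h1 := mul_le_mul_of_nonneg_left hiter (Nat.cast_nonneg (α := ℝ) j)
  have hDW : 0 ≤ (400000 + D) * W := by positivity
  have h2 := mul_le_mul_of_nonneg_right hj3 hDW
  have h3 : (400000 + D) * W ≤ S * ((400000 + D) * W) := le_mul_of_one_le_left hDW hS1
  have h4 : 0 ≤ D * W := by positivity
  linarith

end Initialization

end KSM

end

theorem mainTheorem4 (ω : ℝ) (hω : KSM.InversionTime ω) :
    (∀ (n d k : ℕ), 1 ≤ n → 1 ≤ k → k < d → ∀ P : Fin n → EuclideanSpace ℝ (Fin d),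
      KSM.initialPoint k P ∈ KSM.domain k P ∧
      BddBelow (KSM.relaxation P (KSM.t0 k P) '' KSM.domain k P) ∧
      (1 < KSM.t0 k P →
        KSM.relaxation P (KSM.t0 k P) (KSM.initialPoint k P)
            - sInf (KSM.relaxation P (KSM.t0 k P) '' KSM.domain k P)
          ≤ 2 * (n : ℝ) + 4 * (d : ℝ) * Real.log d)) ∧
    ∃ (prog : KSM.Prog) (C : ℝ),
      ∀ (n d k : ℕ), 1 ≤ n → 1 ≤ k → k < d → ∀ P : Fin n → EuclideanSpace ℝ (Fin d),
        ∀ s : KSM.Memory, KSM.HoldsInput s k P →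
          ∃ (s' : KSM.Memory) (τ : ℕ) (z : KSM.Point n d),
            KSM.Exec prog s s' τ ∧
            (τ : ℝ) ≤ C * (((n : ℝ) + (d : ℝ) ^ 2) ^ ω * ((n : ℝ) + (d : ℝ) * Real.log d)) ∧
            KSM.HoldsOutput s' z ∧
            z ∈ KSM.domain k P ∧
            KSM.decrement P (KSM.t0 k P) z ≤ 1 / 100 := by
  have hω2 := hω.two_le
  obtain ⟨inv, C, hinv⟩ := hω
  refine ⟨fun n d k hn hk hkd P => ⟨KSM.initialPoint_mem_domain hk hkd, ?_,
    KSM.relaxation_initialPoint_sub_sInf_le hn hk hkd⟩,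
    KSM.mainProg inv, 300000001 * (400000 + C * (2 + 3 ^ ω)), ?_⟩
  · refine ⟨2 * n + 2 * n * Real.log (KSM.t0 k P / 2), ?_⟩
    rintro _ ⟨z, hz, rfl⟩
    exact KSM.relaxation_ge (KSM.t0_pos hn) hz
  · intro n d k hn hk hkd P s hs
    obtain ⟨s', τ, h1, h2, z, h3, h4, h5⟩ := KSM.runs_mainProg hinv hω2 hn hk hkd hs
    exact ⟨s', τ, z, h1, h2, h3, h4, h5⟩
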